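/- **Setting.** Let $V\subseteq H$ be real Hilbert spaces, the inclusion being dense, continuous and compact; $V'$ is the dual of $V$, $H\subseteq V'$ through $\langle h,z\rangle_{V',V}=(h,z)_H$. Let $A\in\mathcal L(V,V')$ be symmetric and such that $(y,z)\mapsto\langle Ay,z\rangle_{V',V}$ is a complete scalar product on $V$; $V$ is endowed with this scalar product $(y,z)_V$. With $(e_n)$ a complete orthonormal system in $H$ of eigenvectors, $Ae_n=\alpha_ne_n$, let $A^\rho y=\sum_n\alpha_n^\rho (y,e_n)_H\,e_n\in V'$ for $y\in V$, $\rho\le 1$. **Actuators.** Let $\sigma:\{1,2,\dots\}\to\{1,2,\dots\}$ be strictly increasing. For each $M\ge1$ let $\mathcal U_M\subset H$ and $\widetilde{\mathcal U}_M\subset V$ be the spans of $\sigma(M)$ linearly independent vectors, with $H=\mathcal U_M\oplus\widetilde{\mathcal U}_M^\perp$ (equivalently $H=\widetilde{\mathcal U}_M\oplus\mathcal U_M^\perp$), and assume $$\lim_{M\to\infty}\ \inf_{\theta\in (V\cap\,\mathcal U_M^\perp)\setminus\{0\}}\frac{|\theta|_V^2}{|\theta|_H^2}=+\infty .$$ $P_{\mathcal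 U_M}$ is the orthogonal projection in $H$ onto $\mathcal U_M$; $P_F^G$ is the oblique projection in $H$ onto $F$ along $G$. $P_{\mathcal U_M}^{\widetilde{\mathcal U}_M^\perp}$ is extended to $V'$ by: $P_{\mathcal U_M}^{\widetilde{\mathcal U}_M^\perp}f\in\mathcal U_M$ and $(P_{\mathcal U_M}^{\widetilde{\mathcal U}_M^\perp}f,\phi)_H=\langle f,P_{\widetilde{\mathcal U}_M}^{\mathcal U_M^\perp}\phi\rangle_{V',V}$ for all $\phi\in V$. **Perturbations.** Fix $n$ and exponents $\zeta_{1j},\zeta_{2j},\delta_{1j},\delta_{2j}\ge0$, $1\le j\le n$, with $\zeta_{2j}+\delta_{2j}<1$ and $\delta_{1j}+\delta_{2j}\ge1$. For constants $C_{\rm rc},C_{\mathcal N}\ge0$ consider * $A_{\rm rc}\in L^\infty((0,\infty),\mathcal L(H,V')+\mathcal L(V,H))$ with norm at most $C_{\rm rc}$; * $\mathcal N:(0,\infty)\times V\to V'$ such that $\mathcal N(\cdot,y)\in L^1_{\rm loc}((0,\infty),V')$ for each $y\in V$; for a.e. $t>0$, $\mathcal N(t,\cdot)$ is continuous with $|\mathcal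 N(t,y)|_{V'}\le\mathfrak i_t(|y|_V)$ for some continuous nondecreasing $\mathfrak i_t:[0,\infty)\to\mathbb R$ with $\mathfrak i_t(0)=0$; and for all $t>0$, $y_1,y_2\in V$, $$|\mathcal N(t,y_1)-\mathcal N(t,y_2)|_{V'}\le C_{\mathcal N}\sum_{j=1}^n\left(|y_1|_H^{\zeta_{1j}}|y_1|_V^{\zeta_{2j}}+|y_2|_H^{\zeta_{1j}}|y_2|_V^{\zeta_{2j}}\right)|y_1-y_2|_H^{\delta_{1j}}|y_1-y_2|_V^{\delta_{2j}} .$$ **Claim.** Let $\rho\le1$. There are functions $\overline M(R,\mu,C_{\rm rc},C_{\mathcal N})\in\{1,2,\dots\}$ and $\overline\lambda(M,R,\mu,C_{\rm rc},C_{\mathcal N})\ge0$, nondecreasing in each of their arguments and depending otherwise only on $V,H,A$, the families $(\mathcal U_M),(\widetilde{\mathcal U}_M)$, the exponents and $\rho$, such that the following holds for all $R,\mu>0$, all $C_{\rm rc},C_{\mathcal N}\ge0$, all $A_{\rm rc}$ and $\mathcal N$ as above, all $M\ge\overline M(R,\mu,C_{\rm rc},C_{\mathcal N})$ and all $\lambda>0$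 with $\lambda\ge\overline\lambda(M,R,\mu,C_{\rm rc},C_{\mathcal N})$. (In particular $M=\overline M(R,\mu,C_{\rm rc},C_{\mathcal N})$ is admissible, with a threshold for $\lambda$ that is a nondecreasing function of $R,\mu,C_{\rm rc},C_{\mathcal N}$.) For each $y_0\in H$ with $|y_0|_H<R$, each of the two systems $$\dot y+Ay+A_{\rm rc}(t)y+\mathcal N(t,y)=-\lambda P_{\mathcal U_M}y,\qquad y(0)=y_0,$$ $$\dot y+Ay+A_{\rm rc}(t)y+\mathcal N(t,y)=-\lambda P_{\mathcal U_M}^{\widetilde{\mathcal U}_M^\perp}A^\rho P_{\widetilde{\mathcal U}_M}^{\mathcal U_M^\perp}y,\qquad y(0)=y_0,$$ has exactly one global weak solution ($y\in C([0,\infty),H)$, $y\in L^2((0,T),V)$ and $\dot y\in L^2((0,T),V')$ for all $T>0$), and it satisfies $$|y(t)|_H\le e^{-\mu(t-s)}|y(s)|_H\quad\text{for all } t\ge s\ge0 .$$ In particular, $t\mapsto|y(t)|_H$ is strictly decreasing at each time $s\ge 0$ with $y(s)\ne0$: $|y(t)|_H<|y(s)|_H$ for $t>s$ and $|y(s)|_H<|y(r)|_H$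 for $0\le r<s$. -/

import Mathlib

open MeasureTheory Filter Topology Set
open scoped NNReal ENNReal RealInnerProductSpace

/-- A pair of real Hilbert spaces `V ⊆ H` with dense, continuous and compact inclusion `emb`, together
with the diffusion operator `A : V → V'` (`V'` is `StrongDual ℝ V` with its dual norm). The space `V`
carries the scalar product `(y, z)_V = ⟨A y, z⟩`; that this is a complete scalar product making `A`
symmetric is then the Hilbert space structure of `V`. -/
structure DiffusionSetting (V H : Type*)
    [NormedAddCommGroup V] [InnerProductSpace ℝ V] [CompleteSpace V]
    [NormedAddCommGroup H] [InnerProductSpace ℝ H] [CompleteSpace H] where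
  emb : V →L[ℝ] H
  emb_injective : Function.Injective emb
  emb_denseRange : DenseRange emb
  emb_compact : IsCompactOperator emb
  A : V →L[ℝ] StrongDual ℝ V
  A_apply : ∀ y z : V, A y z = ⟪y, z⟫

namespace DiffusionSetting

instance finiteDimensional_span_range {E ι : Type*} [AddCommGroup E] [Module ℝ E] [Finite ι]
    (f : ι → E) : FiniteDimensional ℝ (Submodule.span ℝ (range f)) :=
  FiniteDimensional.span_of_finite ℝ (finite_range f)

noncomputable section

variable {V H : Type*}
  [NormedAddCommGroup V] [InnerProductSpace ℝ V] [CompleteSpace V]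
  [NormedAddCommGroup H] [InnerProductSpace ℝ H] [CompleteSpace H]
  (S : DiffusionSetting V H)

/-- The inclusion `H ⊆ V'` given by `⟨h, z⟩_{V',V} = (h, z)_H`. -/
def incl (h : H) : StrongDual ℝ V := (innerSL ℝ h).comp S.emb

/-! ### Fractional powers of `A` -/

/-- The eigenspace `{v ∈ V | A v = α v}` (equality in `V'`). It is `{0}` unless `α > 0`. -/
def eigenspace (α : ℝ) : Submodule ℝ V where
  carrier := {v | S.A v = α • S.incl (S.emb v)}
  zero_mem' := by simp [incl]
  add_mem' := by
    intro a b ha hb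
    simp only [Set.mem_ofPred_eq, incl, map_add, ContinuousLinearMap.add_comp, smul_add] at *
    rw [ha, hb]
  smul_mem' := by
    intro c a ha
    simp only [Set.mem_ofPred_eq, incl, map_smul, ContinuousLinearMap.smul_comp] at *
    rw [ha, smul_comm]

theorem mem_eigenspace {α : ℝ} {v : V} :
    v ∈ S.eigenspace α ↔ ∀ z : V, ⟪v, z⟫ = α * ⟪S.emb v, S.emb z⟫ := by
  constructor
  · intro h z
    have := DFunLike.congr_fun (show S.A v = α • S.incl (S.emb v) from h) z
    simpa [S.A_apply, incl] using this
  · intro h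
    change S.A v = α • S.incl (S.emb v)
    ext z
    simpa [S.A_apply, incl] using h z

theorem isClosed_eigenspace (α : ℝ) : IsClosed (S.eigenspace α : Set V) := by
  have : (S.eigenspace α : Set V) =
      ⋂ z : V, {v | ⟪v, z⟫ = α * ⟪S.emb v, S.emb z⟫} := by
    ext v
    simp [S.mem_eigenspace]
  rw [this]
  refine isClosed_iInter fun z => isClosed_eq (by fun_prop) (by fun_prop)

instance (α : ℝ) : CompleteSpace (S.eigenspace α) := (S.isClosed_eigenspace α).completeSpace_coe

/-- The component of `y ∈ V` in the eigenspace of `α`. The eigenspaces are orthogonal to each other both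
in `V` and in `H`, and the `V`-orthogonal projection used here is also the `H`-orthogonal one, see
`inner_sub_eigenComponent`. -/
def eigenComponent (α : ℝ) (y : V) : V := (S.eigenspace α).starProjection y

theorem inner_sub_eigenComponent {α : ℝ} (hα : α ≠ 0) (y : V) {w : V} (hw : w ∈ S.eigenspace α) :
    ⟪S.emb (y - S.eigenComponent α y), S.emb w⟫ = 0 := by
  have h1 : ⟪w, y - S.eigenComponent α y⟫ = 0 := by
    have := (S.eigenspace α).sub_starProjection_mem_orthogonal y
    exact this w hw
  rw [S.mem_eigenspace.1 hw, mul_eq_zero] at h1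
  rw [real_inner_comm]
  exact h1.resolve_left hα

/-- The fractional power `A^ρ y = ∑ₙ αₙ^ρ yₙ eₙ` of `y = ∑ₙ yₙ eₙ ∈ V` as a series in `V'`, where
the terms with equal eigenvalues `αₙ = α` are collected, `∑_{αₙ = α} yₙ eₙ` being the component of `y`
in the eigenspace of `α`. The series converges (unconditionally) in `V'` for all `ρ ≤ 1`, see
`summable_fracPow`. -/
def fracPow (ρ : ℝ) (y : V) : StrongDual ℝ V :=
  ∑' α : ℝ, α ^ ρ • S.incl (S.emb (S.eigenComponent α y))

theorem eigenspace_eq_zero_or {α : ℝ} {v : V} (hv : v ∈ S.eigenspace α) :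
    v = 0 ∨ (0 < α ∧ (‖S.emb‖ ^ 2)⁻¹ ≤ α ∧ 0 < ‖S.emb‖ ^ 2) := by
  by_cases h0 : v = 0
  · exact Or.inl h0
  right
  have h1 : ‖v‖ ^ 2 = α * ‖S.emb v‖ ^ 2 := by
    have := S.mem_eigenspace.1 hv v
    rwa [real_inner_self_eq_norm_sq, real_inner_self_eq_norm_sq] at this
  have hvpos : 0 < ‖v‖ ^ 2 := by positivity
  have hα : 0 < α := by
    by_contra hα
    nlinarith [sq_nonneg ‖S.emb v‖]
  have h2 : ‖S.emb v‖ ^ 2 ≤ ‖S.emb‖ ^ 2 * ‖v‖ ^ 2 := by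
    rw [← mul_pow]
    gcongr
    exact S.emb.le_opNorm v
  have h3 : 1 ≤ α * ‖S.emb‖ ^ 2 := by
    by_contra hlt
    push Not at hlt
    nlinarith [mul_le_mul_of_nonneg_left h2 hα.le]
  have h4 : 0 < ‖S.emb‖ ^ 2 := by
    by_contra hlt
    nlinarith
  exact ⟨hα, by rw [inv_eq_one_div, div_le_iff₀ h4]; exact h3, h4⟩

theorem orthogonalFamily_eigenspace :
    OrthogonalFamily ℝ (fun α : ℝ => S.eigenspace α) fun α => (S.eigenspace α).subtypeₗᵢ := by
  intro α β hαβ v w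
  have h1 := S.mem_eigenspace.1 v.2 w
  have h2 := S.mem_eigenspace.1 w.2 v
  rw [real_inner_comm, real_inner_comm (S.emb v)] at h2
  have h3 : (α - β) * ⟪S.emb v, S.emb w⟫ = 0 := by linarith
  have h4 : ⟪S.emb v, S.emb w⟫ = 0 := (mul_eq_zero.1 h3).resolve_left (sub_ne_zero.2 hαβ)
  change ⟪(v : V), (w : V)⟫ = 0
  rw [h1, h4, mul_zero]

theorem summable_norm_eigenComponent_sq (y : V) :
    Summable fun α : ℝ => ‖S.eigenComponent α y‖ ^ 2 := by
  refine summable_of_sum_le (c := ‖y‖ ^ 2) (fun _ => sq_nonneg _) fun s => ?_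
  set p : V := ∑ α ∈ s, S.eigenComponent α y with hp
  have h1 : ‖p‖ ^ 2 = ∑ α ∈ s, ‖S.eigenComponent α y‖ ^ 2 := by
    have := S.orthogonalFamily_eigenspace.norm_sum
      (fun α => (S.eigenspace α).orthogonalProjectionOnto y) s
    exact this
  have h2 : ⟪p, y⟫ = ∑ α ∈ s, ‖S.eigenComponent α y‖ ^ 2 := by
    rw [hp, sum_inner]
    refine Finset.sum_congr rfl fun α _ => ?_
    have h3 : ⟪S.eigenComponent α y, y - S.eigenComponent α y⟫ = 0 :=
      (S.eigenspace α).sub_starProjection_mem_orthogonal y _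
        ((S.eigenspace α).starProjection_apply_mem y)
    rw [inner_sub_right, real_inner_self_eq_norm_sq] at h3
    linarith
  have h5 := real_inner_le_norm p y
  rw [h2, ← h1] at h5
  rw [← h1]
  nlinarith [norm_nonneg p, norm_nonneg y, sq_nonneg (‖p‖ - ‖y‖)]

/-- The series defining `A^ρ y`, for `ρ ≤ 1` and `y ∈ V`, converges in `V'`. -/
theorem summable_fracPow {ρ : ℝ} (hρ : ρ ≤ 1) (y : V) :
    Summable fun α : ℝ => α ^ ρ • S.incl (S.emb (S.eigenComponent α y)) := by
  have hmem : ∀ α, S.eigenComponent α y ∈ S.eigenspace α := fun α =>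
    (S.eigenspace α).starProjection_apply_mem y
  let f : ∀ α : ℝ, S.eigenspace α := fun α =>
    ⟨α ^ (ρ - 1) • S.eigenComponent α y, (S.eigenspace α).smul_mem _ (hmem α)⟩
  have hf : Summable fun α => ‖f α‖ ^ 2 := by
    refine Summable.of_nonneg_of_le (fun _ => sq_nonneg _) (fun α => ?_)
      ((S.summable_norm_eigenComponent_sq y).mul_left ((((‖S.emb‖ ^ 2)⁻¹) ^ (ρ - 1)) ^ 2))
    change ‖α ^ (ρ - 1) • S.eigenComponent α y‖ ^ 2 ≤ _
    rcases S.eigenspace_eq_zero_or (hmem α) with h | ⟨h1, h2, h3⟩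
    · simp [h]
    · rw [norm_smul, mul_pow, Real.norm_eq_abs, abs_of_nonneg (Real.rpow_nonneg h1.le _)]
      gcongr ?_ ^ 2 * _
      exact Real.rpow_le_rpow_of_nonpos (inv_pos.2 h3) h2 (by linarith)
  have hs : Summable fun α => ((f α : S.eigenspace α) : V) :=
    (S.orthogonalFamily_eigenspace.summable_iff_norm_sq_summable f).2 hf
  have hA := hs.map S.A S.A.continuous
  refine hA.congr fun α => ?_
  change S.A (α ^ (ρ - 1) • S.eigenComponent α y) = _
  rcases S.eigenspace_eq_zero_or (hmem α) with h | ⟨h1, -, -⟩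
  · simp [h, incl]
  · rw [map_smul, show S.A (S.eigenComponent α y) = _ from hmem α, smul_smul]
    congr 1
    rw [Real.rpow_sub_one h1.ne', div_mul_cancel₀ _ h1.ne']

/-! ### Oblique projections -/

/-- If `H = U ⊕ W^⊥` then `H = W ⊕ U^⊥`, for finite-dimensional `U` and `W`. -/
theorem isCompl_swap {U W : Submodule ℝ H} [FiniteDimensional ℝ U] [FiniteDimensional ℝ W]
    (h : IsCompl U Wᗮ) : IsCompl W Uᗮ := by
  refine ⟨?_, ?_⟩
  · rw [Submodule.disjoint_def]
    intro w hw hwU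
    have hw' : w ∈ Wᗮᗮ := Submodule.le_orthogonal_orthogonal W hw
    have : w ∈ (U ⊔ Wᗮ)ᗮ := by
      rw [← Submodule.inf_orthogonal]
      exact ⟨hwU, hw'⟩
    rw [h.sup_eq_top] at this
    simpa using this
  · rw [codisjoint_iff, eq_top_iff]
    rintro x -
    let K : Submodule ℝ H := W.map (U.starProjection : H →ₗ[ℝ] H)
    have hKU : K ≤ U := by
      rintro _ ⟨w, -, rfl⟩
      exact U.starProjection_apply_mem w
    have hUK : U ≤ K := by
      intro u hu
      set d := u - K.starProjection u with hd
      have hdU : d ∈ U := U.sub_mem hu (hKU (K.starProjection_apply_mem u))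
      have hdK : d ∈ Kᗮ := K.sub_starProjection_mem_orthogonal u
      have hdW : d ∈ Wᗮ := by
        intro w hw
        have h1 : ⟪U.starProjection w, d⟫ = 0 := hdK _ ⟨w, hw, rfl⟩
        have h2 : ⟪d, w - U.starProjection w⟫ = 0 :=
          U.sub_starProjection_mem_orthogonal w d hdU
        rw [inner_sub_right, real_inner_comm, real_inner_comm _ d, h1, sub_zero] at h2
        exact h2
      have h0 : d = 0 := (Submodule.disjoint_def.1 h.disjoint) d hdU hdW
      rw [sub_eq_zero.1 h0]
      exact K.starProjection_apply_mem u
    obtain ⟨w, hw, hwx⟩ := hUK (U.starProjection_apply_mem x)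
    refine Submodule.mem_sup.2 ⟨w, hw, x - w, ?_, by abel⟩
    intro u hu
    have h1 : ⟪u, x - U.starProjection x⟫ = 0 := U.sub_starProjection_mem_orthogonal x u hu
    have h2 : ⟪u, w - U.starProjection w⟫ = 0 := U.sub_starProjection_mem_orthogonal w u hu
    rw [inner_sub_right] at h1 h2 ⊢
    have h3 : U.starProjection w = U.starProjection x := hwx
    rw [h3] at h2
    linarith

section Oblique

variable (U : Submodule ℝ H) (W : Submodule ℝ V) [FiniteDimensional ℝ U] [FiniteDimensional ℝ W]

/-- For `W ⊆ V` and `U ⊆ H` with `H = U ⊕ W^⊥`, the oblique projection `P_W^{U^⊥}` in `H` onto `W` along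
`U^⊥`, as an operator from `H` into `V` (its values are in `W ⊆ V`). -/
def projToV (h : IsCompl U (W.map (S.emb : V →ₗ[ℝ] H))ᗮ) : H →L[ℝ] V :=
  W.subtypeL ∘L
    (LinearMap.toContinuousLinearMap
      (Submodule.equivMapOfInjective (S.emb : V →ₗ[ℝ] H) S.emb_injective W).symm.toLinearMap) ∘L
    Submodule.projectionOntoL (W.map (S.emb : V →ₗ[ℝ] H)) Uᗮ
      (Submodule.IsCompl.isTopCompl_of_isClosed (isCompl_swap h)
        (Submodule.closed_of_finiteDimensional _) (Submodule.isClosed_orthogonal U))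

/-- As an element of `H`, `S.projToV U W h y` is the oblique projection of `y`. -/
theorem emb_projToV (h : IsCompl U (W.map (S.emb : V →ₗ[ℝ] H))ᗮ) (y : H) :
    S.emb (S.projToV U W h y) =
      Submodule.projection (W.map (S.emb : V →ₗ[ℝ] H)) Uᗮ (isCompl_swap h) y := by
  have := Submodule.map_equivMapOfInjective_symm_apply (S.emb : V →ₗ[ℝ] H) S.emb_injective W
    (Submodule.projectionOnto (W.map (S.emb : V →ₗ[ℝ] H)) Uᗮ (isCompl_swap h) y)
  exact this

/-- The extension to `V'` of the oblique projection `P_U^{W^⊥}` in `H` onto `U` along `W^⊥`: the element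
`P f` of `U` with `⟨P f, φ⟩ = ⟨f, P_W^{U^⊥} φ⟩` for all `φ ∈ V`; see `inner_projExt`, `projExt_mem` and
`projExt_incl`. -/
def projExt (h : IsCompl U (W.map (S.emb : V →ₗ[ℝ] H))ᗮ) (f : StrongDual ℝ V) : H :=
  (InnerProductSpace.toDual ℝ H).symm (f.comp (S.projToV U W h))

theorem inner_projExt (h : IsCompl U (W.map (S.emb : V →ₗ[ℝ] H))ᗮ) (f : StrongDual ℝ V) (g : H) :
    ⟪S.projExt U W h f, g⟫ = f (S.projToV U W h g) := by
  simp [projExt]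

theorem projExt_mem (h : IsCompl U (W.map (S.emb : V →ₗ[ℝ] H))ᗮ) (f : StrongDual ℝ V) :
    S.projExt U W h f ∈ U := by
  suffices S.projExt U W h f ∈ Uᗮᗮ by rwa [Submodule.orthogonal_orthogonal U] at this
  intro g hg
  have h0 : S.projToV U W h g = 0 := by
    apply S.emb_injective
    rw [emb_projToV, map_zero, Submodule.projection_apply_eq_zero_iff]
    exact hg
  rw [real_inner_comm, inner_projExt, h0, map_zero]

theorem projExt_incl (h : IsCompl U (W.map (S.emb : V →ₗ[ℝ] H))ᗮ) (g : H) :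
    S.projExt U W h (S.incl g) =
      Submodule.projection U (W.map (S.emb : V →ₗ[ℝ] H))ᗮ h g := by
  refine ext_inner_right ℝ fun z => ?_
  rw [inner_projExt]
  change ⟪g, S.emb (S.projToV U W h z)⟫ = _
  rw [emb_projToV]
  set P := Submodule.projection U (W.map (S.emb : V →ₗ[ℝ] H))ᗮ h with hP
  set Q := Submodule.projection (W.map (S.emb : V →ₗ[ℝ] H)) Uᗮ (isCompl_swap h) with hQ
  have h1 : ⟪g - P g, Q z⟫ = 0 := by
    have : g - P g ∈ (W.map (S.emb : V →ₗ[ℝ] H))ᗮ := by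
      rw [← Submodule.projection_apply_eq_zero_iff h, map_sub]
      rw [hP, Submodule.projection_apply_of_mem_left h (Submodule.projection_apply_mem h g), sub_self]
    rw [real_inner_comm]
    exact this _ (Submodule.projection_apply_mem _ _)
  have h2 : ⟪P g, z - Q z⟫ = 0 := by
    have : z - Q z ∈ Uᗮ := by
      rw [← Submodule.projection_apply_eq_zero_iff (isCompl_swap h), map_sub]
      rw [hQ, Submodule.projection_apply_of_mem_left _
        (Submodule.projection_apply_mem (isCompl_swap h) z), sub_self]
    exact this _ (Submodule.projection_apply_mem _ _)
  rw [inner_sub_left] at h1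
  rw [inner_sub_right] at h2
  linarith

/-- The orthogonal-projection feedback `y ↦ -λ P_U y`. -/
def orthogonalFeedback (lam : ℝ) (y : H) : H := -lam • U.starProjection y

/-- The oblique-projection feedback `y ↦ -λ P_U^{W^⊥} A^ρ P_W^{U^⊥} y`. -/
def obliqueFeedback (h : IsCompl U (W.map (S.emb : V →ₗ[ℝ] H))ᗮ) (ρ lam : ℝ) (y : H) : H :=
  -lam • S.projExt U W h (S.fracPow ρ (S.projToV U W h y))

end Oblique

/-! ### Assumptions on the actuators, on the linear and on the nonlinear perturbation -/

/-- The Poincaré-like constant `inf {‖θ‖_V² / ‖θ‖_H² : θ ∈ (V ∩ U^⊥) \ {0}}` (`∞` if there is no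
such `θ`). -/
def poincareConst (U : Submodule ℝ H) : ℝ≥0∞ :=
  ⨅ (θ : V) (_ : θ ≠ 0) (_ : S.emb θ ∈ Uᗮ), ENNReal.ofReal (‖θ‖ ^ 2 / ‖S.emb θ‖ ^ 2)

/-- The norm of `L : V → V'` in the sum `𝓛(H, V') + 𝓛(V, H)`; it is `∞` if `L` is not in this sum. -/
def sumNorm (L : V →L[ℝ] StrongDual ℝ V) : ℝ≥0∞ :=
  ⨅ (B : H →L[ℝ] StrongDual ℝ V) (D : V →L[ℝ] H)
    (_ : ∀ v, L v = B (S.emb v) + S.incl (D v)),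
    ENNReal.ofReal (√(‖B‖ ^ 2 + ‖D‖ ^ 2))

/-- `A_rc ∈ L^∞((0,∞), 𝓛(H, V') + 𝓛(V, H))` with norm at most `C`; measurability in time is the
measurability of `t ↦ A_rc(t) v` for each `v`. -/
structure IsReactionConvection (Arc : ℝ → V →L[ℝ] StrongDual ℝ V) (C : ℝ≥0) : Prop where
  aestronglyMeasurable : ∀ v : V, AEStronglyMeasurable (fun t => Arc t v) (volume.restrict (Ioi 0))
  bound : ∀ᵐ t ∂volume.restrict (Ioi (0 : ℝ)), S.sumNorm (Arc t) ≤ C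

/-- The class `𝓒_{b,ι}(V, V')` of continuous maps which are bounded by a continuous nondecreasing
function of the norm that vanishes at `0`. -/
def BoundedContinuousClass (F : V → StrongDual ℝ V) : Prop :=
  Continuous F ∧ ∃ i : ℝ → ℝ, ContinuousOn i (Ici 0) ∧ MonotoneOn i (Ici 0) ∧ i 0 = 0 ∧
    ∀ y, ‖F y‖ ≤ i ‖y‖

/-- The class of nonlinearities with exponents `ζ₁, ζ₂, δ₁, δ₂` and constant `C`. -/
structure IsNonlinearity {n : ℕ} (ζ₁ ζ₂ δ₁ δ₂ : Fin n → ℝ) (C : ℝ≥0)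
    (N : ℝ → V → StrongDual ℝ V) : Prop where
  boundedContinuous : ∀ᵐ t ∂volume.restrict (Ioi (0 : ℝ)), BoundedContinuousClass (N t)
  bound : ∀ t > 0, ∀ y₁ y₂ : V,
    ‖N t y₁ - N t y₂‖ ≤ C * ∑ j,
      (‖S.emb y₁‖ ^ ζ₁ j * ‖y₁‖ ^ ζ₂ j + ‖S.emb y₂‖ ^ ζ₁ j * ‖y₂‖ ^ ζ₂ j) *
        (‖S.emb (y₁ - y₂)‖ ^ δ₁ j * ‖y₁ - y₂‖ ^ δ₂ j)
  locallyIntegrable : ∀ y : V, LocallyIntegrableOn (fun t => N t y) (Ioi 0)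

/-! ### Weak solutions and stability -/

/-- Global weak solutions of `y' + A y + A_rc(t) y + N(t, y) = K(y)`, `y(0) = y₀`: functions
`y ∈ C([0,∞), H)` with `y ∈ L²((0,T), V)` and `y' ∈ L²((0,T), V')` for all `T > 0` which satisfy the
initial condition and the equation in `V'`. Here `v` is `y` as a `V`-valued function, and the equation is
written in the integrated form `y(t) = y₀ + ∫₀ᵗ (K(y) - A y - A_rc y - N(s, y)) ds` in `V'`. -/
def IsWeakSolution (Arc : ℝ → V →L[ℝ] StrongDual ℝ V) (N : ℝ → V → StrongDual ℝ V)
    (K : H → H) (y₀ : H) (y : ℝ → H) : Prop :=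
  ContinuousOn y (Ici 0) ∧ y 0 = y₀ ∧
    ∃ v : ℝ → V, (∀ᵐ t ∂volume.restrict (Ioi (0 : ℝ)), S.emb (v t) = y t) ∧
      (∀ T > 0, MemLp v 2 (volume.restrict (Ioo 0 T))) ∧
      (∀ T > 0, MemLp (fun s => S.incl (K (y s)) - S.A (v s) - Arc s (v s) - N s (v s)) 2
        (volume.restrict (Ioo 0 T))) ∧
      ∀ t ≥ 0, S.incl (y t) = S.incl y₀ +
        ∫ s in 0..t, (S.incl (K (y s)) - S.A (v s) - Arc s (v s) - N s (v s))

/-- For all `y₀` with `‖y₀‖ < R` the closed loop has exactly one global weak solution, its norm decays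
exponentially with rate `μ` (and constant one), and its norm is strictly decreasing at each time
at which the solution does not vanish. -/
def IsStabilized (Arc : ℝ → V →L[ℝ] StrongDual ℝ V) (N : ℝ → V → StrongDual ℝ V)
    (K : H → H) (R μ : ℝ) : Prop :=
  ∀ y₀ : H, ‖y₀‖ < R → ∃ y : ℝ → H,
    S.IsWeakSolution Arc N K y₀ y ∧
    (∀ z : ℝ → H, S.IsWeakSolution Arc N K y₀ z → EqOn z y (Ici 0)) ∧
    (∀ s t : ℝ, 0 ≤ s → s ≤ t → ‖y t‖ ≤ Real.exp (-μ * (t - s)) * ‖y s‖) ∧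
    ∀ s : ℝ, 0 ≤ s → y s ≠ 0 →
      (∀ t, s < t → ‖y t‖ < ‖y s‖) ∧ ∀ r, 0 ≤ r → r < s → ‖y s‖ < ‖y r‖

end

end DiffusionSetting

open scoped BoundedContinuousFunction

/-! ### Absolutely continuous functions on an interval -/

/-! Let `F` collect the feedback, `-A_rc` and `-N`. Along a solution, d/dt |y|_H² = 2(⟨F(t, y), y⟩ -
|y|_V²). While |y|_H ≤ R, twice the perturbation is at most (3/2)|y|_V² + k |y|_H² with `k`
independent of M and λ (`exists_monotone_energy_const`). This is Young's inequality: ζ₂ + δ₂ < 1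
lets the powers of the V-norm be absorbed, and δ₁ + δ₂ ≥ 1 makes the remainder quadratic. Half of
|y|_V² survives, and together with the feedback it has to dominate (k + 2μ)|y|_H².

Write U, W for the spans of the M-th families and split y = q + θ, where q is the oblique projection
of y onto W and θ ∈ U^⊥. For large M the Poincaré constant lets |θ|_V² dominate |θ|_H². The
finite-dimensional part q is left to the feedback: both feedback forms are at least c_M |q|_V² with
c_M > 0 (`exists_orthogonal_coercive`, `exists_oblique_coercive`), and λ is chosen after M, so the
size of c_M does not matter (`mul_norm_emb_sq_le`). Hence d/dt |y|_H² ≤ -2μ |y|_H² in the ball of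
radius R. A solution starting inside never leaves this ball, and the estimate holds for all times.

For well-posedness the linear equation y' + Ay = f is solved mode by mode in an eigenbasis
(`exists_linSol`), which also yields the energy identity. One difference estimate for the
perturbation (`PertBound.exists_energy_bound`) then gives uniqueness by a Gronwall argument and
local existence by a contraction in C(H) × L²(V). The length of the local interval depends only on a
bound for the initial value, so the decay makes the solution global. -/

theorem primitive_mul_sub {a b : ℝ} (hab : a ≤ b) {u w p q : ℝ → ℝ}
    (hp : IntervalIntegrable p volume a b) (hq : IntervalIntegrable q volume a b)
    (hu : ∀ t ∈ Icc a b, u t = u a + ∫ s in a..t, p s)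
    (hw : ∀ t ∈ Icc a b, w t = w a + ∫ s in a..t, q s) :
    u b * w b - u a * w a = ∫ s in a..b, (p s * w s + u s * q s) := by
  set U : ℝ → ℝ := fun t => u a + ∫ s in a..t, p s with hU
  set W : ℝ → ℝ := fun t => w a + ∫ s in a..t, q s with hW
  have hc : ∀ k : ℝ, AbsolutelyContinuousOnInterval (fun _ : ℝ => k) a b := fun k =>
    (LipschitzWith.const k).lipschitzOnWith.absolutelyContinuousOnInterval
  have hUac : AbsolutelyContinuousOnInterval U a b :=
    (hc _).fun_add (hp.absolutelyContinuousOnInterval_intervalIntegral (by simp))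
  have hWac : AbsolutelyContinuousOnInterval W a b :=
    (hc _).fun_add (hq.absolutelyContinuousOnInterval_intervalIntegral (by simp))
  have h := hUac.integral_deriv_mul_eq_sub hWac
  rw [hu b (right_mem_Icc.2 hab), hw b (right_mem_Icc.2 hab)]
  have hUa : U a = u a := by simp [hU]
  have hWa : W a = w a := by simp [hW]
  rw [hUa, hWa] at h
  rw [← h]
  apply intervalIntegral.integral_congr_ae
  filter_upwards [hp.ae_hasDerivAt_integral, hq.ae_hasDerivAt_integral] with x h1 h2 hx
  have hx' : x ∈ uIcc a b := uIoc_subset_uIcc hx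
  have h3 : deriv U x = p x := ((h1 hx' a (by simp)).const_add _).deriv
  have h4 : deriv W x = q x := ((h2 hx' a (by simp)).const_add _).deriv
  rw [uIcc_of_le hab] at hx'
  rw [h3, h4, hu x hx', hw x hx']

/-- Integrating factor: the derivative of E(s) exp(m(s - a)) is (h + mE) exp(m(s - a)), which is
nonpositive almost everywhere. -/
theorem primitive_exp_decay {a b m : ℝ} (hab : a ≤ b) {E h : ℝ → ℝ}
    (hh : IntervalIntegrable h volume a b)
    (hE : ∀ t ∈ Icc a b, E t = E a + ∫ s in a..t, h s)
    (hle : ∀ᵐ s ∂volume.restrict (Ioc a b), h s ≤ -m * E s) :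
    E b ≤ Real.exp (-m * (b - a)) * E a := by
  have hw : ∀ t ∈ Icc a b, Real.exp (m * (t - a)) = Real.exp (m * (a - a)) +
      ∫ s in a..t, m * Real.exp (m * (s - a)) := by
    intro t _
    rw [intervalIntegral.integral_eq_sub_of_hasDerivAt (f := fun s => Real.exp (m * (s - a)))]
    · ring
    · intro x _
      have := (((hasDerivAt_id x).sub_const a).const_mul m).exp
      simpa [mul_comm] using this
    · exact (by fun_prop : Continuous fun s => m * Real.exp (m * (s - a))).intervalIntegrable _ _
  have hq : IntervalIntegrable (fun s => m * Real.exp (m * (s - a))) volume a b :=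
    (by fun_prop : Continuous fun s => m * Real.exp (m * (s - a))).intervalIntegrable _ _
  have key := primitive_mul_sub hab hh hq hE hw
  have hneg : ∫ s in a..b, (h s * Real.exp (m * (s - a)) + E s * (m * Real.exp (m * (s - a)))) ≤ 0 := by
    rw [intervalIntegral.integral_of_le hab]
    apply integral_nonpos_of_ae
    filter_upwards [hle] with s hs
    have := Real.exp_pos (m * (s - a))
    show _ ≤ (0 : ℝ)
    nlinarith
  rw [← key] at hneg
  simp only [sub_self, mul_zero, Real.exp_zero, mul_one] at hneg
  have h1 : Real.exp (-m * (b - a)) * Real.exp (m * (b - a)) = 1 := by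
    rw [← Real.exp_add]; simp
  have h2 := mul_le_mul_of_nonneg_left hneg (Real.exp_pos (-m * (b - a))).le
  rw [mul_sub, mul_left_comm, h1, mul_one, mul_zero] at h2
  linarith

/-- A Gronwall lemma with an integrable rate and zero initial value. -/
theorem eq_zero_of_le_integral {a b : ℝ} {E h k : ℝ → ℝ} (hc : ContinuousOn E (Icc a b))
    (hE0 : ∀ t ∈ Icc a b, 0 ≤ E t) (hEa : E a = 0) (hk : IntegrableOn k (Ioc a b))
    (hh : IntegrableOn h (Ioc a b))
    (hhk : ∀ᵐ r ∂volume.restrict (Ioc a b), h r ≤ k r * E r)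
    (hle : ∀ s ∈ Icc a b, ∀ t ∈ Icc s b, E t = E s + ∫ r in s..t, h r) :
    ∀ t ∈ Icc a b, E t = 0 := by
  intro t0 ht0
  have hab : a ≤ b := ht0.1.trans ht0.2
  -- Continuation argument: let `c` be the last time up to which `E` vanishes. If c < b, choose τ >
  -- c with the integral of |k| over (c, τ) below 1/2; at a maximum point x of `E` on [c, τ] one
  -- gets E(x) ≤ E(x)/2, so `E` vanishes up to τ, contradicting the choice of c.
  set Z : Set ℝ := {t ∈ Icc a b | ∀ r ∈ Icc a t, E r = 0} with hZ
  have haZ : a ∈ Z := ⟨left_mem_Icc.2 hab, fun r hr => by rw [le_antisymm hr.2 hr.1, hEa]⟩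
  have hbdd : BddAbove Z := ⟨b, fun t ht => ht.1.2⟩
  set c := sSup Z with hcdef
  have hac : a ≤ c := le_csSup hbdd haZ
  have hcb : c ≤ b := csSup_le ⟨a, haZ⟩ fun t ht => ht.1.2
  have hlt : ∀ r ∈ Ico a c, E r = 0 := by
    intro r hr
    obtain ⟨t, htZ, hrt⟩ := exists_lt_of_lt_csSup ⟨a, haZ⟩ hr.2
    exact htZ.2 r ⟨hr.1, hrt.le⟩
  have hEc : E c = 0 := by
    rcases hac.eq_or_lt with h | h
    · rw [← h, hEa]
    have hmem : c ∈ closure (Ico a c) := by rw [closure_Ico h.ne]; exact ⟨hac, le_rfl⟩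
    have hcw : ContinuousWithinAt E (Ico a c) c :=
      (hc c ⟨hac, hcb⟩).mono fun x hx => ⟨hx.1, hx.2.le.trans hcb⟩
    have := hcw.mem_closure_image hmem
    have h2 : E '' Ico a c ⊆ {0} := by rintro _ ⟨r, hr, rfl⟩; exact hlt r hr
    simpa using closure_mono h2 this
  by_cases hcb' : c = b
  · rcases eq_or_lt_of_le ht0.2 with h | h
    · rw [h, ← hcb', hEc]
    · exact hlt _ ⟨ht0.1, by rw [hcb']; exact h⟩
  exfalso
  have hclt : c < b := lt_of_le_of_ne hcb hcb'
  -- the integral of the rate is small on a short interval to the right of c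
  have hkI : IntervalIntegrable (fun r => |k r|) volume a b :=
    (intervalIntegrable_iff_integrableOn_Ioc_of_le hab).2 hk.abs
  have hcont : ContinuousOn (fun t => ∫ r in c..t, |k r|) (uIcc a b) :=
    intervalIntegral.continuousOn_primitive_interval' hkI (by rw [uIcc_of_le hab]; exact ⟨hac, hcb⟩)
  rw [uIcc_of_le hab] at hcont
  have hcw : Tendsto (fun t => ∫ r in c..t, |k r|) (𝓝[>] c) (𝓝 0) := by
    have h1 := (hcont c ⟨hac, hcb⟩).mono_left (nhdsWithin_mono c (s := Ioo c b)
      fun x hx => ⟨hac.trans hx.1.le, hx.2.le⟩)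
    rw [nhdsWithin_Ioo_eq_nhdsGT hclt] at h1
    simpa using h1
  have hev := (hcw.eventually (gt_mem_nhds (show (0 : ℝ) < 1 / 2 by norm_num))).and
    (Ioo_mem_nhdsGT hclt)
  obtain ⟨τ, hτ, hτm⟩ := hev.exists
  have hsub : Icc c τ ⊆ Icc a b := Icc_subset_Icc hac hτm.2.le
  obtain ⟨x, hx, hmax⟩ := isCompact_Icc.exists_isMaxOn (nonempty_Icc.2 hτm.1.le) (hc.mono hsub)
  have hEx : E x ≤ E x * (1 / 2) := by
    have h1 := hle c ⟨hac, hcb⟩ x ⟨hx.1, hx.2.trans hτm.2.le⟩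
    rw [hEc, zero_add] at h1
    have hsub' : Ioc c x ⊆ Ioc a b := Ioc_subset_Ioc hac (hx.2.trans hτm.2.le)
    have hkx : IntegrableOn (fun r => |k r|) (Ioc c x) := IntegrableOn.mono_set hk.abs hsub'
    have h2 : ∫ r in c..x, h r ≤ ∫ r in c..x, |k r| * E x := by
      rw [intervalIntegral.integral_of_le hx.1, intervalIntegral.integral_of_le hx.1]
      refine integral_mono_ae (hh.mono_set hsub') (hkx.mul_const _) ?_
      filter_upwards [ae_restrict_mem measurableSet_Ioc,
        ae_restrict_of_ae_restrict_of_subset hsub' hhk] with r hr hr2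
      have hrc : r ∈ Icc c τ := ⟨hr.1.le, hr.2.trans hx.2⟩
      have h3 := hE0 r (hsub hrc)
      have h4 : E r ≤ E x := hmax hrc
      nlinarith [le_abs_self (k r), abs_nonneg (k r)]
    have h3 : ∫ r in c..x, |k r| ≤ ∫ r in c..τ, |k r| := by
      rw [intervalIntegral.integral_of_le hx.1, intervalIntegral.integral_of_le hτm.1.le]
      exact setIntegral_mono_set (IntegrableOn.mono_set hk.abs (Ioc_subset_Ioc hac hτm.2.le))
        (ae_of_all _ fun _ => abs_nonneg _) (Ioc_subset_Ioc le_rfl hx.2).eventuallyLE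
    rw [intervalIntegral.integral_mul_const] at h2
    have h4 := hE0 x (hsub hx)
    rw [mul_comm]
    exact h1.le.trans (h2.trans (mul_le_mul_of_nonneg_right (h3.trans hτ.le) h4))
  have hx0 : E x = 0 := le_antisymm (by linarith) (hE0 x (hsub hx))
  have hτZ : τ ∈ Z := by
    refine ⟨⟨hac.trans hτm.1.le, hτm.2.le⟩, fun r hr => ?_⟩
    by_cases hrc : r < c
    · exact hlt r ⟨hr.1, hrc⟩
    · have hrm : r ∈ Icc c τ := ⟨not_lt.1 hrc, hr.2⟩
      have h5 : E r ≤ E x := hmax hrm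
      exact le_antisymm (h5.trans_eq hx0) (hE0 r (hsub hrm))
  exact absurd (le_csSup hbdd hτZ) (not_le.2 hτm.1)

namespace DiffusionSetting

variable {V H : Type*}
  [NormedAddCommGroup V] [InnerProductSpace ℝ V] [CompleteSpace V]
  [NormedAddCommGroup H] [InnerProductSpace ℝ H] [CompleteSpace H]
  (S : DiffusionSetting V H)

/-! ### The eigenbasis -/

/-- The operator T = emb* emb on V satisfies (Tv, w)_V = (v, w)_H. It is compact and symmetric, so
the spectral theorem applies. Its eigenvalue μ ≠ 0 corresponds to the eigenvalue μ⁻¹ of `A`, and 0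
is not an eigenvalue because `emb` is injective. -/
theorem iSup_eigenspace_orthogonal : (⨆ α, S.eigenspace α)ᗮ = ⊥ := by
  let T : V →L[ℝ] V := (ContinuousLinearMap.adjoint S.emb).comp S.emb
  have hT : IsCompactOperator T := S.emb_compact.clm_comp (ContinuousLinearMap.adjoint S.emb)
  have hin : ∀ v w, ⟪T v, w⟫ = ⟪S.emb v, S.emb w⟫ := fun v w => by
    simp [T, ContinuousLinearMap.adjoint_inner_left]
  have hsym : (T : V →ₗ[ℝ] V).IsSymmetric := by
    intro v w
    change ⟪T v, w⟫ = ⟪v, T w⟫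
    rw [hin, real_inner_comm, ← hin, real_inner_comm]
  have h := ContinuousLinearMap.orthogonalComplement_iSup_eigenspaces_eq_bot hT hsym
  rw [eq_bot_iff, ← h]
  apply Submodule.orthogonal_le
  refine iSup_le fun μ v hv => ?_
  have hv' : T v = μ • v := Module.End.mem_eigenspace_iff.1 hv
  by_cases hμ : μ = 0
  · have h0 : ⟪S.emb v, S.emb v⟫ = 0 := by rw [← hin, hv', hμ]; simp
    have : v = 0 := S.emb_injective (by rw [inner_self_eq_zero.1 h0, map_zero])
    rw [this]; exact Submodule.zero_mem _
  · refine Submodule.mem_iSup_of_mem μ⁻¹ ?_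
    rw [S.mem_eigenspace]
    intro z
    rw [← hin, hv', real_inner_smul_left, inv_mul_cancel_left₀ hμ]

/-- An eigenbasis of `A`, orthonormal in `V`; the numbers `mu i` are the inverses of the
eigenvalues. -/
structure EigenBasis (ι : Type*) where
  basis : HilbertBasis ι ℝ V
  mu : ι → ℝ
  mu_pos : ∀ i, 0 < mu i
  inner_emb : ∀ i z, ⟪S.emb (basis i), S.emb z⟫ = mu i * ⟪basis i, z⟫

namespace EigenBasis

variable {S} {ι : Type*} (B : S.EigenBasis ι)

theorem inner_emb_basis [DecidableEq ι] (i j : ι) :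
    ⟪S.emb (B.basis i), S.emb (B.basis j)⟫ = if i = j then B.mu i else 0 := by
  rw [B.inner_emb, orthonormal_iff_ite.1 B.basis.orthonormal i j]
  simp

theorem orthonormal_emb :
    Orthonormal ℝ fun i => (√(B.mu i))⁻¹ • S.emb (B.basis i) := by
  classical
  rw [orthonormal_iff_ite]
  intro i j
  rw [real_inner_smul_left, real_inner_smul_right, B.inner_emb_basis]
  split_ifs with h
  · subst h
    have := B.mu_pos i
    have h2 := Real.sqrt_pos.2 this
    field_simp
    rw [Real.sq_sqrt this.le]
  · simp

theorem eq_of_inner_eq {y z : H}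
    (h : ∀ i, ⟪y, S.emb (B.basis i)⟫ = ⟪z, S.emb (B.basis i)⟫) : y = z := by
  have h1 : S.incl y = S.incl z := by
    refine ContinuousLinearMap.ext_on (s := range B.basis) ?_ ?_
    · rw [Submodule.dense_iff_topologicalClosure_eq_top]; exact B.basis.dense_span
    · rintro _ ⟨i, rfl⟩; exact h i
  have h2 : innerSL ℝ y = innerSL ℝ z := by
    ext w
    have := S.emb_denseRange.induction_on (p := fun w => ⟪y, w⟫ = ⟪z, w⟫) w
      (isClosed_eq (by fun_prop) (by fun_prop)) (fun v => DFunLike.congr_fun h1 v)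
    simpa using this
  refine ext_inner_right ℝ fun w => by simpa using DFunLike.congr_fun h2 w

theorem dual_ext {f g : StrongDual ℝ V} (h : ∀ i, f (B.basis i) = g (B.basis i)) : f = g := by
  refine ContinuousLinearMap.ext_on (s := range B.basis) ?_ ?_
  · rw [Submodule.dense_iff_topologicalClosure_eq_top]; exact B.basis.dense_span
  · rintro _ ⟨i, rfl⟩; exact h i

noncomputable def embBasis : HilbertBasis ι ℝ H :=
  HilbertBasis.mkOfOrthogonalEqBot B.orthonormal_emb (by
    rw [eq_bot_iff]
    intro y hy
    rw [Submodule.mem_bot]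
    refine B.eq_of_inner_eq fun i => ?_
    have h1 := hy _ (Submodule.subset_span ⟨i, rfl⟩)
    rw [real_inner_smul_left, mul_eq_zero] at h1
    rw [inner_zero_left, real_inner_comm]
    exact h1.resolve_left (inv_ne_zero (Real.sqrt_pos.2 (B.mu_pos i)).ne'))

theorem embBasis_apply (i : ι) : B.embBasis i = (√(B.mu i))⁻¹ • S.emb (B.basis i) := by
  rw [embBasis, HilbertBasis.coe_mkOfOrthogonalEqBot]

theorem hasSum_norm_sq (y : H) :
    HasSum (fun i => (B.mu i)⁻¹ * ⟪y, S.emb (B.basis i)⟫ ^ 2) (‖y‖ ^ 2) := by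
  have h := B.embBasis.hasSum_inner_mul_inner y y
  rw [real_inner_self_eq_norm_sq] at h
  refine (congrArg (HasSum · _) (funext fun i => ?_)).mp h
  rw [real_inner_comm, B.embBasis_apply, real_inner_smul_left, real_inner_comm]
  have h1 := Real.mul_self_sqrt (B.mu_pos i).le
  rw [show (√(B.mu i))⁻¹ * ⟪y, S.emb (B.basis i)⟫ * ((√(B.mu i))⁻¹ * ⟪y, S.emb (B.basis i)⟫)
    = (√(B.mu i) * √(B.mu i))⁻¹ * ⟪y, S.emb (B.basis i)⟫ ^ 2 by rw [mul_inv]; ring, h1]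

theorem hasSum_apply (f : StrongDual ℝ V) (v : V) :
    HasSum (fun i => ⟪B.basis i, v⟫ * f (B.basis i)) (f v) := by
  have h := (B.basis.hasSum_repr v).mapL f
  simpa [B.basis.repr_apply_apply] using h

theorem hasSum_dual_sq (f : StrongDual ℝ V) :
    HasSum (fun i => f (B.basis i) ^ 2) (‖f‖ ^ 2) := by
  set w := (InnerProductSpace.toDual ℝ V).symm f with hw
  have hf : ∀ v, f v = ⟪w, v⟫ := fun v => by simp [hw]
  have h := B.basis.hasSum_inner_mul_inner w w
  rw [real_inner_self_eq_norm_sq, hw, LinearIsometryEquiv.norm_map] at h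
  refine (congrArg (HasSum · _) (funext fun i => ?_)).mp h
  rw [hf, real_inner_comm, sq]

theorem sum_sq_le (f : StrongDual ℝ V) (s : Finset ι) :
    ∑ i ∈ s, f (B.basis i) ^ 2 ≤ ‖f‖ ^ 2 :=
  sum_le_hasSum s (fun _ _ => sq_nonneg _) (B.hasSum_dual_sq f)

/-- Cauchy–Schwarz with a bound uniform in the finite set, which provides the dominating function
when the energy identity is summed over the modes. -/
theorem abs_sum_apply_le (f : StrongDual ℝ V) (v : V) (s : Finset ι) :
    |∑ i ∈ s, ⟪B.basis i, v⟫ * f (B.basis i)| ≤ ‖f‖ * ‖v‖ := by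
  have h1 := Finset.sum_mul_sq_le_sq_mul_sq s (fun i => ⟪B.basis i, v⟫) (fun i => f (B.basis i))
  have h2 := B.sum_sq_le f s
  have h3 := B.sum_sq_le (innerSL ℝ v) s
  simp only [innerSL_apply_apply, innerSL_apply_norm, real_inner_comm _ v] at h3
  rw [← abs_of_nonneg (mul_nonneg (norm_nonneg f) (norm_nonneg v)), ← sq_le_sq]
  refine h1.trans ?_
  rw [mul_pow, mul_comm]
  exact mul_le_mul h2 h3 (Finset.sum_nonneg fun _ _ => sq_nonneg _) (sq_nonneg _)

-- Countability of the modes makes dominated convergence available along finite subsets of `ι`. The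
-- image of the unit ball under the compact `emb` is separable. Every mode is non-orthogonal to some
-- member of a countable dense set, and by Parseval each member is non-orthogonal to only countably
-- many modes.
include B in
theorem countable_index : Countable ι := by
  obtain ⟨c, hcc, hc⟩ :=
    (S.emb_compact.isCompact_closure_image_closedBall 1).isSeparable
  have h1 : (univ : Set ι) ⊆ ⋃ d ∈ c, {i | ⟪d, S.emb (B.basis i)⟫ ≠ 0} := by
    rintro i -
    have h2 : S.emb (B.basis i) ∈ closure c := hc (subset_closure
      ⟨B.basis i, by simp [B.basis.orthonormal.1 i], rfl⟩)
    have h3 : IsOpen {d : H | ⟪d, S.emb (B.basis i)⟫ ≠ 0} :=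
      isOpen_ne_fun (by fun_prop) (by fun_prop)
    have h4 : S.emb (B.basis i) ∈ {d : H | ⟪d, S.emb (B.basis i)⟫ ≠ 0} := by
      classical
      simp only [mem_ofPred_eq, B.inner_emb_basis, if_pos]
      exact (B.mu_pos i).ne'
    obtain ⟨d, hd, hdc⟩ := mem_closure_iff.1 h2 _ h3 h4
    exact mem_biUnion hdc hd
  have h5 : (⋃ d ∈ c, {i | ⟪d, S.emb (B.basis i)⟫ ≠ 0}).Countable := by
    refine hcc.biUnion fun d _ => ?_
    refine ((B.hasSum_norm_sq d).summable.countable_support).mono fun i hi => ?_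
    have := (B.mu_pos i).ne'
    simp only [Function.mem_support]
    exact mul_ne_zero (inv_ne_zero this) (pow_ne_zero _ hi)
  exact countable_univ_iff.1 (h5.mono h1)

end EigenBasis

/-- Hilbert bases of the mutually orthogonal eigenspaces are put together. A vector orthogonal to
all of them is orthogonal to every eigenspace, hence zero by `iSup_eigenspace_orthogonal`. -/
theorem exists_eigenBasis.{u} {V : Type u} [NormedAddCommGroup V] [InnerProductSpace ℝ V]
    [CompleteSpace V] (S : DiffusionSetting V H) :
    ∃ ι : Type u, Nonempty (S.EigenBasis ι) := by
  choose w b hb using fun α : ℝ => exists_hilbertBasis ℝ (S.eigenspace α)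
  have hon : Orthonormal ℝ fun a : Σ α, w α => ((b a.1 a.2 : S.eigenspace a.1) : V) :=
    S.orthogonalFamily_eigenspace.orthonormal_sigma_orthonormal fun α => (b α).orthonormal
  have hbot : (Submodule.span ℝ
      (range fun a : Σ α, w α => ((b a.1 a.2 : S.eigenspace a.1) : V)))ᗮ = ⊥ := by
    rw [eq_bot_iff, ← S.iSup_eigenspace_orthogonal]
    intro v hv
    rw [Submodule.mem_orthogonal']
    intro u hu
    have h2 : (⨆ α, S.eigenspace α) ≤ LinearMap.ker (innerSL ℝ v : V →ₗ[ℝ] ℝ) := by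
      refine iSup_le fun α x hx => ?_
      have h3 : ((innerSL ℝ v).comp (S.eigenspace α).subtypeL) = 0 := by
        refine ContinuousLinearMap.ext_on (s := range (b α)) ?_ ?_
        · rw [Submodule.dense_iff_topologicalClosure_eq_top]; exact (b α).dense_span
        · rintro _ ⟨i, rfl⟩
          have := (Submodule.mem_orthogonal' _ _).1 hv _ (Submodule.subset_span ⟨⟨α, i⟩, rfl⟩)
          simpa using this
      exact DFunLike.congr_fun h3 ⟨x, hx⟩
    simpa using h2 hu
  refine ⟨Σ α, w α, ⟨⟨HilbertBasis.mkOfOrthogonalEqBot hon hbot, fun a => a.1⁻¹, ?_, ?_⟩⟩⟩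
  · intro a
    rcases S.eigenspace_eq_zero_or (b a.1 a.2).2 with h | h
    · have := hon.1 a
      simp [h] at this
    · exact inv_pos.2 h.1
  · intro a z
    rw [HilbertBasis.coe_mkOfOrthogonalEqBot]
    rcases S.eigenspace_eq_zero_or (b a.1 a.2).2 with h | h
    · have := hon.1 a
      simp [h] at this
    · rw [S.mem_eigenspace.1 (b a.1 a.2).2 z, inv_mul_cancel_left₀ h.1.ne']

end DiffusionSetting

namespace DiffusionSetting

variable {V H : Type*}
  [NormedAddCommGroup V] [InnerProductSpace ℝ V] [CompleteSpace V]
  [NormedAddCommGroup H] [InnerProductSpace ℝ H] [CompleteSpace H]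
  (S : DiffusionSetting V H)

/-! ### The linear equation with a source -/

@[simp] theorem incl_apply (h : H) (v : V) : S.incl h v = ⟪h, S.emb v⟫ := rfl

/-- `y` (also given as the `V`-valued function `v`) is a weak solution of `y' + A y = f` on
`[a, b]`. -/
structure LinSol (f : ℝ → StrongDual ℝ V) (a b : ℝ) (y : ℝ → H) (v : ℝ → V) : Prop where
  cont : ContinuousOn y (Icc a b)
  compat : ∀ᵐ t ∂volume.restrict (Ioc a b), S.emb (v t) = y t
  memv : MemLp v 2 (volume.restrict (Ioc a b))
  memf : MemLp f 2 (volume.restrict (Ioc a b))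
  eq : ∀ t ∈ Icc a b, S.incl (y t) = S.incl (y a) + ∫ s in a..t, (f s - S.A (v s))

namespace LinSol

variable {S} {f g : ℝ → StrongDual ℝ V} {a b : ℝ} {y z : ℝ → H} {v w : ℝ → V}

theorem mem_rhs (h : S.LinSol f a b y v) :
    MemLp (fun s => f s - S.A (v s)) 2 (volume.restrict (Ioc a b)) :=
  h.memf.sub (S.A.comp_memLp' h.memv)

theorem integrable_rhs (h : S.LinSol f a b y v) :
    IntegrableOn (fun s => f s - S.A (v s)) (Ioc a b) :=
  h.mem_rhs.integrable (by norm_num)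

theorem eq_of_mem (h : S.LinSol f a b y v) {s t : ℝ} (hs : s ∈ Icc a b) (ht : t ∈ Icc a b) :
    S.incl (y t) = S.incl (y s) + ∫ r in s..t, (f r - S.A (v r)) := by
  have hi : ∀ c ∈ Icc a b, IntervalIntegrable (fun s => f s - S.A (v s)) volume a c := fun c hc =>
    (intervalIntegrable_iff_integrableOn_Ioc_of_le hc.1).2
      (h.integrable_rhs.mono_set (Ioc_subset_Ioc le_rfl hc.2))
  rw [h.eq t ht, h.eq s hs, add_assoc,
    intervalIntegral.integral_add_adjacent_intervals (hi s hs) ((hi s hs).symm.trans (hi t ht))]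

theorem mono (h : S.LinSol f a b y v) {c d : ℝ} (hac : a ≤ c) (hdb : d ≤ b) :
    S.LinSol f c d y v where
  cont := h.cont.mono (Icc_subset_Icc hac hdb)
  compat := ae_restrict_of_ae_restrict_of_subset (Ioc_subset_Ioc hac hdb) h.compat
  memv := h.memv.mono_measure (Measure.restrict_mono (Ioc_subset_Ioc hac hdb) le_rfl)
  memf := h.memf.mono_measure (Measure.restrict_mono (Ioc_subset_Ioc hac hdb) le_rfl)
  eq _ ht := h.eq_of_mem ⟨hac, ht.1.trans (ht.2.trans hdb)⟩ ⟨hac.trans ht.1, ht.2.trans hdb⟩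

theorem congr (h : S.LinSol f a b y v) (hfg : f =ᵐ[volume.restrict (Ioc a b)] g)
    (hyz : EqOn y z (Icc a b)) (hvw : v =ᵐ[volume.restrict (Ioc a b)] w) :
    S.LinSol g a b z w where
  cont := h.cont.congr fun t ht => (hyz ht).symm
  compat := by
    filter_upwards [h.compat, hvw, ae_restrict_mem measurableSet_Ioc] with t h1 h2 h3
    rw [← h2, h1, hyz ⟨h3.1.le, h3.2⟩]
  memv := (memLp_congr_ae hvw).1 h.memv
  memf := (memLp_congr_ae hfg).1 h.memf
  eq t ht := by
    rw [← hyz ht, ← hyz ⟨le_rfl, ht.1.trans ht.2⟩, h.eq t ht,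
      intervalIntegral.integral_of_le ht.1, intervalIntegral.integral_of_le ht.1]
    congr 1
    apply integral_congr_ae
    filter_upwards [ae_restrict_of_ae_restrict_of_subset (Ioc_subset_Ioc le_rfl ht.2) hfg,
      ae_restrict_of_ae_restrict_of_subset (Ioc_subset_Ioc le_rfl ht.2) hvw] with s h1 h2
    rw [h1, h2]

theorem sub (h : S.LinSol f a b y v) (h' : S.LinSol g a b z w) :
    S.LinSol (fun t => f t - g t) a b (fun t => y t - z t) (fun t => v t - w t) where
  cont := h.cont.sub h'.cont
  compat := by
    filter_upwards [h.compat, h'.compat] with t h1 h2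
    rw [map_sub, h1, h2]
  memv := h.memv.sub h'.memv
  memf := h.memf.sub h'.memf
  eq t ht := by
    have e : ∀ p q : H, S.incl (p - q) = S.incl p - S.incl q := fun p q => by
      ext; simp [inner_sub_left]
    have hi : ∀ {f y v}, S.LinSol f a b y v →
        IntervalIntegrable (fun s => f s - S.A (v s)) volume a t := fun h =>
      (intervalIntegrable_iff_integrableOn_Ioc_of_le ht.1).2
        (h.integrable_rhs.mono_set (Ioc_subset_Ioc le_rfl ht.2))
    rw [e, e, h.eq t ht, h'.eq t ht, add_sub_add_comm, ← intervalIntegral.integral_sub (hi h) (hi h')]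
    congr 1
    refine intervalIntegral.integral_congr fun s _ => ?_
    simp only [map_sub]
    abel

theorem integrable_apply (h : S.LinSol f a b y v) (e : V) (hab : a ≤ b) :
    IntervalIntegrable (fun s => (f s - S.A (v s)) e) volume a b :=
  (intervalIntegrable_iff_integrableOn_Ioc_of_le hab).2
    (((ContinuousLinearMap.apply ℝ ℝ e).integrable_comp h.integrable_rhs))

theorem inner_eq (h : S.LinSol f a b y v) (e : V) {t : ℝ} (ht : t ∈ Icc a b) :
    ⟪y t, S.emb e⟫ = ⟪y a, S.emb e⟫ + ∫ s in a..t, (f s - S.A (v s)) e := by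
  have h1 := DFunLike.congr_fun (h.eq t ht) e
  rw [add_apply] at h1
  rw [← incl_apply, h1, intervalIntegral.integral_of_le ht.1, intervalIntegral.integral_of_le ht.1,
    ContinuousLinearMap.integral_apply
      (h.integrable_rhs.mono_set (Ioc_subset_Ioc le_rfl ht.2))]
  rfl

theorem integrable_energy (h : S.LinSol f a b y v) :
    IntegrableOn (fun s => f s (v s) - ‖v s‖ ^ 2) (Ioc a b) := by
  have h1 : IntegrableOn (fun s => ‖v s‖ ^ 2) (Ioc a b) := h.memv.integrable_norm_pow (by norm_num)
  refine Integrable.sub ?_ h1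
  have h2 : Integrable (fun s => ‖f s‖ * ‖v s‖) (volume.restrict (Ioc a b)) :=
    h.memf.norm.integrable_mul h.memv.norm
  refine h2.mono' ?_ (ae_of_all _ fun s => (f s).le_opNorm (v s))
  exact isBoundedBilinearMap_apply.continuous.comp_aestronglyMeasurable
    (h.memf.1.prodMk h.memv.1)

/-- The energy identity. -/
theorem energy (h : S.LinSol f a b y v) (hab : a ≤ b) :
    ‖y b‖ ^ 2 = ‖y a‖ ^ 2 + ∫ r in a..b, 2 * (f r (v r) - ‖v r‖ ^ 2) := by
  obtain ⟨ι, ⟨B⟩⟩ := S.exists_eigenBasis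
  have := B.countable_index
  set G : ℝ → StrongDual ℝ V := fun s => f s - S.A (v s) with hG
  have hgv : ∀ s, G s (v s) = f s (v s) - ‖v s‖ ^ 2 := fun s => by
    simp [hG, S.A_apply]
  -- The identity is proved for each mode, whose coefficient is a scalar absolutely continuous
  -- function, using (v, e_i)_H = mu_i (v, e_i)_V almost everywhere. Summing over the modes is
  -- Parseval in H on the left and dominated convergence on the right.
  have hz : ∀ i, (B.mu i)⁻¹ * ⟪y b, S.emb (B.basis i)⟫ ^ 2 -
      (B.mu i)⁻¹ * ⟪y a, S.emb (B.basis i)⟫ ^ 2 =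
      ∫ r in Ioc a b, 2 * (⟪B.basis i, v r⟫ * G r (B.basis i)) := by
    intro i
    have hi := h.integrable_apply (B.basis i) hab
    have h1 := primitive_mul_sub hab hi hi (fun t ht => h.inner_eq (B.basis i) ht)
      (fun t ht => h.inner_eq (B.basis i) ht)
    rw [← mul_sub, sq, sq, h1, intervalIntegral.integral_of_le hab, ← integral_const_mul]
    apply integral_congr_ae
    filter_upwards [h.compat] with r hr
    rw [← hr, real_inner_comm, B.inner_emb]
    have := (B.mu_pos i).ne'
    simp only [hG]
    field_simp
    ring
  have hs1 := (B.hasSum_norm_sq (y b)).sub (B.hasSum_norm_sq (y a))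
  have hs2 : HasSum (fun i => (B.mu i)⁻¹ * ⟪y b, S.emb (B.basis i)⟫ ^ 2 -
      (B.mu i)⁻¹ * ⟪y a, S.emb (B.basis i)⟫ ^ 2) (∫ r in Ioc a b, 2 * G r (v r)) := by
    have hterm : ∀ i, IntegrableOn (fun r => 2 * (⟪B.basis i, v r⟫ * G r (B.basis i))) (Ioc a b) := by
      intro i
      refine Integrable.const_mul ?_ _
      exact MemLp.integrable_mul (p := 2) (q := 2) ((innerSL ℝ (B.basis i)).comp_memLp' h.memv)
        ((ContinuousLinearMap.apply ℝ ℝ (B.basis i)).comp_memLp' h.mem_rhs)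
    unfold HasSum
    simp only [hz]
    have : ∀ s : Finset ι, ∑ i ∈ s, ∫ r in Ioc a b, 2 * (⟪B.basis i, v r⟫ * G r (B.basis i)) =
        ∫ r in Ioc a b, 2 * ∑ i ∈ s, ⟪B.basis i, v r⟫ * G r (B.basis i) := fun s => by
      simp_rw [Finset.mul_sum]
      rw [integral_finsetSum _ fun i _ => hterm i]
    simp only [this]
    refine tendsto_integral_filter_of_dominated_convergence (fun r => 2 * (‖G r‖ * ‖v r‖)) ?_ ?_ ?_ ?_
    · refine Eventually.of_forall fun s => ?_
      simp_rw [Finset.mul_sum]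
      exact (integrable_finsetSum _ fun i _ => hterm i).1
    · refine Eventually.of_forall fun s => ae_of_all _ fun r => ?_
      rw [norm_mul, Real.norm_eq_abs, Real.norm_eq_abs, abs_two]
      gcongr
      exact B.abs_sum_apply_le _ _ _
    · exact (h.mem_rhs.norm.integrable_mul h.memv.norm).const_mul _
    · exact ae_of_all _ fun r => (B.hasSum_apply (G r) (v r)).const_mul _
  have h3 := hs1.unique hs2
  rw [intervalIntegral.integral_of_le hab]
  simp only [hgv] at h3
  linarith

theorem energy_of_mem (h : S.LinSol f a b y v) {s t : ℝ} (has : a ≤ s) (hst : s ≤ t) (htb : t ≤ b) :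
    ‖y t‖ ^ 2 = ‖y s‖ ^ 2 + ∫ r in s..t, 2 * (f r (v r) - ‖v r‖ ^ 2) :=
  (h.mono has htb).energy hst

theorem trans {c : ℝ} (hab : a ≤ b) (hbc : b ≤ c) (h : S.LinSol f a b y v)
    (h' : S.LinSol f b c z w) (hyz : z b = y b) :
    S.LinSol f a c (fun t => if t ≤ b then y t else z t) (fun t => if t ≤ b then v t else w t) := by
  set Y : ℝ → H := fun t => if t ≤ b then y t else z t
  set W : ℝ → V := fun t => if t ≤ b then v t else w t
  have hY1 : EqOn y Y (Icc a b) := fun t ht => by simp [Y, ht.2]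
  have hY2 : EqOn z Y (Icc b c) := fun t ht => by
    rcases ht.1.eq_or_lt with h | h
    · simp [Y, ← h, hyz]
    · simp [Y, not_le.2 h]
  have hW1 : v =ᵐ[volume.restrict (Ioc a b)] W := by
    filter_upwards [ae_restrict_mem measurableSet_Ioc] with t ht
    simp [W, ht.2]
  have hW2 : w =ᵐ[volume.restrict (Ioc b c)] W := by
    filter_upwards [ae_restrict_mem measurableSet_Ioc] with t ht
    simp [W, not_le.2 ht.1]
  have k1 := h.congr (Eventually.of_forall fun _ => rfl) hY1 hW1
  have k2 := h'.congr (Eventually.of_forall fun _ => rfl) hY2 hW2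
  have hU : Ioc a c = Ioc a b ∪ Ioc b c := (Ioc_union_Ioc_eq_Ioc hab hbc).symm
  have hU' : Icc a c = Icc a b ∪ Icc b c := (Icc_union_Icc_eq_Icc hab hbc).symm
  have hmem : ∀ {E : Type _} [NormedAddCommGroup E] {p : ℝ → E},
      MemLp p 2 (volume.restrict (Ioc a b)) → MemLp p 2 (volume.restrict (Ioc b c)) →
      MemLp p 2 (volume.restrict (Ioc a c)) := by
    intro E _ p h1 h2
    have hm := aestronglyMeasurable_union_iff.2 ⟨h1.1, h2.1⟩
    rw [← hU] at hm
    rw [memLp_two_iff_integrable_sq_norm hm, hU]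
    exact IntegrableOn.union (h1.integrable_norm_pow (by norm_num))
      (h2.integrable_norm_pow (by norm_num))
  refine ⟨?_, ?_, hmem k1.memv k2.memv, hmem k1.memf k2.memf, ?_⟩
  · rw [hU']
    exact k1.cont.union_of_isClosed k2.cont isClosed_Icc isClosed_Icc
  · rw [hU, ae_restrict_union_iff]
    exact ⟨k1.compat, k2.compat⟩
  · intro t ht
    rcases le_total t b with htb | htb
    · exact k1.eq t ⟨ht.1, htb⟩
    · have e1 := k1.eq b ⟨hab, le_rfl⟩
      have e2 := k2.eq t ⟨htb, ht.2⟩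
      rw [e2, e1, add_assoc, intervalIntegral.integral_add_adjacent_intervals]
      · exact (intervalIntegrable_iff_integrableOn_Ioc_of_le hab).2 k1.integrable_rhs
      · exact (intervalIntegrable_iff_integrableOn_Ioc_of_le htb).2
          (k2.integrable_rhs.mono_set (Ioc_subset_Ioc le_rfl ht.2))

end LinSol

end DiffusionSetting

/-! ### Solvability of the linear equation with a source in L²(V'). -/

theorem summable_of_norm_sum_sq_le {ι E : Type*} [NormedAddCommGroup E] [CompleteSpace E]
    {x : ι → E} {β : ι → ℝ} (hβ : Summable β)
    (h : ∀ s : Finset ι, ‖∑ i ∈ s, x i‖ ^ 2 ≤ ∑ i ∈ s, β i) : Summable x := by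
  rw [summable_iff_vanishing_norm]
  intro ε hε
  obtain ⟨s, hs⟩ := summable_iff_vanishing_norm.1 hβ (ε ^ 2) (by positivity)
  refine ⟨s, fun t ht => ?_⟩
  have h1 := hs t ht
  refine lt_of_pow_lt_pow_left₀ 2 hε.le ((h t).trans_lt ((le_abs_self _).trans_lt h1))

namespace DiffusionSetting

variable {V H : Type*}
  [NormedAddCommGroup V] [InnerProductSpace ℝ V] [CompleteSpace V]
  [NormedAddCommGroup H] [InnerProductSpace ℝ H] [CompleteSpace H]
  (S : DiffusionSetting V H)

/-- The solution of `c' = α (φ - c)`, `c(a) = k`. -/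
noncomputable def relaxation (α a k : ℝ) (φ : ℝ → ℝ) (t : ℝ) : ℝ :=
  Real.exp (-α * (t - a)) * (k + ∫ s in a..t, Real.exp (α * (s - a)) * (α * φ s))

theorem continuousOn_relaxation {α a b k : ℝ} {φ : ℝ → ℝ} (hab : a ≤ b)
    (hφ : IntervalIntegrable φ volume a b) :
    ContinuousOn (relaxation α a k φ) (Icc a b) := by
  have hq : IntervalIntegrable (fun s => Real.exp (α * (s - a)) * (α * φ s)) volume a b :=
    (hφ.const_mul α).continuousOn_mul (by fun_prop)
  have h1 := intervalIntegral.continuousOn_primitive_interval' hq left_mem_uIcc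
  rw [uIcc_of_le hab] at h1
  exact ContinuousOn.mul (by fun_prop) (continuousOn_const.add h1)

theorem relaxation_self (α a k : ℝ) (φ : ℝ → ℝ) : relaxation α a k φ a = k := by
  simp [relaxation]

theorem relaxation_eq {α a b k : ℝ} {φ : ℝ → ℝ} (hφ : IntervalIntegrable φ volume a b)
    {t : ℝ} (ht : t ∈ Icc a b) :
    relaxation α a k φ t = k + ∫ s in a..t, α * (φ s - relaxation α a k φ s) := by
  have hφ' : IntervalIntegrable φ volume a t := hφ.mono_set (by
    rw [uIcc_of_le ht.1, uIcc_of_le (ht.1.trans ht.2)]; exact Icc_subset_Icc le_rfl ht.2)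
  have hq : IntervalIntegrable (fun s => Real.exp (α * (s - a)) * (α * φ s)) volume a t :=
    (hφ'.const_mul α).continuousOn_mul (by fun_prop)
  have hp : IntervalIntegrable (fun s => -α * Real.exp (-α * (s - a))) volume a t :=
    (by fun_prop : Continuous fun s => -α * Real.exp (-α * (s - a))).intervalIntegrable _ _
  have hexp : ∀ r ∈ Icc a t, Real.exp (-α * (r - a)) = Real.exp (-α * (a - a)) +
      ∫ s in a..r, -α * Real.exp (-α * (s - a)) := by
    intro r _
    rw [intervalIntegral.integral_eq_sub_of_hasDerivAt (f := fun s => Real.exp (-α * (s - a)))]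
    · ring
    · intro x _
      have := (((hasDerivAt_id x).sub_const a).const_mul (-α)).exp
      simpa [mul_comm] using this
    · exact (by fun_prop : Continuous fun s => -α * Real.exp (-α * (s - a))).intervalIntegrable _ _
  have key := primitive_mul_sub ht.1 hp hq hexp
    (w := fun r => k + ∫ s in a..r, Real.exp (α * (s - a)) * (α * φ s)) (fun r _ => by simp)
  rw [sub_eq_iff_eq_add] at key
  rw [relaxation, key, add_comm]
  congr 1
  · simp
  · refine intervalIntegral.integral_congr fun s _ => ?_
    have h1 : Real.exp (-α * (s - a)) * Real.exp (α * (s - a)) = 1 := by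
      rw [← Real.exp_add]; simp
    simp only [relaxation]
    rw [← mul_assoc (Real.exp (-α * (s - a))) (Real.exp (α * (s - a))), h1]
    ring

/-- Multiply the equation by c: (c²)' = 2α(φ - c)c ≤ α(φ² - c²), the difference being α(φ - c)². For
one mode with α = mu⁻¹ this controls the H-norm at time t and the L²(V)-norm at once. -/
theorem relaxation_sq_le {α a b k : ℝ} {φ : ℝ → ℝ} (hα : 0 < α)
    (hφ : MemLp φ 2 (volume.restrict (Ioc a b))) {t : ℝ} (ht : t ∈ Icc a b) :
    α⁻¹ * relaxation α a k φ t ^ 2 + ∫ s in a..t, relaxation α a k φ s ^ 2 ≤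
      α⁻¹ * k ^ 2 + ∫ s in a..b, φ s ^ 2 := by
  have hab := ht.1.trans ht.2
  have hφi : IntervalIntegrable φ volume a b :=
    (intervalIntegrable_iff_integrableOn_Ioc_of_le hab).2 (hφ.integrable (by norm_num))
  have hsub : uIcc a t ⊆ uIcc a b := by
    rw [uIcc_of_le ht.1, uIcc_of_le hab]; exact Icc_subset_Icc le_rfl ht.2
  have hφt := hφi.mono_set hsub
  set c := relaxation α a k φ with hc
  have hcc : ContinuousOn c (uIcc a t) := by
    rw [uIcc_of_le ht.1]; exact continuousOn_relaxation ht.1 hφt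
  have hi : IntervalIntegrable (fun s => α * (φ s - c s)) volume a t :=
    (hφt.sub hcc.intervalIntegrable).const_mul α
  have hceq : ∀ r ∈ Icc a t, c r = c a + ∫ s in a..r, α * (φ s - c s) := fun r hr => by
    rw [hc, relaxation_self]
    exact relaxation_eq hφi ⟨hr.1, hr.2.trans ht.2⟩
  have key := primitive_mul_sub ht.1 hi hi hceq hceq
  have hsq : IntervalIntegrable (fun s => φ s ^ 2) volume a b :=
    (intervalIntegrable_iff_integrableOn_Ioc_of_le hab).2 hφ.integrable_sq
  have hcsq : IntervalIntegrable (fun s => c s ^ 2) volume a t := (hcc.pow 2).intervalIntegrable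
  have h1 : ∫ s in a..t, (α * (φ s - c s) * c s + c s * (α * (φ s - c s))) ≤
      ∫ s in a..t, α * (φ s ^ 2 - c s ^ 2) := by
    refine intervalIntegral.integral_mono_on ht.1 ?_
      (((hsq.mono_set hsub).sub hcsq).const_mul α) ?_
    · exact (hi.mul_continuousOn hcc).add (hi.continuousOn_mul hcc)
    · intro s _
      nlinarith [sq_nonneg (φ s - c s)]
  rw [← key, intervalIntegral.integral_const_mul,
    intervalIntegral.integral_sub (hsq.mono_set hsub) hcsq] at h1
  have h2 : ∫ s in a..t, φ s ^ 2 ≤ ∫ s in a..b, φ s ^ 2 :=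
    intervalIntegral.integral_mono_interval le_rfl ht.1 ht.2
      (ae_of_all _ fun s => sq_nonneg _) hsq
  rw [hc, relaxation_self, ← hc] at h1
  have h3 := mul_le_mul_of_nonneg_left h1 (inv_pos.2 hα).le
  rw [inv_mul_cancel_left₀ hα.ne'] at h3
  rw [← sq, ← sq] at h3
  linarith

variable {S} in
theorem EigenBasis.norm_sum_emb_sq {ι : Type*} (B : S.EigenBasis ι) (s : Finset ι) (c : ι → ℝ) :
    ‖∑ i ∈ s, c i • S.emb (B.basis i)‖ ^ 2 = ∑ i ∈ s, B.mu i * c i ^ 2 := by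
  classical
  rw [← real_inner_self_eq_norm_sq, sum_inner]
  refine Finset.sum_congr rfl fun i hi => ?_
  rw [inner_sum]
  simp_rw [real_inner_smul_left, real_inner_smul_right, B.inner_emb_basis]
  simp [hi]
  ring

variable {S} in
theorem EigenBasis.norm_sum_sq {ι : Type*} (B : S.EigenBasis ι) (s : Finset ι) (c : ι → ℝ) :
    ‖∑ i ∈ s, c i • B.basis i‖ ^ 2 = ∑ i ∈ s, c i ^ 2 := by
  rw [← real_inner_self_eq_norm_sq, B.basis.orthonormal.inner_sum]
  simp [sq]

theorem norm_sq_Lp_two {E X : Type*} [MeasurableSpace X] {m : Measure X} [NormedAddCommGroup E]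
    [InnerProductSpace ℝ E] (g : Lp E 2 m) : ‖g‖ ^ 2 = ∫ x, ‖g x‖ ^ 2 ∂m := by
  rw [← real_inner_self_eq_norm_sq, L2.inner_def]
  simp_rw [real_inner_self_eq_norm_sq]

/-- The coefficient of each mode solves a scalar relaxation equation with rate mu⁻¹. The estimate
`relaxation_sq_le` makes the series of modes converge both uniformly in H and in L²(V). -/
theorem exists_linSol {f : ℝ → StrongDual ℝ V} {a b : ℝ} (hab : a ≤ b)
    (hf : MemLp f 2 (volume.restrict (Ioc a b))) (y₀ : H) :
    ∃ (y : ℝ →ᵇ H) (v : Lp V 2 (volume.restrict (Ioc a b))),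
      S.LinSol f a b y v ∧ y a = y₀ ∧ ∀ t, y t = y (max a (min b t)) := by
  obtain ⟨ι, ⟨B⟩⟩ := S.exists_eigenBasis
  classical
  set φ : ι → ℝ → ℝ := fun i s => f s (B.basis i) with hφdef
  have hφ : ∀ i, MemLp (φ i) 2 (volume.restrict (Ioc a b)) := fun i =>
    (ContinuousLinearMap.apply ℝ ℝ (B.basis i)).comp_memLp' hf
  have hφi : ∀ i, IntervalIntegrable (φ i) volume a b := fun i =>
    (intervalIntegrable_iff_integrableOn_Ioc_of_le hab).2 ((hφ i).integrable (by norm_num))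
  set k : ι → ℝ := fun i => (B.mu i)⁻¹ * ⟪y₀, S.emb (B.basis i)⟫ with hk
  set c : ι → ℝ → ℝ := fun i => relaxation (B.mu i)⁻¹ a (k i) (φ i) with hc
  -- Energy budget of the i-th mode. These are summable, by Parseval for y₀ in H and for f(s) in V',
  -- and they dominate the partial sums in both spaces.
  set β : ι → ℝ := fun i => B.mu i * k i ^ 2 + ∫ s in a..b, φ i s ^ 2 with hβdef
  have hbound : ∀ i, ∀ t ∈ Icc a b, B.mu i * c i t ^ 2 + ∫ s in a..t, c i s ^ 2 ≤ β i := by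
    intro i t ht
    have := relaxation_sq_le (k := k i) (inv_pos.2 (B.mu_pos i)) (hφ i) ht
    rwa [inv_inv] at this
  have hβ : Summable β := by
    refine Summable.add ?_ ?_
    · refine (B.hasSum_norm_sq y₀).summable.congr fun i => ?_
      have := (B.mu_pos i).ne'
      simp only [hk]
      field_simp
    · refine summable_of_sum_le (c := ∫ s in Ioc a b, ‖f s‖ ^ 2)
        (fun i => intervalIntegral.integral_nonneg hab fun s _ => sq_nonneg _) fun s => ?_
      simp_rw [intervalIntegral.integral_of_le hab]
      rw [← integral_finsetSum _ fun i _ => (hφ i).integrable_sq]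
      refine integral_mono (integrable_finsetSum _ fun i _ => (hφ i).integrable_sq)
        (hf.integrable_norm_pow (by norm_num)) fun s' => ?_
      exact B.sum_sq_le _ _
  have hccont : ∀ i, ContinuousOn (c i) (Icc a b) := fun i => continuousOn_relaxation hab (hφi i)
  -- Clamping time to [a, b] extends the modes by constants, so that `y` lies in the Banach space of
  -- bounded continuous functions on the line used in the fixed point argument.
  set κ : ℝ → ℝ := fun t => max a (min b t) with hκ
  have hκc : Continuous κ := by fun_prop
  have hκm : ∀ t, κ t ∈ Icc a b := fun t => ⟨le_max_left _ _, max_le hab (min_le_left _ _)⟩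
  have hκid : ∀ t ∈ Icc a b, κ t = t := fun t ht => by simp [hκ, ht.1, ht.2]
  have hint : ∀ i, 0 ≤ ∫ s in a..b, c i s ^ 2 := fun i =>
    intervalIntegral.integral_nonneg hab fun s _ => sq_nonneg _
  have hint' : ∀ i, ∀ t ∈ Icc a b, 0 ≤ ∫ s in a..t, c i s ^ 2 := fun i t ht =>
    intervalIntegral.integral_nonneg ht.1 fun s _ => sq_nonneg _
  have hsum : ∀ s : Finset ι, ∀ t ∈ Icc a b,
      ‖∑ i ∈ s, c i t • S.emb (B.basis i)‖ ^ 2 ≤ ∑ i ∈ s, β i := by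
    intro s t ht
    rw [B.norm_sum_emb_sq]
    exact Finset.sum_le_sum fun i _ => by linarith [hbound i t ht, hint' i t ht]
  let F : ι → ℝ →ᵇ H := fun i => BoundedContinuousFunction.ofNormedAddCommGroup
    (fun t => c i (κ t) • S.emb (B.basis i))
    (((hccont i).comp_continuous hκc hκm).smul continuous_const) (√(β i)) (fun t => by
      have := hsum {i} (κ t) (hκm t)
      simp only [Finset.sum_singleton] at this
      exact Real.le_sqrt_of_sq_le this)
  have hF : ∀ i t, F i t = c i (κ t) • S.emb (B.basis i) := fun i t => rfl
  have hFsum : Summable F := by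
    refine summable_of_norm_sum_sq_le hβ fun s => ?_
    have hnn : 0 ≤ ∑ i ∈ s, β i := (sq_nonneg _).trans (hsum s a ⟨le_rfl, hab⟩)
    rw [← Real.le_sqrt (norm_nonneg _) hnn]
    refine (BoundedContinuousFunction.norm_le (Real.sqrt_nonneg _)).2 fun t => ?_
    rw [BoundedContinuousFunction.sum_apply]
    exact Real.le_sqrt_of_sq_le (hsum s _ (hκm t))
  have hcm : ∀ i, MemLp (fun t => c i t) 2 (volume.restrict (Ioc a b)) := fun i => by
    have hm : AEStronglyMeasurable (c i) (volume.restrict (Ioc a b)) :=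
      ((hccont i).mono Ioc_subset_Icc_self).aestronglyMeasurable measurableSet_Ioc
    rw [memLp_two_iff_integrable_sq hm]
    exact (((hccont i).pow 2).integrableOn_Icc).mono_set Ioc_subset_Icc_self
  have hGm : ∀ i, MemLp (fun t => c i t • B.basis i) 2 (volume.restrict (Ioc a b)) := fun i =>
    ((ContinuousLinearMap.id ℝ ℝ).smulRight (B.basis i)).comp_memLp' (hcm i)
  let G : ι → Lp V 2 (volume.restrict (Ioc a b)) := fun i => (hGm i).toLp
  have hGsum : Summable G := by
    refine summable_of_norm_sum_sq_le hβ fun s => ?_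
    have e : (∑ i ∈ s, G i : Lp V 2 (volume.restrict (Ioc a b)))
        =ᵐ[volume.restrict (Ioc a b)] fun t => ∑ i ∈ s, c i t • B.basis i := by
      induction s using Finset.induction_on with
      | empty => exact Lp.coeFn_zero V 2 (volume.restrict (Ioc a b))
      | insert i s hi ih =>
        rw [Finset.sum_insert hi]
        filter_upwards [Lp.coeFn_add (G i) (∑ i ∈ s, G i), ih, (hGm i).coeFn_toLp] with t h1 h2 h3
        rw [h1, Pi.add_apply, h2, h3, Finset.sum_insert hi]
    rw [norm_sq_Lp_two]
    have : ∫ x in Ioc a b, ‖(∑ i ∈ s, G i : Lp V 2 (volume.restrict (Ioc a b))) x‖ ^ 2 =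
        ∫ x in Ioc a b, ∑ i ∈ s, c i x ^ 2 := by
      apply integral_congr_ae
      filter_upwards [e] with x hx
      rw [hx, B.norm_sum_sq]
    rw [this, integral_finsetSum _ fun i _ => (hcm i).integrable_sq]
    refine Finset.sum_le_sum fun i _ => ?_
    have h1 := hbound i b ⟨hab, le_rfl⟩
    rw [intervalIntegral.integral_of_le hab] at h1
    have := mul_nonneg (B.mu_pos i).le (sq_nonneg (c i b))
    linarith
  set y : ℝ →ᵇ H := ∑' i, F i with hy
  set v : Lp V 2 (volume.restrict (Ioc a b)) := ∑' i, G i with hv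
  have hyt : ∀ t, HasSum (fun i => c i (κ t) • S.emb (B.basis i)) (y t) := fun t =>
    hFsum.hasSum.mapL (BoundedContinuousFunction.evalCLM ℝ t)
  have hyi : ∀ i t, ⟪y t, S.emb (B.basis i)⟫ = B.mu i * c i (κ t) := by
    intro i t
    have h1 := (hyt t).mapL (innerSL ℝ (S.emb (B.basis i)))
    simp only [innerSL_apply_apply, real_inner_smul_right, B.inner_emb_basis] at h1
    rw [real_inner_comm]
    refine h1.unique ?_
    convert hasSum_single i fun j hj => ?_ using 1
    · simp; ring
    · simp [hj.symm]
  -- Both series are mapped continuously into L²(a, b; H), where they agree term by term, so their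
  -- sums agree almost everywhere.
  have hcompat : ∀ᵐ t ∂volume.restrict (Ioc a b), S.emb (v t) = y t := by
    have h1 : HasSum (fun i => S.emb.compLpL 2 _ (G i)) (S.emb.compLpL 2 _ v) :=
      hGsum.hasSum.mapL _
    have h2 : HasSum (fun i => BoundedContinuousFunction.toLp 2 (volume.restrict (Ioc a b)) ℝ (F i))
      (BoundedContinuousFunction.toLp 2 (volume.restrict (Ioc a b)) ℝ y) := hFsum.hasSum.mapL _
    have h3 : ∀ i, S.emb.compLpL 2 _ (G i) =
        BoundedContinuousFunction.toLp 2 (volume.restrict (Ioc a b)) ℝ (F i) := by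
      intro i
      apply Lp.ext
      filter_upwards [S.emb.coeFn_compLpL (G i), BoundedContinuousFunction.coeFn_toLp
        (p := 2) (volume.restrict (Ioc a b)) ℝ (F i), (hGm i).coeFn_toLp,
        ae_restrict_mem measurableSet_Ioc] with t h4 h5 h6 h7
      rw [h4, h5, h6, hF, hκid t ⟨h7.1.le, h7.2⟩, map_smul]
    simp only [h3] at h1
    have h8 := h1.unique h2
    filter_upwards [S.emb.coeFn_compLpL v, BoundedContinuousFunction.coeFn_toLp
        (p := 2) (volume.restrict (Ioc a b)) ℝ y] with t h4 h5
    rw [← h4, h8, h5]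
  have hya : y a = y₀ := by
    refine B.eq_of_inner_eq fun i => ?_
    rw [hyi, hκid a ⟨le_rfl, hab⟩]
    simp only [hc, hk]
    rw [relaxation_self, mul_inv_cancel_left₀ (B.mu_pos i).ne']
  have hrhs : IntegrableOn (fun s => f s - S.A (v s)) (Ioc a b) :=
    (hf.sub (S.A.comp_memLp' (Lp.memLp v))).integrable (by norm_num)
  refine ⟨y, v, ⟨y.continuous.continuousOn, hcompat, Lp.memLp v, hf, fun t ht => ?_⟩, hya, ?_⟩
  · refine B.dual_ext fun i => ?_
    rw [add_apply, incl_apply, incl_apply, hyi, hyi, hκid t ht,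
      hκid a ⟨le_rfl, hab⟩, intervalIntegral.integral_of_le ht.1,
      ContinuousLinearMap.integral_apply (hrhs.mono_set (Ioc_subset_Ioc le_rfl ht.2))]
    have h1 := relaxation_eq (α := (B.mu i)⁻¹) (k := k i) (hφi i) ht
    change c i t = _ at h1
    have h2 : c i a = k i := relaxation_self _ _ _ _
    rw [h1, h2, mul_add, intervalIntegral.integral_of_le ht.1, ← integral_const_mul]
    congr 1
    apply integral_congr_ae
    filter_upwards [ae_restrict_of_ae_restrict_of_subset (Ioc_subset_Ioc le_rfl ht.2) hcompat,
      ae_restrict_mem measurableSet_Ioc] with s h3 h4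
    have h5 := hyi i s
    rw [← h3, real_inner_comm, B.inner_emb, hκid s ⟨h4.1.le, h4.2.trans ht.2⟩] at h5
    have h6 := mul_left_cancel₀ (B.mu_pos i).ne' h5
    rw [mul_inv_cancel_left₀ (B.mu_pos i).ne']
    change f s (B.basis i) - c i s = _
    rw [sub_apply, S.A_apply, ← h6, real_inner_comm]
  · intro t
    refine (hyt t).unique ?_
    have := hyt (κ t)
    rwa [hκid _ (hκm t)] at this

end DiffusionSetting

/-! ### Measurability of compositions, and Young inequalities for the nonlinearity. -/

/-- Approximate u by simple functions: for these the composition is a finite sum of indicators of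
measurable functions, and continuity in the second argument passes to the limit. -/
theorem aestronglyMeasurable_comp_caratheodory {X E G : Type*} [MeasurableSpace X] {m : Measure X}
    [TopologicalSpace E] [NormedAddCommGroup G] {F : X → E → G}
    (hm : ∀ e, AEStronglyMeasurable (fun x => F x e) m) (hc : ∀ᵐ x ∂m, Continuous (F x))
    {u : X → E} (hu : AEStronglyMeasurable u m) :
    AEStronglyMeasurable (fun x => F x (u x)) m := by
  classical
  have h1 : AEStronglyMeasurable (fun x => F x (hu.mk u x)) m := by
    refine aestronglyMeasurable_of_tendsto_ae atTop
      (f := fun k x => F x (hu.stronglyMeasurable_mk.approx k x)) (fun k => ?_) ?_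
    · set s := hu.stronglyMeasurable_mk.approx k
      have e : (fun x => F x (s x)) =
          fun x => ∑ e ∈ s.range, (s ⁻¹' {e}).indicator (fun x => F x e) x := by
        funext x
        rw [Finset.sum_eq_single (s x)]
        · rw [indicator_of_mem]; rfl
        · intro e _ he
          exact indicator_of_notMem (fun h => he (by simpa using h.symm)) _
        · intro h; exact absurd (s.mem_range_self x) h
      rw [e]
      exact Finset.aestronglyMeasurable_fun_sum _ fun e _ =>
        (hm e).indicator (s.measurableSet_preimage _)
    · filter_upwards [hc] with x hx
      exact (hx.tendsto _).comp (hu.stronglyMeasurable_mk.tendsto_approx x)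
  refine h1.congr ?_
  filter_upwards [hu.ae_eq_mk] with x hx
  rw [hx]

/-- Weighted arithmetic–geometric mean of κx, κz and 1 with weights p, q and 1 - p - q > 0. The
choice κ^(1 - p - q) = ε turns κ(x + z), after division by κ^(p + q), into ε(x + z). -/
theorem rpow_mul_rpow_le_add {p q ε : ℝ} (hp : 0 ≤ p) (hq : 0 ≤ q) (hpq : p + q < 1)
    (hε : 0 < ε) :
    ∃ C : ℝ, 0 ≤ C ∧ ∀ x z : ℝ, 0 ≤ x → 0 ≤ z → x ^ p * z ^ q ≤ ε * (x + z) + C := by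
  set κ : ℝ := ε ^ (1 / (1 - (p + q))) with hκ
  have hκ0 : 0 < κ := Real.rpow_pos_of_pos hε _
  have hκε : κ ^ (1 - (p + q)) = ε := by
    rw [hκ, ← Real.rpow_mul hε.le, one_div, inv_mul_cancel₀ (by linarith), Real.rpow_one]
  refine ⟨κ ^ (-(p + q)), (Real.rpow_pos_of_pos hκ0 _).le, fun x z hx hz => ?_⟩
  have h1 := Real.geom_mean_le_arith_mean3_weighted hp hq (by linarith : 0 ≤ 1 - (p + q))
    (mul_nonneg hκ0.le hx) (mul_nonneg hκ0.le hz) zero_le_one (by ring)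
  rw [Real.one_rpow, mul_one, Real.mul_rpow hκ0.le hx, Real.mul_rpow hκ0.le hz] at h1
  have h2 : κ ^ p * x ^ p * (κ ^ q * z ^ q) = κ ^ (p + q) * (x ^ p * z ^ q) := by
    rw [Real.rpow_add hκ0]; ring
  rw [h2] at h1
  have h3 : κ ^ (p + q) * (x ^ p * z ^ q) ≤ κ * (x + z) + 1 := by
    refine h1.trans ?_
    nlinarith [mul_nonneg hκ0.le hx, mul_nonneg hκ0.le hz]
  have h4 : κ ^ (-(p + q)) * κ ^ (p + q) = 1 := by rw [← Real.rpow_add hκ0]; simp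
  have h5 : κ ^ (-(p + q)) * κ = ε := by
    rw [← hκε]
    nth_rw 2 [← Real.rpow_one κ]
    rw [← Real.rpow_add hκ0]; congr 1; ring
  have h6 := mul_le_mul_of_nonneg_left h3 (Real.rpow_pos_of_pos hκ0 (-(p + q))).le
  rw [← mul_assoc, h4, one_mul, mul_add, ← mul_assoc, h5, mul_one] at h6
  exact h6

/-- The assumptions on the exponents of the nonlinearity. -/
structure AdmissibleExponents {n : ℕ} (ζ₁ ζ₂ δ₁ δ₂ : Fin n → ℝ) : Prop where
  zeta₁ : ∀ j, 0 ≤ ζ₁ j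
  zeta₂ : ∀ j, 0 ≤ ζ₂ j
  delta₁ : ∀ j, 0 ≤ δ₁ j
  delta₂ : ∀ j, 0 ≤ δ₂ j
  lt : ∀ j, ζ₂ j + δ₂ j < 1
  ge : ∀ j, 1 ≤ δ₁ j + δ₂ j

namespace AdmissibleExponents

variable {n : ℕ} {ζ₁ ζ₂ δ₁ δ₂ : Fin n → ℝ}

/-- Since δ₁ + δ₂ ≥ 1 and D ≤ 2r, a full factor D comes out of k^δ₁ l^δ₂, leaving (l/D)^δ₂. Young's
inequality in g² and (l/D)² then keeps all terms quadratic in (D, l). The scale D is only required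
to bound k: it is k itself for uniqueness, but the distance of two iterates in the contraction. -/
theorem term_sq_le (hE : AdmissibleExponents ζ₁ ζ₂ δ₁ δ₂) (j : Fin n) {r ε : ℝ} (hr : 0 < r)
    (hε : 0 < ε) :
    ∃ C : ℝ, 0 ≤ C ∧ ∀ D h₁ h₂ k g₁ g₂ l : ℝ, 0 < D → D ≤ 2 * r → 0 ≤ h₁ → h₁ ≤ r → 0 ≤ h₂ →
      h₂ ≤ r → 0 ≤ k → k ≤ D → 0 ≤ g₁ → 0 ≤ g₂ → 0 ≤ l →
      ((h₁ ^ ζ₁ j * g₁ ^ ζ₂ j + h₂ ^ ζ₁ j * g₂ ^ ζ₂ j) * (k ^ δ₁ j * l ^ δ₂ j)) ^ 2 ≤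
        ε * D ^ 2 * (g₁ ^ 2 + g₂ ^ 2) + ε * l ^ 2 + C * D ^ 2 := by
  set K : ℝ := (r ^ ζ₁ j * (2 * r) ^ (δ₁ j + δ₂ j - 1)) ^ 2 with hK
  have hK0 : 0 < K := by positivity
  -- The factor 4 accounts for the square of the sum g₁^ζ₂ + g₂^ζ₂, which costs 2, and for (l/D)²
  -- occurring once for each of its two terms.
  obtain ⟨C, hC0, hC⟩ := rpow_mul_rpow_le_add (hE.zeta₂ j) (hE.delta₂ j) (hE.lt j)
    (show 0 < ε / (4 * K) by positivity)
  refine ⟨4 * K * C, by positivity, fun D h₁ h₂ k g₁ g₂ l hD hDr h10 h1 h20 h2 k0 hk g10 g20 l0 => ?_⟩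
  have hsq : ∀ {g p : ℝ}, 0 ≤ g → (g ^ p) ^ 2 = (g ^ 2) ^ p := fun {g p} hg => by
    rw [← Real.rpow_natCast, ← Real.rpow_natCast, ← Real.rpow_mul hg, ← Real.rpow_mul hg, mul_comm]
  have hl : l = D * (l / D) := by field_simp
  have hDk : k ^ δ₁ j * l ^ δ₂ j ≤ (2 * r) ^ (δ₁ j + δ₂ j - 1) * D * (l / D) ^ δ₂ j := by
    have e1 : k ^ δ₁ j ≤ D ^ δ₁ j := Real.rpow_le_rpow k0 hk (hE.delta₁ j)
    have e2 : l ^ δ₂ j = D ^ δ₂ j * (l / D) ^ δ₂ j := by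
      rw [← Real.mul_rpow hD.le (by positivity), ← hl]
    have e3 : D ^ δ₁ j * D ^ δ₂ j = D ^ (δ₁ j + δ₂ j - 1) * D := by
      rw [← Real.rpow_add hD, Real.rpow_sub_one hD.ne', div_mul_cancel₀ _ hD.ne']
    have e4 : D ^ (δ₁ j + δ₂ j - 1) ≤ (2 * r) ^ (δ₁ j + δ₂ j - 1) :=
      Real.rpow_le_rpow hD.le hDr (by linarith [hE.ge j])
    calc k ^ δ₁ j * l ^ δ₂ j ≤ D ^ δ₁ j * (D ^ δ₂ j * (l / D) ^ δ₂ j) := by rw [e2]; gcongr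
      _ = D ^ (δ₁ j + δ₂ j - 1) * D * (l / D) ^ δ₂ j := by rw [← mul_assoc, e3]
      _ ≤ _ := by gcongr
  have hh : h₁ ^ ζ₁ j * g₁ ^ ζ₂ j + h₂ ^ ζ₁ j * g₂ ^ ζ₂ j ≤ r ^ ζ₁ j * (g₁ ^ ζ₂ j + g₂ ^ ζ₂ j) := by
    have e1 := Real.rpow_le_rpow h10 h1 (hE.zeta₁ j)
    have e2 := Real.rpow_le_rpow h20 h2 (hE.zeta₁ j)
    rw [mul_add]; gcongr
  set q := (l / D) ^ δ₂ j with hq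
  have key : (h₁ ^ ζ₁ j * g₁ ^ ζ₂ j + h₂ ^ ζ₁ j * g₂ ^ ζ₂ j) * (k ^ δ₁ j * l ^ δ₂ j) ≤
      (r ^ ζ₁ j * (g₁ ^ ζ₂ j + g₂ ^ ζ₂ j)) * ((2 * r) ^ (δ₁ j + δ₂ j - 1) * D * q) := by
    gcongr
  have c1 := hC (g₁ ^ 2) ((l / D) ^ 2) (by positivity) (by positivity)
  have c2 := hC (g₂ ^ 2) ((l / D) ^ 2) (by positivity) (by positivity)
  rw [← hsq g10, ← hsq (by positivity), ← hq] at c1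
  rw [← hsq g20, ← hsq (by positivity), ← hq] at c2
  calc ((h₁ ^ ζ₁ j * g₁ ^ ζ₂ j + h₂ ^ ζ₁ j * g₂ ^ ζ₂ j) * (k ^ δ₁ j * l ^ δ₂ j)) ^ 2
      ≤ ((r ^ ζ₁ j * (g₁ ^ ζ₂ j + g₂ ^ ζ₂ j)) * ((2 * r) ^ (δ₁ j + δ₂ j - 1) * D * q)) ^ 2 :=
        pow_le_pow_left₀ (by positivity) key 2
    _ = K * D ^ 2 * ((g₁ ^ ζ₂ j + g₂ ^ ζ₂ j) ^ 2 * q ^ 2) := by rw [hK]; ring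
    _ ≤ K * D ^ 2 * (2 * ((g₁ ^ ζ₂ j) ^ 2 * q ^ 2 + (g₂ ^ ζ₂ j) ^ 2 * q ^ 2)) := by
        refine mul_le_mul_of_nonneg_left ?_ (by positivity)
        nlinarith [mul_nonneg (sq_nonneg (g₁ ^ ζ₂ j - g₂ ^ ζ₂ j)) (sq_nonneg q)]
    _ ≤ K * D ^ 2 * (2 * (ε / (4 * K) * (g₁ ^ 2 + (l / D) ^ 2) + C +
          (ε / (4 * K) * (g₂ ^ 2 + (l / D) ^ 2) + C))) := by gcongr
    _ = ε / 2 * D ^ 2 * (g₁ ^ 2 + g₂ ^ 2) + ε * l ^ 2 + 4 * K * C * D ^ 2 := by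
        field_simp; ring
    _ ≤ _ := by
        have : 0 ≤ ε * D ^ 2 * (g₁ ^ 2 + g₂ ^ 2) := by positivity
        linarith

theorem sum_sq_le (hE : AdmissibleExponents ζ₁ ζ₂ δ₁ δ₂) {r ε : ℝ} (hr : 0 < r) (hε : 0 < ε) :
    ∃ C : ℝ, 0 ≤ C ∧ ∀ D h₁ h₂ k g₁ g₂ l : ℝ, 0 < D → D ≤ 2 * r → 0 ≤ h₁ → h₁ ≤ r → 0 ≤ h₂ →
      h₂ ≤ r → 0 ≤ k → k ≤ D → 0 ≤ g₁ → 0 ≤ g₂ → 0 ≤ l →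
      (∑ j, (h₁ ^ ζ₁ j * g₁ ^ ζ₂ j + h₂ ^ ζ₁ j * g₂ ^ ζ₂ j) * (k ^ δ₁ j * l ^ δ₂ j)) ^ 2 ≤
        ε * D ^ 2 * (g₁ ^ 2 + g₂ ^ 2) + ε * l ^ 2 + C * D ^ 2 := by
  -- One factor n comes from Cauchy–Schwarz and another from summing n equal contributions; the 1
  -- covers n = 0.
  set ε' : ℝ := ε / (n ^ 2 + 1) with hε'
  have hε'0 : 0 < ε' := by positivity
  choose C hC0 hC using fun j => hE.term_sq_le j hr hε'0
  refine ⟨n * ∑ j, C j, mul_nonneg (Nat.cast_nonneg _) (Finset.sum_nonneg fun j _ => hC0 j),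
    fun D h₁ h₂ k g₁ g₂ l hD hDr h10 h1 h20 h2 k0 hk g10 g20 l0 => ?_⟩
  refine (sq_sum_le_card_mul_sum_sq (s := Finset.univ)).trans ?_
  have h3 := Finset.sum_le_sum fun j (_ : j ∈ (Finset.univ : Finset (Fin n))) =>
    hC j D h₁ h₂ k g₁ g₂ l hD hDr h10 h1 h20 h2 k0 hk g10 g20 l0
  rw [Finset.sum_add_distrib, Finset.sum_const, ← Finset.sum_mul] at h3
  simp only [Finset.card_univ, Fintype.card_fin, nsmul_eq_mul] at h3 ⊢
  refine (mul_le_mul_of_nonneg_left h3 (Nat.cast_nonneg n)).trans ?_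
  set P := D ^ 2 * (g₁ ^ 2 + g₂ ^ 2) + l ^ 2 with hP
  have hP0 : 0 ≤ P := by positivity
  have h4 : (n : ℝ) ^ 2 * ε' ≤ ε := by
    rw [hε', ← mul_div_assoc, div_le_iff₀ (by positivity)]
    nlinarith
  have h5 := mul_le_mul_of_nonneg_right h4 hP0
  calc (n : ℝ) * (n * (ε' * D ^ 2 * (g₁ ^ 2 + g₂ ^ 2) + ε' * l ^ 2) + (∑ j, C j) * D ^ 2)
      = n ^ 2 * ε' * P + n * (∑ j, C j) * D ^ 2 := by rw [hP]; ring
    _ ≤ ε * P + n * (∑ j, C j) * D ^ 2 := by gcongr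
    _ = _ := by rw [hP]; ring

end AdmissibleExponents

/-! ### The class of perturbations: energy bound, growth and continuity. -/

namespace DiffusionSetting

variable {V H : Type*}
  [NormedAddCommGroup V] [InnerProductSpace ℝ V] [CompleteSpace V]
  [NormedAddCommGroup H] [InnerProductSpace ℝ H] [CompleteSpace H]
  (S : DiffusionSetting V H)

/-- Maps `F : V → V'` which are the sum of a linear perturbation and a nonlinearity of the class
considered. -/
structure PertBound {n : ℕ} (ζ₁ ζ₂ δ₁ δ₂ : Fin n → ℝ) (C₀ C₁ : ℝ) (F : V → StrongDual ℝ V) :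
    Prop where
  zero : F 0 = 0
  bound : ∀ v₁ v₂ w : V, |(F v₁ - F v₂) w| ≤
    C₀ * (‖S.emb (v₁ - v₂)‖ * ‖w‖ + ‖v₁ - v₂‖ * ‖S.emb w‖) +
    C₁ * (∑ j, (‖S.emb v₁‖ ^ ζ₁ j * ‖v₁‖ ^ ζ₂ j + ‖S.emb v₂‖ ^ ζ₁ j * ‖v₂‖ ^ ζ₂ j) *
        (‖S.emb (v₁ - v₂)‖ ^ δ₁ j * ‖v₁ - v₂‖ ^ δ₂ j)) * ‖w‖

namespace PertBound

variable {S} {n : ℕ} {ζ₁ ζ₂ δ₁ δ₂ : Fin n → ℝ} {C₀ C₁ : ℝ} {F : V → StrongDual ℝ V}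

theorem mono (h : S.PertBound ζ₁ ζ₂ δ₁ δ₂ C₀ C₁ F) {C₀' C₁' : ℝ} (h0 : C₀ ≤ C₀') (h1 : C₁ ≤ C₁') :
    S.PertBound ζ₁ ζ₂ δ₁ δ₂ C₀' C₁' F where
  zero := h.zero
  bound v₁ v₂ w := (h.bound v₁ v₂ w).trans (by gcongr)

-- The test vector `w` is independent of v₁ - v₂, so that one estimate serves uniqueness and decay,
-- where they coincide, and also the contraction, where `w` is the difference of the outputs and v₁
-- - v₂ that of the inputs. The coefficient 1 of ‖w‖² leaves half of the dissipation 2‖w‖².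
variable (S) in
theorem exists_energy_bound (hE : AdmissibleExponents ζ₁ ζ₂ δ₁ δ₂) (C₀ C₁ : ℝ) {r ε : ℝ}
    (hr : 0 < r) (hε : 0 < ε) :
    ∃ C : ℝ, 0 ≤ C ∧ ∀ F : V → StrongDual ℝ V, S.PertBound ζ₁ ζ₂ δ₁ δ₂ C₀ C₁ F →
      ∀ (v₁ v₂ w : V) (D : ℝ), 0 < D → D ≤ 2 * r → ‖S.emb v₁‖ ≤ r → ‖S.emb v₂‖ ≤ r →
        ‖S.emb (v₁ - v₂)‖ ≤ D →
        2 * |(F v₁ - F v₂) w| ≤ ‖w‖ ^ 2 + ε * D ^ 2 * (‖v₁‖ ^ 2 + ‖v₂‖ ^ 2) +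
          ε * ‖v₁ - v₂‖ ^ 2 + C * D ^ 2 + C * ‖S.emb w‖ ^ 2 := by
  set ε' : ℝ := ε / (4 * (C₁ ^ 2 + 1)) with hε'
  have hε'0 : 0 < ε' := by positivity
  obtain ⟨C, hC0, hC⟩ := hE.sum_sq_le hr hε'0
  refine ⟨2 * C₀ ^ 2 + 2 * C₁ ^ 2 * C + 2 * C₀ ^ 2 / ε, by positivity,
    fun F hF v₁ v₂ w D hD hDr h1 h2 hd => ?_⟩
  have h3 := hC D ‖S.emb v₁‖ ‖S.emb v₂‖ ‖S.emb (v₁ - v₂)‖ ‖v₁‖ ‖v₂‖ ‖v₁ - v₂‖ hD hDr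
    (norm_nonneg _) h1 (norm_nonneg _) h2 (norm_nonneg _) hd (norm_nonneg _) (norm_nonneg _)
    (norm_nonneg _)
  have h4 := hF.bound v₁ v₂ w
  set Q := ∑ j, (‖S.emb v₁‖ ^ ζ₁ j * ‖v₁‖ ^ ζ₂ j + ‖S.emb v₂‖ ^ ζ₁ j * ‖v₂‖ ^ ζ₂ j) *
        (‖S.emb (v₁ - v₂)‖ ^ δ₁ j * ‖v₁ - v₂‖ ^ δ₂ j) with hQ
  set k := ‖S.emb (v₁ - v₂)‖
  set l := ‖v₁ - v₂‖
  set x := ‖w‖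
  set z := ‖S.emb w‖
  set P := ‖v₁‖ ^ 2 + ‖v₂‖ ^ 2
  have hk0 : 0 ≤ k := norm_nonneg _
  have e1 : 2 * (C₀ * (k * x)) ≤ x ^ 2 / 2 + 2 * C₀ ^ 2 * D ^ 2 := by
    have : k ^ 2 ≤ D ^ 2 := pow_le_pow_left₀ hk0 hd 2
    nlinarith [sq_nonneg (x - 2 * C₀ * k), mul_le_mul_of_nonneg_left this (sq_nonneg C₀)]
  have e2 : 2 * (C₀ * (l * z)) ≤ ε / 2 * l ^ 2 + 2 * C₀ ^ 2 / ε * z ^ 2 := by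
    have h5 : ε / 2 * l ^ 2 + 2 * C₀ ^ 2 / ε * z ^ 2 - 2 * (C₀ * (l * z)) =
        (ε * l - 2 * C₀ * z) ^ 2 / (2 * ε) := by field_simp; ring
    have : 0 ≤ (ε * l - 2 * C₀ * z) ^ 2 / (2 * ε) := by positivity
    linarith
  have e3 : 2 * (C₁ * Q * x) ≤ x ^ 2 / 2 + 2 * C₁ ^ 2 * Q ^ 2 := by
    nlinarith [sq_nonneg (x - 2 * C₁ * Q)]
  have e4 : 2 * C₁ ^ 2 * ε' ≤ ε / 2 := by
    rw [hε', ← mul_div_assoc, div_le_iff₀ (by positivity)]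
    nlinarith
  have hP0 : 0 ≤ D ^ 2 * P + l ^ 2 := by positivity
  have e5 := mul_le_mul_of_nonneg_right e4 hP0
  have e6 := mul_le_mul_of_nonneg_left h3 (show 0 ≤ 2 * C₁ ^ 2 by positivity)
  have p1 : 0 ≤ ε * D ^ 2 * P := by positivity
  have p2 : 0 ≤ 2 * C₀ ^ 2 / ε * D ^ 2 := by positivity
  have p3 : 0 ≤ (2 * C₀ ^ 2 + 2 * C₁ ^ 2 * C) * z ^ 2 := by positivity
  nlinarith

-- Compare with 0 and rescale the test vector to length s = 1 + ‖v‖. The energy bound becomes a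
-- multiple of s², and dividing by s leaves linear growth.
variable (S) in
theorem exists_growth (hE : AdmissibleExponents ζ₁ ζ₂ δ₁ δ₂) (C₀ C₁ : ℝ) {r : ℝ} (hr : 0 < r) :
    ∃ C : ℝ, 0 ≤ C ∧ ∀ F : V → StrongDual ℝ V, S.PertBound ζ₁ ζ₂ δ₁ δ₂ C₀ C₁ F →
      ∀ v : V, ‖S.emb v‖ ≤ r → ‖F v‖ ≤ C * (1 + ‖v‖) := by
  obtain ⟨C, hC0, hC⟩ := exists_energy_bound S hE C₀ C₁ hr one_pos
  refine ⟨1 + r ^ 2 + 1 + C * r ^ 2 + C * ‖S.emb‖ ^ 2, by positivity, fun F hF v hv => ?_⟩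
  set s := 1 + ‖v‖ with hs
  have hs0 : 0 < s := by positivity
  refine ContinuousLinearMap.opNorm_le_bound _ (by positivity) fun w => ?_
  rcases eq_or_ne w 0 with rfl | hw
  · simp
  have hw0 : 0 < ‖w‖ := norm_pos_iff.2 hw
  have h1 := hC F hF v 0 ((s / ‖w‖) • w) r hr (by linarith) hv (by simpa using hr.le)
    (by simpa using hv)
  have hn : ‖(s / ‖w‖) • w‖ = s := by
    rw [norm_smul, Real.norm_eq_abs, abs_of_pos (by positivity)]; field_simp
  have h2 : ‖S.emb ((s / ‖w‖) • w)‖ ≤ ‖S.emb‖ * s :=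
    (S.emb.le_opNorm _).trans_eq (by rw [hn])
  have h3 : ‖S.emb ((s / ‖w‖) • w)‖ ^ 2 ≤ ‖S.emb‖ ^ 2 * s ^ 2 := by
    rw [← mul_pow]; exact pow_le_pow_left₀ (norm_nonneg _) h2 2
  rw [hF.zero, sub_zero, sub_zero, hn, map_smul, smul_eq_mul, abs_mul,
    abs_of_pos (show 0 < s / ‖w‖ by positivity), norm_zero] at h1
  have hv2 : ‖v‖ ^ 2 ≤ s ^ 2 := pow_le_pow_left₀ (norm_nonneg _) (by linarith) 2
  have hs1 : 1 ≤ s ^ 2 := by nlinarith [norm_nonneg v]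
  have h4 : 2 * (s / ‖w‖ * |F v w|) ≤
      (1 + r ^ 2 + 1 + C * r ^ 2 + C * ‖S.emb‖ ^ 2) * s ^ 2 := by
    refine h1.trans ?_
    nlinarith [mul_le_mul_of_nonneg_left h3 hC0, mul_le_mul_of_nonneg_left hv2 (sq_nonneg r),
      mul_le_mul_of_nonneg_left hs1 (mul_nonneg hC0 (sq_nonneg r))]
  have h5 : s / ‖w‖ * |F v w| ≤ (1 + r ^ 2 + 1 + C * r ^ 2 + C * ‖S.emb‖ ^ 2) * s ^ 2 := by
    have : 0 ≤ s / ‖w‖ * |F v w| := by positivity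
    linarith
  rw [div_mul_eq_mul_div, div_le_iff₀ hw0] at h5
  rw [Real.norm_eq_abs]
  refine le_of_mul_le_mul_left ?_ hs0
  linarith

/-- The same rescaling, now to the length of v₁ - v₂, with D proportional to that length. It
supplies the continuity needed for measurability of t ↦ F(t, v(t)). -/
theorem exists_lipschitz (hE : AdmissibleExponents ζ₁ ζ₂ δ₁ δ₂)
    (hF : S.PertBound ζ₁ ζ₂ δ₁ δ₂ C₀ C₁ F) {R : ℝ} (hR : 0 < R) :
    ∃ C : ℝ, ∀ v₁ v₂ : V, ‖v₁‖ ≤ R → ‖v₂‖ ≤ R → ‖F v₁ - F v₂‖ ≤ C * ‖v₁ - v₂‖ := by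
  set e := ‖S.emb‖ + 1 with he
  have he0 : 0 < e := by positivity
  obtain ⟨C, hC0, hC⟩ := exists_energy_bound S hE C₀ C₁ (mul_pos he0 hR) one_pos
  refine ⟨1 + e ^ 2 * (2 * R ^ 2) + 1 + C * e ^ 2 + C * ‖S.emb‖ ^ 2, fun v₁ v₂ h1 h2 => ?_⟩
  rcases eq_or_ne v₁ v₂ with rfl | hne
  · simp
  set s := ‖v₁ - v₂‖ with hs
  have hs0 : 0 < s := norm_pos_iff.2 (sub_ne_zero.2 hne)
  have hemb : ∀ v, ‖S.emb v‖ ≤ e * ‖v‖ := fun v =>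
    (S.emb.le_opNorm v).trans (mul_le_mul_of_nonneg_right (by linarith) (norm_nonneg _))
  refine ContinuousLinearMap.opNorm_le_bound _ (by positivity) fun w => ?_
  rcases eq_or_ne w 0 with rfl | hw
  · simp
  have hw0 : 0 < ‖w‖ := norm_pos_iff.2 hw
  have h3 := hC F hF v₁ v₂ ((s / ‖w‖) • w) (e * s) (by positivity)
    (by nlinarith [norm_sub_le v₁ v₂]) ((hemb _).trans (by gcongr)) ((hemb _).trans (by gcongr))
    (hemb _)
  have hn : ‖(s / ‖w‖) • w‖ = s := by
    rw [norm_smul, Real.norm_eq_abs, abs_of_pos (by positivity)]; field_simp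
  have h4 : ‖S.emb ((s / ‖w‖) • w)‖ ≤ ‖S.emb‖ * s :=
    (S.emb.le_opNorm _).trans_eq (by rw [hn])
  have h5 : ‖S.emb ((s / ‖w‖) • w)‖ ^ 2 ≤ ‖S.emb‖ ^ 2 * s ^ 2 := by
    rw [← mul_pow]; exact pow_le_pow_left₀ (norm_nonneg _) h4 2
  rw [hn, map_smul, smul_eq_mul, abs_mul, abs_of_pos (show 0 < s / ‖w‖ by positivity)] at h3
  have q1 : ‖v₁‖ ^ 2 ≤ R ^ 2 := pow_le_pow_left₀ (norm_nonneg _) h1 2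
  have q2 : ‖v₂‖ ^ 2 ≤ R ^ 2 := pow_le_pow_left₀ (norm_nonneg _) h2 2
  have h6 : s / ‖w‖ * |(F v₁ - F v₂) w| ≤
      (1 + e ^ 2 * (2 * R ^ 2) + 1 + C * e ^ 2 + C * ‖S.emb‖ ^ 2) * s ^ 2 := by
    have : 0 ≤ s / ‖w‖ * |(F v₁ - F v₂) w| := by positivity
    have q3 := mul_le_mul_of_nonneg_left (add_le_add q1 q2) (show 0 ≤ e ^ 2 * s ^ 2 by positivity)
    have q4 := mul_le_mul_of_nonneg_left h5 hC0
    nlinarith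
  rw [div_mul_eq_mul_div, div_le_iff₀ hw0] at h6
  rw [Real.norm_eq_abs]
  refine le_of_mul_le_mul_left ?_ hs0
  linarith

theorem continuous (hE : AdmissibleExponents ζ₁ ζ₂ δ₁ δ₂)
    (hF : S.PertBound ζ₁ ζ₂ δ₁ δ₂ C₀ C₁ F) : Continuous F := by
  rw [continuous_iff_continuousAt]
  intro v
  obtain ⟨C, hC⟩ := hF.exists_lipschitz hE (show 0 < ‖v‖ + 1 by positivity)
  rw [ContinuousAt, tendsto_iff_norm_sub_tendsto_zero]
  have h1 : Tendsto (fun w => C * ‖w - v‖) (𝓝 v) (𝓝 0) := by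
    have : Continuous fun w => C * ‖w - v‖ := by fun_prop
    simpa using this.tendsto v
  refine tendsto_of_tendsto_of_tendsto_of_le_of_le' tendsto_const_nhds h1
    (Eventually.of_forall fun _ => norm_nonneg _) ?_
  filter_upwards [Metric.ball_mem_nhds v one_pos] with w hw
  refine hC w v ?_ (by linarith)
  have := norm_le_norm_add_norm_sub' w v
  rw [mem_ball_iff_norm] at hw
  linarith

end PertBound

/-- Time-dependent perturbations on `(0, ∞)`. -/
structure IsPert {n : ℕ} (ζ₁ ζ₂ δ₁ δ₂ : Fin n → ℝ) (C₀ C₁ : ℝ) (F : ℝ → V → StrongDual ℝ V) :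
    Prop where
  bound : ∀ᵐ t ∂volume.restrict (Ioi (0 : ℝ)), S.PertBound ζ₁ ζ₂ δ₁ δ₂ C₀ C₁ (F t)
  meas : ∀ v, AEStronglyMeasurable (fun t => F t v) (volume.restrict (Ioi 0))

namespace IsPert

variable {S} {n : ℕ} {ζ₁ ζ₂ δ₁ δ₂ : Fin n → ℝ} {C₀ C₁ : ℝ} {F : ℝ → V → StrongDual ℝ V}

theorem ae_bound (hF : S.IsPert ζ₁ ζ₂ δ₁ δ₂ C₀ C₁ F) {a b : ℝ} (ha : 0 ≤ a) :
    ∀ᵐ t ∂volume.restrict (Ioc a b), S.PertBound ζ₁ ζ₂ δ₁ δ₂ C₀ C₁ (F t) :=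
  ae_restrict_of_ae_restrict_of_subset (Ioc_subset_Ioi_self.trans (Ioi_subset_Ioi ha)) hF.bound

theorem memLp_comp (hE : AdmissibleExponents ζ₁ ζ₂ δ₁ δ₂) (hF : S.IsPert ζ₁ ζ₂ δ₁ δ₂ C₀ C₁ F)
    {a b r : ℝ} (ha : 0 ≤ a) {v : ℝ → V} (hv : MemLp v 2 (volume.restrict (Ioc a b)))
    (hr : 0 < r) (hvr : ∀ᵐ t ∂volume.restrict (Ioc a b), ‖S.emb (v t)‖ ≤ r) :
    MemLp (fun t => F t (v t)) 2 (volume.restrict (Ioc a b)) := by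
  obtain ⟨C, hC0, hC⟩ := PertBound.exists_growth S hE C₀ C₁ hr
  have hm : AEStronglyMeasurable (fun t => F t (v t)) (volume.restrict (Ioc a b)) := by
    refine aestronglyMeasurable_comp_caratheodory (fun e => (hF.meas e).mono_measure
      (Measure.restrict_mono (Ioc_subset_Ioi_self.trans (Ioi_subset_Ioi ha)) le_rfl)) ?_ hv.1
    filter_upwards [hF.ae_bound ha] with t ht using ht.continuous hE
  have h1 : MemLp (fun _ : ℝ => (1 : ℝ)) 2 (volume.restrict (Ioc a b)) := memLp_const 1
  have hg : MemLp (fun t => C * (1 + ‖v t‖)) 2 (volume.restrict (Ioc a b)) :=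
    (h1.add hv.norm).const_mul C
  refine hg.mono hm ?_
  filter_upwards [hF.ae_bound ha, hvr] with t h1 h2
  rw [Real.norm_eq_abs]
  exact (hC _ h1 _ h2).trans (le_abs_self _)

end IsPert

end DiffusionSetting

/-! ### Uniqueness and local existence for the perturbed equation. -/

namespace DiffusionSetting

variable {V H : Type*}
  [NormedAddCommGroup V] [InnerProductSpace ℝ V] [CompleteSpace V]
  [NormedAddCommGroup H] [InnerProductSpace ℝ H] [CompleteSpace H]
  {S : DiffusionSetting V H} {n : ℕ} {ζ₁ ζ₂ δ₁ δ₂ : Fin n → ℝ} {C₀ C₁ : ℝ}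
  {F : ℝ → V → StrongDual ℝ V}

namespace LinSol

theorem exists_norm_le {f : ℝ → StrongDual ℝ V} {a b : ℝ} {y : ℝ → H} {v : ℝ → V}
    (h : S.LinSol f a b y v) : ∃ r > 0, (∀ t ∈ Icc a b, ‖y t‖ ≤ r) ∧
      ∀ᵐ t ∂volume.restrict (Ioc a b), ‖S.emb (v t)‖ ≤ r := by
  obtain ⟨r, hr⟩ := isCompact_Icc.exists_bound_of_continuousOn h.cont
  refine ⟨max r 1, by positivity, fun t ht => (hr t ht).trans (le_max_left _ _), ?_⟩
  filter_upwards [h.compat, ae_restrict_mem measurableSet_Ioc] with t h1 h2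
  rw [h1]
  exact (hr t ⟨h2.1.le, h2.2⟩).trans (le_max_left _ _)

end LinSol

/-- Take ε = 1 and D = |v - w|_H in the energy bound for the difference. The terms ‖v - w‖² cancel
the dissipation exactly, and what remains is |y - z|_H² times ‖v‖² + ‖w‖² + 2C, an integrable rate
to which the Gronwall lemma applies. -/
theorem IsPert.eqOn_of_linSol (hE : AdmissibleExponents ζ₁ ζ₂ δ₁ δ₂)
    (hF : S.IsPert ζ₁ ζ₂ δ₁ δ₂ C₀ C₁ F) {a b : ℝ} (ha : 0 ≤ a) {y z : ℝ → H} {v w : ℝ → V}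
    (h : S.LinSol (fun s => F s (v s)) a b y v) (h' : S.LinSol (fun s => F s (w s)) a b z w)
    (hyz : y a = z a) : EqOn y z (Icc a b) := by
  obtain ⟨r₁, hr₁, -, hv⟩ := h.exists_norm_le
  obtain ⟨r₂, hr₂, -, hw⟩ := h'.exists_norm_le
  set r := max r₁ r₂ with hrdef
  have hr : 0 < r := lt_max_of_lt_left hr₁
  obtain ⟨C, hC0, hC⟩ := PertBound.exists_energy_bound S hE C₀ C₁ hr one_pos
  have hd := h.sub h'
  have hk : IntegrableOn (fun t => ‖v t‖ ^ 2 + ‖w t‖ ^ 2 + 2 * C) (Ioc a b) :=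
    Integrable.add (Integrable.add (h.memv.integrable_norm_pow (by norm_num))
      (h'.memv.integrable_norm_pow (by norm_num))) (integrable_const _)
  have key := eq_zero_of_le_integral (E := fun t => ‖y t - z t‖ ^ 2)
    (hd.cont.norm.pow 2)
    (fun _ _ => sq_nonneg _) (by simp [hyz])
    hk
    (hd.integrable_energy.const_mul 2) ?_
    (fun s hs t ht => hd.energy_of_mem hs.1 ht.1 ht.2)
  · intro t ht
    have := key t ht
    simpa [sub_eq_zero] using this
  · filter_upwards [hF.ae_bound ha, hv, hw, hd.compat] with t h1 h2 h3 h4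
    rw [← h4]
    rcases eq_or_ne (v t) (w t) with e | e
    · simp [e]
    have hD : 0 < ‖S.emb (v t - w t)‖ := by
      rw [norm_pos_iff, map_sub, sub_ne_zero]
      exact fun h => e (S.emb_injective h)
    have h2' := h2.trans (le_max_left r₁ r₂)
    have h3' := h3.trans (le_max_right r₁ r₂)
    have h5 := hC (F t) h1 (v t) (w t) (v t - w t) _ hD
      (by rw [map_sub]; linarith [norm_sub_le (S.emb (v t)) (S.emb (w t))]) h2' h3' le_rfl
    have h6 := le_abs_self ((F t (v t) - F t (w t)) (v t - w t))
    nlinarith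

/-- The estimate behind the contraction property of the solution map. -/
theorem IsPert.linSol_sub_le {r ε C : ℝ} (hε : 0 < ε) (hC0 : 0 ≤ C)
    (hC : ∀ F : V → StrongDual ℝ V, S.PertBound ζ₁ ζ₂ δ₁ δ₂ C₀ C₁ F →
      ∀ (v₁ v₂ w : V) (D : ℝ), 0 < D → D ≤ 2 * r → ‖S.emb v₁‖ ≤ r → ‖S.emb v₂‖ ≤ r →
        ‖S.emb (v₁ - v₂)‖ ≤ D →
        2 * |(F v₁ - F v₂) w| ≤ ‖w‖ ^ 2 + ε * D ^ 2 * (‖v₁‖ ^ 2 + ‖v₂‖ ^ 2) +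
          ε * ‖v₁ - v₂‖ ^ 2 + C * D ^ 2 + C * ‖S.emb w‖ ^ 2)
    (hεr : ε * (2 * r ^ 2 + 1) ≤ 1 / 16)
    (hF : S.IsPert ζ₁ ζ₂ δ₁ δ₂ C₀ C₁ F) {a b : ℝ} (ha : 0 ≤ a) (hab : a ≤ b)
    (hCb : C * (b - a) ≤ 1 / 16) {y₁ y₂ : ℝ → H} {v₁ v₂ u₁ u₂ : ℝ → V}
    (h₁ : S.LinSol (fun s => F s (u₁ s)) a b y₁ v₁) (h₂ : S.LinSol (fun s => F s (u₂ s)) a b y₂ v₂)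
    {D : ℝ} (hD : 0 < D) (hDr : D ≤ 2 * r)
    (hu₁ : MemLp u₁ 2 (volume.restrict (Ioc a b))) (hu₂ : MemLp u₂ 2 (volume.restrict (Ioc a b)))
    (hi₁ : ∫ t in Ioc a b, ‖u₁ t‖ ^ 2 ≤ r ^ 2) (hi₂ : ∫ t in Ioc a b, ‖u₂ t‖ ^ 2 ≤ r ^ 2)
    (hid : ∫ t in Ioc a b, ‖u₁ t - u₂ t‖ ^ 2 ≤ D ^ 2)
    (hs₁ : ∀ᵐ t ∂volume.restrict (Ioc a b), ‖S.emb (u₁ t)‖ ≤ r)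
    (hs₂ : ∀ᵐ t ∂volume.restrict (Ioc a b), ‖S.emb (u₂ t)‖ ≤ r)
    (hsd : ∀ᵐ t ∂volume.restrict (Ioc a b), ‖S.emb (u₁ t - u₂ t)‖ ≤ D) :
    (∀ t ∈ Icc a b, ‖y₁ t - y₂ t‖ ^ 2 ≤ 2 * ‖y₁ a - y₂ a‖ ^ 2 + D ^ 2 / 4) ∧
      ∫ t in Ioc a b, ‖v₁ t - v₂ t‖ ^ 2 ≤ 2 * ‖y₁ a - y₂ a‖ ^ 2 + D ^ 2 / 4 := by
  have hd := h₁.sub h₂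
  obtain ⟨x, hx, hmax⟩ := isCompact_Icc.exists_isMaxOn (nonempty_Icc.2 hab) (hd.cont.norm.pow 2)
  -- The term C|w|_H² of the energy bound is replaced by C m, with `m` the maximum over the
  -- interval. Integrated, it contributes at most m/16, which is absorbed on the left.
  set m := ‖y₁ x - y₂ x‖ ^ 2 with hm
  have hm0 : 0 ≤ m := sq_nonneg _
  have hmle : ∀ t ∈ Icc a b, ‖y₁ t - y₂ t‖ ^ 2 ≤ m := fun t ht => hmax ht
  set p : ℝ → ℝ := fun t => ε * D ^ 2 * (‖u₁ t‖ ^ 2 + ‖u₂ t‖ ^ 2) + ε * ‖u₁ t - u₂ t‖ ^ 2 +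
    (C * D ^ 2 + C * m) with hp
  have hq₁ : IntegrableOn (fun t => ‖u₁ t‖ ^ 2) (Ioc a b) := hu₁.integrable_norm_pow (by norm_num)
  have hq₂ : IntegrableOn (fun t => ‖u₂ t‖ ^ 2) (Ioc a b) := hu₂.integrable_norm_pow (by norm_num)
  have hqd : IntegrableOn (fun t => ‖u₁ t - u₂ t‖ ^ 2) (Ioc a b) :=
    (hu₁.sub hu₂).integrable_norm_pow (by norm_num)
  have hqv : IntegrableOn (fun t => ‖v₁ t - v₂ t‖ ^ 2) (Ioc a b) :=
    hd.memv.integrable_norm_pow (by norm_num)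
  have hp1 : IntegrableOn (fun t => ε * D ^ 2 * (‖u₁ t‖ ^ 2 + ‖u₂ t‖ ^ 2)) (Ioc a b) :=
    (hq₁.add hq₂).const_mul _
  have hp2 : IntegrableOn (fun t => ε * ‖u₁ t - u₂ t‖ ^ 2) (Ioc a b) := hqd.const_mul _
  have hp3 : IntegrableOn (fun _ => C * D ^ 2 + C * m) (Ioc a b) := integrable_const _
  have hp12 : IntegrableOn (fun t => ε * D ^ 2 * (‖u₁ t‖ ^ 2 + ‖u₂ t‖ ^ 2) +
    ε * ‖u₁ t - u₂ t‖ ^ 2) (Ioc a b) := hp1.add hp2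
  have hpi : IntegrableOn p (Ioc a b) := hp12.add hp3
  have hp0 : ∀ t, 0 ≤ p t := fun t => by positivity
  have hpint : ∫ t in Ioc a b, p t ≤ D ^ 2 / 8 + m / 16 := by
    have e : ∫ t in Ioc a b, p t = ε * D ^ 2 * ((∫ t in Ioc a b, ‖u₁ t‖ ^ 2) +
        ∫ t in Ioc a b, ‖u₂ t‖ ^ 2) + ε * (∫ t in Ioc a b, ‖u₁ t - u₂ t‖ ^ 2) +
        (b - a) * (C * D ^ 2 + C * m) := by
      simp only [hp]
      rw [integral_add hp12 hp3, integral_add hp1 hp2, integral_const_mul,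
        integral_add hq₁ hq₂, integral_const_mul]
      simp [hab]
    rw [e]
    have e1 : ε * D ^ 2 * ((∫ t in Ioc a b, ‖u₁ t‖ ^ 2) + ∫ t in Ioc a b, ‖u₂ t‖ ^ 2) ≤
        ε * D ^ 2 * (r ^ 2 + r ^ 2) := by gcongr
    have e2 : ε * (∫ t in Ioc a b, ‖u₁ t - u₂ t‖ ^ 2) ≤ ε * D ^ 2 := by gcongr
    have e3 := mul_le_mul_of_nonneg_right hεr (sq_nonneg D)
    have e4 := mul_le_mul_of_nonneg_right hCb (add_nonneg (sq_nonneg D) hm0)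
    nlinarith
  have hmain : ∀ t ∈ Icc a b, ‖y₁ t - y₂ t‖ ^ 2 + ∫ s in Ioc a t, ‖v₁ s - v₂ s‖ ^ 2 ≤
      ‖y₁ a - y₂ a‖ ^ 2 + (D ^ 2 / 8 + m / 16) := by
    intro t ht
    have hsub : Ioc a t ⊆ Ioc a b := Ioc_subset_Ioc le_rfl ht.2
    have h1 := hd.energy_of_mem le_rfl ht.1 ht.2
    rw [intervalIntegral.integral_of_le ht.1] at h1
    have h2 : ∫ s in Ioc a t, 2 * ((F s (u₁ s) - F s (u₂ s)) (v₁ s - v₂ s) - ‖v₁ s - v₂ s‖ ^ 2) ≤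
        ∫ s in Ioc a t, (p s - ‖v₁ s - v₂ s‖ ^ 2) := by
      refine integral_mono_ae (IntegrableOn.mono_set (hd.integrable_energy.const_mul 2) hsub)
        (IntegrableOn.mono_set (hpi.sub hqv) hsub) ?_
      refine ae_restrict_of_ae_restrict_of_subset hsub ?_
      filter_upwards [hF.ae_bound ha, hs₁, hs₂, hsd, hd.compat,
        ae_restrict_mem measurableSet_Ioc] with s k1 k2 k3 k4 k5 k6
      have k7 := hC (F s) k1 (u₁ s) (u₂ s) (v₁ s - v₂ s) D hD hDr k2 k3 k4
      have k8 := le_abs_self ((F s (u₁ s) - F s (u₂ s)) (v₁ s - v₂ s))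
      have k9 : C * ‖S.emb (v₁ s - v₂ s)‖ ^ 2 ≤ C * m := by
        rw [k5]; exact mul_le_mul_of_nonneg_left (hmle s ⟨k6.1.le, k6.2⟩) hC0
      simp only [hp]
      linarith
    rw [integral_sub (hpi.mono_set hsub) (hqv.mono_set hsub)] at h2
    have h3 : ∫ s in Ioc a t, p s ≤ ∫ s in Ioc a b, p s :=
      setIntegral_mono_set hpi (ae_of_all _ hp0) hsub.eventuallyLE
    linarith
  have hmx : m ≤ ‖y₁ a - y₂ a‖ ^ 2 + (D ^ 2 / 8 + m / 16) := by
    have h1 := hmain x hx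
    have h2 : 0 ≤ ∫ s in Ioc a x, ‖v₁ s - v₂ s‖ ^ 2 := integral_nonneg fun s => sq_nonneg _
    linarith
  have hy0 := sq_nonneg ‖y₁ a - y₂ a‖
  have hD0 := sq_nonneg D
  refine ⟨fun t ht => (hmle t ht).trans (by linarith), ?_⟩
  have h1 := hmain b ⟨hab, le_rfl⟩
  have h2 := sq_nonneg ‖y₁ b - y₂ b‖
  linarith

theorem linSol_zero {a b : ℝ} {f : ℝ → StrongDual ℝ V}
    (hf : f =ᵐ[volume.restrict (Ioc a b)] fun _ => 0) :
    S.LinSol f a b (fun _ => 0) (fun _ => 0) := by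
  have h : S.LinSol (fun _ => 0) a b (fun _ => 0) (fun _ => 0) :=
    ⟨continuousOn_const, ae_of_all _ fun _ => map_zero _, memLp_const 0, memLp_const 0,
      fun t _ => by simp⟩
  exact h.congr hf.symm (fun _ _ => rfl) (Eventually.of_forall fun _ => rfl)

/-- Local existence, on a time interval whose length depends only on a bound for the initial
value. -/
theorem IsPert.exists_local (hE : AdmissibleExponents ζ₁ ζ₂ δ₁ δ₂) (C₀ C₁ : ℝ) {R : ℝ}
    (hR : 0 < R) :
    ∃ τ > 0, ∀ F : ℝ → V → StrongDual ℝ V, S.IsPert ζ₁ ζ₂ δ₁ δ₂ C₀ C₁ F → ∀ a ≥ 0, ∀ y₀ : H,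
      ‖y₀‖ ≤ R → ∃ (y : ℝ → H) (v : ℝ → V),
        S.LinSol (fun s => F s (v s)) a (a + τ) y v ∧ y a = y₀ := by
  -- With |y₀| ≤ R and D = r, the estimate `linSol_sub_le` bounds the squared norms of the image by
  -- 2R² + r²/4 = 3R² ≤ r², so the ball of radius r is mapped into itself.
  set r := 2 * R with hr
  have hr0 : 0 < r := by positivity
  set ε : ℝ := 1 / (16 * (2 * r ^ 2 + 1)) with hε
  have hε0 : 0 < ε := by positivity
  have hεr : ε * (2 * r ^ 2 + 1) ≤ 1 / 16 := by
    rw [hε]; apply le_of_eq; field_simp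
  obtain ⟨C, hC0, hC⟩ := PertBound.exists_energy_bound S hE C₀ C₁ hr0 hε0
  refine ⟨1 / (16 * (C + 1)), by positivity, fun F hF a ha y₀ hy₀ => ?_⟩
  set b := a + 1 / (16 * (C + 1)) with hb
  have hab : a ≤ b := by rw [hb]; linarith [show 0 < 1 / (16 * (C + 1)) by positivity]
  have hCb : C * (b - a) ≤ 1 / 16 := by
    rw [hb, add_sub_cancel_left, mul_one_div, div_le_div_iff₀ (by positivity) (by positivity)]
    linarith
  set m := volume.restrict (Ioc a b) with hm
  -- The two components represent the same function, once in C(H) and once in L²(V). This is a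
  -- closed condition, so `K` is complete.
  let K : Set ((ℝ →ᵇ H) × Lp V 2 m) :=
    {p | (‖p.1‖ ≤ r ∧ ‖p.2‖ ≤ r) ∧ S.emb.compLpL 2 m p.2 = BoundedContinuousFunction.toLp 2 m ℝ p.1}
  have hKcl : IsClosed K := by
    refine IsClosed.inter (IsClosed.inter ?_ ?_) ?_
    · exact isClosed_le continuous_fst.norm continuous_const
    · exact isClosed_le continuous_snd.norm continuous_const
    · exact isClosed_eq ((S.emb.compLpL 2 m).continuous.comp continuous_snd)
        ((BoundedContinuousFunction.toLp 2 m ℝ).continuous.comp continuous_fst)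
  have hKae : ∀ p : (ℝ →ᵇ H) × Lp V 2 m,
      S.emb.compLpL 2 m p.2 = BoundedContinuousFunction.toLp 2 m ℝ p.1 ↔
      ∀ᵐ t ∂m, S.emb (p.2 t) = p.1 t := by
    intro p
    rw [Lp.ext_iff]
    have h1 := S.emb.coeFn_compLpL p.2
    have h2 := BoundedContinuousFunction.coeFn_toLp (p := 2) m ℝ p.1
    constructor
    · intro h
      filter_upwards [h, h1, h2] with t k1 k2 k3
      rw [← k2, k1, k3]
    · intro h
      filter_upwards [h, h1, h2] with t k1 k2 k3
      rw [k2, k1, k3]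
  have hKs : ∀ p : K, ∀ᵐ t ∂m, ‖S.emb (p.1.2 t)‖ ≤ r := by
    intro p
    filter_upwards [(hKae p.1).1 p.2.2] with t ht
    rw [ht]
    exact (p.1.1.norm_coe_le_norm t).trans p.2.1.1
  have hKi : ∀ p : K, ∫ t in Ioc a b, ‖p.1.2 t‖ ^ 2 ≤ r ^ 2 := by
    intro p
    rw [← norm_sq_Lp_two]
    exact pow_le_pow_left₀ (norm_nonneg _) p.2.1.2 2
  have hKm : ∀ p : K, MemLp (fun t => F t (p.1.2 t)) 2 m := fun p =>
    hF.memLp_comp hE ha (Lp.memLp p.1.2) hr0 (hKs p)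
  choose Y W hsol hY0 hYc using fun p : K => S.exists_linSol hab (hKm p) y₀
  have hclamp : ∀ t, max a (min b t) ∈ Icc a b := fun t =>
    ⟨le_max_left _ _, max_le hab (min_le_left _ _)⟩
  -- Comparison with the zero solution, which solves the equation because F(t, 0) = 0.
  have hmaps : ∀ p : K, (Y p, W p) ∈ K := by
    intro p
    have hz : S.LinSol (fun s => F s ((fun _ => (0 : V)) s)) a b (fun _ => 0) (fun _ => 0) := by
      refine linSol_zero ?_
      filter_upwards [hF.ae_bound ha] with t ht using ht.zero
    obtain ⟨k1, k2⟩ := hF.linSol_sub_le hε0 hC0 hC hεr ha hab hCb (hsol p) hz (D := r) hr0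
      (by linarith) (Lp.memLp p.1.2) MemLp.zero' (hKi p) (by simp; positivity)
      (by simpa using hKi p) (hKs p) (by simp [hr0.le]) (by simpa only [sub_zero] using hKs p)
    simp only [sub_zero, hY0] at k1 k2
    have hle : 2 * ‖y₀‖ ^ 2 + r ^ 2 / 4 ≤ r ^ 2 := by
      have := pow_le_pow_left₀ (norm_nonneg _) hy₀ 2
      rw [hr]; nlinarith
    refine ⟨⟨?_, ?_⟩, (hKae _).2 (hsol p).compat⟩
    · refine (BoundedContinuousFunction.norm_le hr0.le).2 fun t => ?_
      rw [hYc]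
      exact le_of_sq_le_sq ((k1 _ (hclamp t)).trans hle) hr0.le
    · refine le_of_sq_le_sq ?_ hr0.le
      rw [norm_sq_Lp_two]
      exact k2.trans hle
  let Ψ : K → K := fun p => ⟨(Y p, W p), hmaps p⟩
  -- Both images start at y₀, so the squared distance is at most D²/4 in each component, where D is
  -- the distance of the inputs.
  have hcontr : ContractingWith (1 / 2) Ψ := by
    refine ⟨by norm_num, LipschitzWith.of_dist_le_mul fun p q => ?_⟩
    rcases eq_or_ne p q with rfl | hpq
    · simp
    have hD : 0 < dist p q := dist_pos.2 hpq
    set D := dist p q with hDdef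
    have hD1 : ‖p.1.1 - q.1.1‖ ≤ D := by
      rw [← dist_eq_norm]; exact le_max_left _ _
    have hD2 : ‖p.1.2 - q.1.2‖ ≤ D := by
      rw [← dist_eq_norm]; exact le_max_right _ _
    have hDr : D ≤ 2 * r := by
      refine max_le ?_ ?_
      · rw [dist_eq_norm]; exact (norm_sub_le _ _).trans (by linarith [p.2.1.1, q.2.1.1])
      · rw [dist_eq_norm]; exact (norm_sub_le _ _).trans (by linarith [p.2.1.2, q.2.1.2])
    have hsq : ∀ g g' : Lp V 2 m, ‖g - g'‖ ^ 2 = ∫ t in Ioc a b, ‖g t - g' t‖ ^ 2 := by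
      intro g g'
      rw [norm_sq_Lp_two]
      refine integral_congr_ae ?_
      filter_upwards [Lp.coeFn_sub g g'] with t ht
      rw [ht, Pi.sub_apply]
    obtain ⟨k1, k2⟩ := hF.linSol_sub_le hε0 hC0 hC hεr ha hab hCb (hsol p) (hsol q) hD hDr
      (Lp.memLp p.1.2) (Lp.memLp q.1.2) (hKi p) (hKi q)
      (by rw [← hsq]; exact pow_le_pow_left₀ (norm_nonneg _) hD2 2) (hKs p) (hKs q)
      (by
        filter_upwards [(hKae p.1).1 p.2.2, (hKae q.1).1 q.2.2] with t e1 e2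
        rw [map_sub, e1, e2]
        exact ((p.1.1 - q.1.1).norm_coe_le_norm t).trans hD1)
    simp only [hY0, sub_self, norm_zero] at k1 k2
    have hhalf : 2 * (0 : ℝ) ^ 2 + D ^ 2 / 4 = (D / 2) ^ 2 := by ring
    rw [hhalf] at k1 k2
    have hcoe : ((1 / 2 : ℝ≥0) : ℝ) * D = D / 2 := by push_cast; ring
    rw [hcoe]
    refine max_le ?_ ?_
    · rw [dist_eq_norm]
      refine (BoundedContinuousFunction.norm_le (by positivity)).2 fun t => ?_
      change ‖Y p t - Y q t‖ ≤ _
      rw [hYc p, hYc q]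
      exact le_of_sq_le_sq (k1 _ (hclamp t)) (by positivity)
    · rw [dist_eq_norm]
      refine le_of_sq_le_sq ?_ (by positivity)
      change ‖W p - W q‖ ^ 2 ≤ _
      rw [hsq]; exact k2
  have : CompleteSpace K := hKcl.completeSpace_coe
  have hz : (0 : (ℝ →ᵇ H) × Lp V 2 m) ∈ K := by
    refine ⟨⟨by simp [hr0.le], by simp [hr0.le]⟩, by simp⟩
  have : Nonempty K := ⟨⟨0, hz⟩⟩
  set p := hcontr.fixedPoint Ψ with hp
  have hfix : Ψ p = p := hcontr.fixedPoint_isFixedPt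
  have e2 : W p = p.1.2 := congrArg (fun q : K => q.1.2) hfix
  refine ⟨Y p, W p, ?_, hY0 p⟩
  have h := hsol p
  rwa [e2] at h ⊢

end DiffusionSetting

namespace DiffusionSetting

variable {V H : Type*}
  [NormedAddCommGroup V] [InnerProductSpace ℝ V] [CompleteSpace V]
  [NormedAddCommGroup H] [InnerProductSpace ℝ H] [CompleteSpace H]
  {S : DiffusionSetting V H} {n : ℕ} {ζ₁ ζ₂ δ₁ δ₂ : Fin n → ℝ} {C₀ C₁ : ℝ}
  {F : ℝ → V → StrongDual ℝ V}

/-! ### Decay and global existence -/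

theorem LinSol.decay_of_le {R μ : ℝ}
    (hdec : ∀ᵐ t ∂volume.restrict (Ioi (0 : ℝ)), ∀ v, ‖S.emb v‖ ≤ R →
      F t v v - ‖v‖ ^ 2 ≤ -μ * ‖S.emb v‖ ^ 2)
    {a b : ℝ} (ha : 0 ≤ a) {y : ℝ → H} {v : ℝ → V}
    (h : S.LinSol (fun s => F s (v s)) a b y v) (hR : ∀ t ∈ Icc a b, ‖y t‖ ≤ R)
    {s t : ℝ} (has : a ≤ s) (hst : s ≤ t) (htb : t ≤ b) :
    ‖y t‖ ≤ Real.exp (-μ * (t - s)) * ‖y s‖ := by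
  have h' := h.mono has htb
  have key := primitive_exp_decay (m := 2 * μ) hst (E := fun r => ‖y r‖ ^ 2)
    ((intervalIntegrable_iff_integrableOn_Ioc_of_le hst).2 (h'.integrable_energy.const_mul 2))
    (fun r hr => h'.energy_of_mem le_rfl hr.1 hr.2) (by
      filter_upwards [ae_restrict_of_ae_restrict_of_subset
        (Ioc_subset_Ioi_self.trans (Ioi_subset_Ioi (ha.trans has))) hdec, h'.compat,
        ae_restrict_mem measurableSet_Ioc] with r h1 h2 h3
      have h4 := h1 (v r) (by rw [h2]; exact hR r ⟨has.trans h3.1.le, h3.2.trans htb⟩)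
      rw [h2] at h4
      linarith)
  refine le_of_sq_le_sq (key.trans_eq ?_) (by positivity)
  rw [mul_pow, ← Real.exp_nat_mul]
  congr 2
  push_cast
  ring

/-- The dissipation inequality is only available in the ball. Up to the first time `c` at which |y|
reaches R it holds, hence |y(c)| ≤ |y(a)| < R, a contradiction. -/
theorem LinSol.norm_lt {R μ : ℝ} (hμ : 0 ≤ μ)
    (hdec : ∀ᵐ t ∂volume.restrict (Ioi (0 : ℝ)), ∀ v, ‖S.emb v‖ ≤ R →
      F t v v - ‖v‖ ^ 2 ≤ -μ * ‖S.emb v‖ ^ 2)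
    {a b : ℝ} (ha : 0 ≤ a) {y : ℝ → H} {v : ℝ → V}
    (h : S.LinSol (fun s => F s (v s)) a b y v) (hR : ‖y a‖ < R) :
    ∀ t ∈ Icc a b, ‖y t‖ < R := by
  by_contra! hcon
  obtain ⟨t₀, ht₀, hRt₀⟩ := hcon
  have hclosed : IsClosed (Icc a b ∩ {t | R ≤ ‖y t‖}) := by
    have := h.cont.norm.preimage_isClosed_of_isClosed isClosed_Icc (isClosed_Ici (a := R))
    exact this
  have hcomp : IsCompact (Icc a b ∩ {t | R ≤ ‖y t‖}) :=
    isCompact_Icc.of_isClosed_subset hclosed inter_subset_left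
  obtain ⟨c, ⟨hc, hcR⟩, hcmin⟩ := hcomp.exists_isLeast ⟨t₀, ht₀, hRt₀⟩
  have hac : a < c := by
    refine lt_of_le_of_ne hc.1 fun e => ?_
    rw [← e] at hcR
    exact absurd hcR (not_le.2 hR)
  have hlt : ∀ t ∈ Ico a c, ‖y t‖ < R := by
    intro t ht
    by_contra! hge
    exact absurd (hcmin ⟨⟨ht.1, ht.2.le.trans hc.2⟩, hge⟩) (not_le.2 ht.2)
  have hle : ∀ t ∈ Icc a c, ‖y t‖ ≤ R := by
    have hcl : closure (Ico a c) = Icc a c := closure_Ico hac.ne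
    intro t ht
    have hcw : ContinuousWithinAt (fun t => ‖y t‖) (Ico a c) t :=
      (h.cont.norm t ⟨ht.1, ht.2.trans hc.2⟩).mono fun x hx => ⟨hx.1, hx.2.le.trans hc.2⟩
    have hmem := hcw.mem_closure_image (by rw [hcl]; exact ht)
    have hsub : (fun t => ‖y t‖) '' Ico a c ⊆ Iic R := by
      rintro _ ⟨r, hr, rfl⟩; exact (hlt r hr).le
    exact isClosed_Iic.closure_subset_iff.2 hsub hmem
  have h1 := (h.mono le_rfl hc.2).decay_of_le hdec ha hle le_rfl hac.le le_rfl
  have h2 : Real.exp (-μ * (c - a)) ≤ 1 := by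
    rw [Real.exp_le_one_iff]; nlinarith
  have h3 : ‖y c‖ ≤ ‖y a‖ := h1.trans (mul_le_of_le_one_left (norm_nonneg _) h2)
  exact absurd hcR (not_le.2 (h3.trans_lt hR))

/-- The norm stays below R, so local steps of one fixed length τ can be glued indefinitely. -/
theorem IsPert.exists_linSol_of_decay (hE : AdmissibleExponents ζ₁ ζ₂ δ₁ δ₂)
    (hF : S.IsPert ζ₁ ζ₂ δ₁ δ₂ C₀ C₁ F) {R μ : ℝ} (hR : 0 < R) (hμ : 0 ≤ μ)
    (hdec : ∀ᵐ t ∂volume.restrict (Ioi (0 : ℝ)), ∀ v, ‖S.emb v‖ ≤ R →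
      F t v v - ‖v‖ ^ 2 ≤ -μ * ‖S.emb v‖ ^ 2) {y₀ : H} (hy₀ : ‖y₀‖ < R) (T : ℝ) :
    ∃ (y : ℝ → H) (v : ℝ → V), S.LinSol (fun s => F s (v s)) 0 T y v ∧ y 0 = y₀ := by
  obtain ⟨τ, hτ, hloc⟩ := IsPert.exists_local (S := S) hE C₀ C₁ hR
  have hstep : ∀ k : ℕ, ∃ (y : ℝ → H) (v : ℝ → V),
      S.LinSol (fun s => F s (v s)) 0 (k * τ) y v ∧ y 0 = y₀ := by
    intro k
    induction k with
    | zero =>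
      refine ⟨fun _ => y₀, fun _ => 0, ⟨continuousOn_const, ?_, ?_, ?_, fun t ht => ?_⟩, rfl⟩
      · simp
      · simp
      · simp
      · have : t = 0 := le_antisymm (by simpa using ht.2) ht.1
        simp [this]
    | succ k ih =>
      obtain ⟨y, v, h, hy⟩ := ih
      have hk : 0 ≤ k * τ := by positivity
      have hlt := h.norm_lt hμ hdec le_rfl (by rw [hy]; exact hy₀) _ ⟨hk, le_rfl⟩
      obtain ⟨z, w, h', hz⟩ := hloc F hF (k * τ) hk (y (k * τ)) hlt.le
      have hk1 : ((k + 1 : ℕ) : ℝ) * τ = k * τ + τ := by push_cast; ring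
      rw [hk1]
      set u : ℝ → V := fun t => if t ≤ k * τ then v t else w t with hu
      have e1 : S.LinSol (fun s => F s (u s)) 0 (k * τ) y v := by
        refine h.congr ?_ (fun _ _ => rfl) (Eventually.of_forall fun _ => rfl)
        filter_upwards [ae_restrict_mem measurableSet_Ioc] with t ht
        simp [hu, ht.2]
      have e2 : S.LinSol (fun s => F s (u s)) (k * τ) (k * τ + τ) z w := by
        refine h'.congr ?_ (fun _ _ => rfl) (Eventually.of_forall fun _ => rfl)
        filter_upwards [ae_restrict_mem measurableSet_Ioc] with t ht
        simp [hu, not_le.2 ht.1]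
      exact ⟨_, u, e1.trans hk (by linarith) e2 hz, by simp [hk, hy]⟩
  obtain ⟨k, hk⟩ := exists_nat_ge (T / τ)
  obtain ⟨y, v, h, hy⟩ := hstep k
  exact ⟨y, v, h.mono le_rfl (by rwa [div_le_iff₀ hτ] at hk), hy⟩

theorem IsPert.exists_global (hE : AdmissibleExponents ζ₁ ζ₂ δ₁ δ₂)
    (hF : S.IsPert ζ₁ ζ₂ δ₁ δ₂ C₀ C₁ F) {R μ : ℝ} (hR : 0 < R) (hμ : 0 ≤ μ)
    (hdec : ∀ᵐ t ∂volume.restrict (Ioi (0 : ℝ)), ∀ v, ‖S.emb v‖ ≤ R →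
      F t v v - ‖v‖ ^ 2 ≤ -μ * ‖S.emb v‖ ^ 2) {y₀ : H} (hy₀ : ‖y₀‖ < R) :
    ∃ (y : ℝ → H) (v : ℝ → V), y 0 = y₀ ∧ ∀ T ≥ 0, S.LinSol (fun s => F s (v s)) 0 T y v := by
  choose Y W hYW using hF.exists_linSol_of_decay hE hR hμ hdec hy₀
  -- Diagonal choice: by uniqueness the solutions on different intervals agree where both are
  -- defined.
  set y : ℝ → H := fun t => Y t t with hy
  have hyY : ∀ T, EqOn (Y T) y (Icc 0 T) := by
    intro T t ht
    obtain ⟨h1, e1⟩ := hYW T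
    obtain ⟨h2, e2⟩ := hYW t
    exact hF.eqOn_of_linSol hE le_rfl (h1.mono le_rfl ht.2) h2 (e1.trans e2.symm) ⟨ht.1, le_rfl⟩
  -- The V-valued representative is recovered from `y` by injectivity of `emb`, so that one function
  -- serves all T.
  set v : ℝ → V := fun t => Function.invFun S.emb (y t) with hv
  refine ⟨y, v, (hYW 0).2, fun T _ => ?_⟩
  have hvW : W T =ᵐ[volume.restrict (Ioc 0 T)] v := by
    filter_upwards [(hYW T).1.compat, ae_restrict_mem measurableSet_Ioc] with t h1 h2
    rw [hv]
    simp only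
    rw [← hyY T ⟨h2.1.le, h2.2⟩, ← h1, Function.leftInverse_invFun S.emb_injective]
  refine (hYW T).1.congr ?_ (hyY T) hvW
  filter_upwards [hvW] with t ht
  rw [ht]

/-! ### Weak solutions of the closed loop -/

/-- Everything but -Av is treated as the source, with `K` evaluated at emb v instead of y, which
agree almost everywhere. The source is in L²(V') because the full right-hand side and Av are. -/
theorem isWeakSolution_iff {Arc : ℝ → V →L[ℝ] StrongDual ℝ V} {N : ℝ → V → StrongDual ℝ V}
    {K : H → H} {y₀ : H} {y : ℝ → H} :
    S.IsWeakSolution Arc N K y₀ y ↔ y 0 = y₀ ∧ ∃ v : ℝ → V, ∀ T ≥ 0,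
      S.LinSol (fun s => S.incl (K (S.emb (v s))) - Arc s (v s) - N s (v s)) 0 T y v := by
  have hGP : ∀ {v : ℝ → V} {s : ℝ}, S.emb (v s) = y s →
      S.incl (K (y s)) - S.A (v s) - Arc s (v s) - N s (v s) =
        S.incl (K (S.emb (v s))) - Arc s (v s) - N s (v s) - S.A (v s) := by
    intro v s h
    rw [h]
    abel
  have hIoo : ∀ T : ℝ, volume.restrict (Ioo 0 T) = volume.restrict (Ioc 0 T) := fun T =>
    restrict_Ioo_eq_restrict_Ioc
  constructor
  · rintro ⟨hc, h0, v, hv, hv2, hG2, heq⟩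
    -- Weak solutions carry information on (0, T) for T > 0 only; passing through [0, T + 1]
    -- includes T = 0.
    refine ⟨h0, v, fun T hT => LinSol.mono (a := 0) (b := T + 1) ?_ le_rfl (by linarith)⟩
    have hvT : ∀ᵐ t ∂volume.restrict (Ioc 0 (T + 1)), S.emb (v t) = y t :=
      ae_restrict_of_ae_restrict_of_subset Ioc_subset_Ioi_self hv
    have hvm := hv2 (T + 1) (by linarith)
    have hGm := hG2 (T + 1) (by linarith)
    rw [hIoo] at hvm hGm
    refine ⟨hc.mono Icc_subset_Ici_self, hvT, hvm, ?_, fun t ht => ?_⟩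
    · have hAm : MemLp (fun t => S.A (-v t)) 2 (volume.restrict (Ioc 0 (T + 1))) :=
        S.A.comp_memLp' hvm.neg
      refine (memLp_congr_ae ?_).1 (hGm.sub hAm)
      filter_upwards [hvT] with t ht
      rw [Pi.sub_apply, hGP ht, map_neg, sub_neg_eq_add, sub_add_cancel]
    · rw [heq t ht.1, h0, intervalIntegral.integral_of_le ht.1,
        intervalIntegral.integral_of_le ht.1]
      congr 1
      apply integral_congr_ae
      filter_upwards [ae_restrict_of_ae_restrict_of_subset (Ioc_subset_Ioc le_rfl ht.2) hvT]
        with s hs using hGP hs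
  · rintro ⟨h0, v, h⟩
    have hv : ∀ᵐ t ∂volume.restrict (Ioi (0 : ℝ)), S.emb (v t) = y t := by
      have hU : Ioi (0 : ℝ) ⊆ ⋃ k : ℕ, Ioc 0 (k : ℝ) := fun t ht => by
        obtain ⟨k, hk⟩ := exists_nat_ge t
        exact mem_iUnion.2 ⟨k, ht, hk⟩
      refine ae_restrict_of_ae_restrict_of_subset hU ?_
      rw [ae_restrict_iUnion_iff]
      exact fun k => (h k (Nat.cast_nonneg k)).compat
    refine ⟨fun t ht => ?_, h0, v, hv, fun T hT => ?_, fun T hT => ?_, fun t ht => ?_⟩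
    · have ht' : 0 ≤ t := ht
      have h1 := (h (t + 1) (by linarith)).cont t ⟨ht, by linarith⟩
      refine h1.mono_of_mem_nhdsWithin ?_
      rw [← Ici_inter_Iic]
      exact inter_mem_nhdsWithin _ (Iic_mem_nhds (by linarith))
    · rw [hIoo]; exact (h T hT.le).memv
    · rw [hIoo]
      refine (memLp_congr_ae ?_).1 (h T hT.le).mem_rhs
      filter_upwards [(h T hT.le).compat] with s hs using (hGP hs).symm
    · rw [(h t ht).eq t ⟨ht, le_rfl⟩, h0, intervalIntegral.integral_of_le ht,
        intervalIntegral.integral_of_le ht]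
      congr 1
      apply integral_congr_ae
      filter_upwards [(h t ht).compat] with s hs using (hGP hs).symm

theorem isStabilized_of_decay (hE : AdmissibleExponents ζ₁ ζ₂ δ₁ δ₂)
    {Arc : ℝ → V →L[ℝ] StrongDual ℝ V} {N : ℝ → V → StrongDual ℝ V} {K : H → H}
    (hF : S.IsPert ζ₁ ζ₂ δ₁ δ₂ C₀ C₁
      fun t v => S.incl (K (S.emb v)) - Arc t v - N t v)
    {R μ : ℝ} (hR : 0 < R) (hμ : 0 < μ)
    (hdec : ∀ᵐ t ∂volume.restrict (Ioi (0 : ℝ)), ∀ v, ‖S.emb v‖ ≤ R →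
      (S.incl (K (S.emb v)) - Arc t v - N t v) v - ‖v‖ ^ 2 ≤ -μ * ‖S.emb v‖ ^ 2) :
    S.IsStabilized Arc N K R μ := by
  intro y₀ hy₀
  obtain ⟨y, v, h0, hsol⟩ := hF.exists_global hE hR hμ.le hdec hy₀
  have hdecay : ∀ s t : ℝ, 0 ≤ s → s ≤ t → ‖y t‖ ≤ Real.exp (-μ * (t - s)) * ‖y s‖ := by
    intro s t hs hst
    have h := hsol t (hs.trans hst)
    exact h.decay_of_le hdec le_rfl
      (fun r hr => (h.norm_lt hμ.le hdec le_rfl (by rw [h0]; exact hy₀) r hr).le) hs hst le_rfl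
  have hlt : ∀ s t : ℝ, 0 ≤ s → s < t → y s ≠ 0 → ‖y t‖ < ‖y s‖ := by
    intro s t hs hst hys
    refine (hdecay s t hs hst.le).trans_lt (mul_lt_of_lt_one_left (norm_pos_iff.2 hys) ?_)
    rw [Real.exp_lt_one_iff]
    nlinarith
  refine ⟨y, isWeakSolution_iff.2 ⟨h0, v, hsol⟩, fun z hz t ht => ?_, hdecay,
    fun s hs hys => ⟨fun t hst => hlt s t hs hst hys, fun r hr hrs => hlt r s hr hrs ?_⟩⟩
  · obtain ⟨hz0, w, hw⟩ := isWeakSolution_iff.1 hz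
    exact hF.eqOn_of_linSol hE le_rfl (hw t ht) (hsol t ht) (hz0.trans h0.symm) ⟨ht, le_rfl⟩
  -- A solution that vanishes at time r stays zero by the decay estimate.
  · intro hyr
    have := hdecay r s hr hrs.le
    rw [hyr, norm_zero, mul_zero] at this
    exact hys (norm_le_zero_iff.1 this)

end DiffusionSetting

/-! ### Coercivity of positive definite forms in finite dimension. -/

theorem exists_pos_mul_norm_sq_le {E : Type*} [NormedAddCommGroup E] [NormedSpace ℝ E]
    [FiniteDimensional ℝ E] (b : E →L[ℝ] E →L[ℝ] ℝ) (hb : ∀ x, x ≠ 0 → 0 < b x x) :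
    ∃ c > 0, ∀ x, c * ‖x‖ ^ 2 ≤ b x x := by
  rcases subsingleton_or_nontrivial E with h | h
  · exact ⟨1, one_pos, fun x => by simp [Subsingleton.elim x 0]⟩
  have : ProperSpace E := FiniteDimensional.proper ℝ E
  obtain ⟨x₀, hx₀, hmin⟩ := (isCompact_sphere (0 : E) 1).exists_isMinOn
    (NormedSpace.sphere_nonempty.2 zero_le_one) (f := fun x => b x x)
    (by fun_prop)
  have hx₀' : x₀ ≠ 0 := by
    rintro rfl
    simp at hx₀
  refine ⟨b x₀ x₀, hb x₀ hx₀', fun x => ?_⟩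
  rcases eq_or_ne x 0 with rfl | hx
  · simp
  have hn : ‖x‖ ≠ 0 := norm_ne_zero_iff.2 hx
  have h1 : b x₀ x₀ ≤ b (‖x‖⁻¹ • x) (‖x‖⁻¹ • x) := hmin (by simp [norm_smul, hn])
  simp only [map_smul, smul_apply, smul_eq_mul] at h1
  calc b x₀ x₀ * ‖x‖ ^ 2 ≤ ‖x‖⁻¹ * (‖x‖⁻¹ * b x x) * ‖x‖ ^ 2 := by gcongr
    _ = b x x := by field_simp

namespace DiffusionSetting

variable {V H : Type*}
  [NormedAddCommGroup V] [InnerProductSpace ℝ V] [CompleteSpace V]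
  [NormedAddCommGroup H] [InnerProductSpace ℝ H] [CompleteSpace H]
  (S : DiffusionSetting V H)

/-! ### The fractional powers are linear and positive -/

theorem incl_add (g h : H) : S.incl (g + h) = S.incl g + S.incl h := by
  ext; simp [inner_add_left]

theorem incl_smul (c : ℝ) (h : H) : S.incl (c • h) = c • S.incl h := by
  ext; simp [real_inner_smul_left]

noncomputable def fracPowLinear {ρ : ℝ} (hρ : ρ ≤ 1) : V →ₗ[ℝ] StrongDual ℝ V where
  toFun := S.fracPow ρ
  map_add' x y := by
    rw [fracPow, fracPow, fracPow, ← (S.summable_fracPow hρ x).tsum_add (S.summable_fracPow hρ y)]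
    refine tsum_congr fun α => ?_
    rw [← smul_add, ← incl_add, ← map_add, eigenComponent, map_add]
    rfl
  map_smul' c x := by
    rw [fracPow, fracPow, RingHom.id_apply, ← (S.summable_fracPow hρ x).tsum_const_smul]
    refine tsum_congr fun α => ?_
    have h : S.eigenComponent α (c • x) = c • S.eigenComponent α x := map_smul _ _ _
    rw [h, map_smul, incl_smul, smul_comm]

/-- ⟨A^ρ y, y⟩ is the sum of α^ρ |y_α|_H² over the eigenvalues; some component y_α is nonzero
because the eigenspaces span a dense subspace. For α ≤ 0 the component is zero, so the value of α^ρ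
is immaterial. -/
theorem fracPow_apply_self_pos {ρ : ℝ} (hρ : ρ ≤ 1) {y : V} (hy : y ≠ 0) :
    0 < S.fracPow ρ y y := by
  have hmem : ∀ α, S.eigenComponent α y ∈ S.eigenspace α := fun α =>
    (S.eigenspace α).starProjection_apply_mem y
  have hs : HasSum (fun α : ℝ => α ^ ρ * ‖S.emb (S.eigenComponent α y)‖ ^ 2)
      (S.fracPow ρ y y) := by
    have h := (S.summable_fracPow hρ y).hasSum.mapL (ContinuousLinearMap.apply ℝ ℝ y)
    refine (congrArg (HasSum · _) (funext fun α => ?_)).mp h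
    rcases S.eigenspace_eq_zero_or (hmem α) with h0 | ⟨h1, -, -⟩
    · simp [h0]
    · have h2 := S.inner_sub_eigenComponent h1.ne' y (hmem α)
      rw [map_sub, inner_sub_left, real_inner_self_eq_norm_sq, sub_eq_zero, real_inner_comm] at h2
      simp [h2]
  have hnn : ∀ α : ℝ, 0 ≤ α ^ ρ * ‖S.emb (S.eigenComponent α y)‖ ^ 2 := by
    intro α
    rcases S.eigenspace_eq_zero_or (hmem α) with h0 | ⟨h1, -, -⟩
    · simp [h0]
    · have := Real.rpow_nonneg h1.le ρ
      positivity
  obtain ⟨α, hα⟩ : ∃ α, S.eigenComponent α y ≠ 0 := by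
    by_contra! h0
    refine hy ?_
    rw [← Submodule.mem_bot ℝ, ← S.iSup_eigenspace_orthogonal, ← Submodule.iInf_orthogonal,
      Submodule.mem_iInf]
    intro α
    have := (S.eigenspace α).sub_starProjection_mem_orthogonal y
    have h1 : (S.eigenspace α).starProjection y = 0 := h0 α
    rwa [h1, sub_zero] at this
  have hpos : 0 < α ^ ρ * ‖S.emb (S.eigenComponent α y)‖ ^ 2 := by
    rcases S.eigenspace_eq_zero_or (hmem α) with h0 | ⟨h1, -, -⟩
    · exact absurd h0 hα
    · have h2 := Real.rpow_pos_of_pos h1 ρ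
      have h3 : S.emb (S.eigenComponent α y) ≠ 0 := fun h =>
        hα (S.emb_injective (by rw [h, map_zero]))
      have := norm_pos_iff.2 h3
      positivity
  exact hpos.trans_le (le_hasSum hs α fun β _ => hnn β)

/-! ### The feedback operators are coercive -/

section Feedback

variable {U : Submodule ℝ H} {W : Submodule ℝ V} [FiniteDimensional ℝ U] [FiniteDimensional ℝ W]
  (h : IsCompl U (W.map (S.emb : V →ₗ[ℝ] H))ᗮ)

theorem projToV_mem (y : H) : S.projToV U W h y ∈ W := Subtype.property _

theorem sub_emb_projToV_mem (y : H) : y - S.emb (S.projToV U W h y) ∈ Uᗮ := by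
  rw [emb_projToV, ← Submodule.projection_apply_eq_zero_iff (isCompl_swap h), map_sub,
    Submodule.projection_apply_of_mem_left _ (Submodule.projection_apply_mem (isCompl_swap h) y),
    sub_self]

theorem projToV_eq_zero {y : H} (hy : y ∈ Uᗮ) : S.projToV U W h y = 0 := by
  apply S.emb_injective
  rw [emb_projToV, map_zero, Submodule.projection_apply_eq_zero_iff]
  exact hy

/-- (P_U y, y)_H = |P_U y|_H², and Q = `projToV` annihilates U^⊥, so Qy = Q P_U y is bounded by ‖Q‖
|P_U y|_H. Measuring by Qy puts this feedback on the same footing as the oblique one. -/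
theorem exists_orthogonal_coercive :
    ∃ c > 0, ∀ y : H, c * ‖S.projToV U W h y‖ ^ 2 ≤ ⟪U.starProjection y, y⟫ := by
  set Q := S.projToV U W h with hQ
  refine ⟨1 / (‖Q‖ ^ 2 + 1), by positivity, fun y => ?_⟩
  have h1 : y - U.starProjection y ∈ Uᗮ := U.sub_starProjection_mem_orthogonal y
  have h2 : Q y = Q (U.starProjection y) := by
    rw [← sub_eq_zero, ← map_sub]; exact S.projToV_eq_zero h h1
  have h3 : ⟪U.starProjection y, y⟫ = ‖U.starProjection y‖ ^ 2 := by
    have := h1 _ (U.starProjection_apply_mem y)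
    rwa [inner_sub_right, real_inner_self_eq_norm_sq, sub_eq_zero] at this
  have h4 := pow_le_pow_left₀ (norm_nonneg _) (Q.le_opNorm (U.starProjection y)) 2
  rw [h3, h2, one_div_mul_eq_div, div_le_iff₀ (by positivity)]
  rw [mul_pow] at h4
  nlinarith [sq_nonneg ‖U.starProjection y‖]

/-- By the duality defining `projExt`, the form is ⟨A^ρ q, q⟩ with q = Qy in the finite-dimensional
space W, where positivity implies coercivity in the V-norm. Finite dimension also makes the feedback
continuous on H, whatever ρ ≤ 1. -/
theorem exists_oblique_coercive {ρ : ℝ} (hρ : ρ ≤ 1) :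
    ∃ B : H →L[ℝ] H, (∀ y, B y = S.projExt U W h (S.fracPow ρ (S.projToV U W h y))) ∧
      ∃ c > 0, ∀ y : H, c * ‖S.projToV U W h y‖ ^ 2 ≤ ⟪B y, y⟫ := by
  set Q := S.projToV U W h with hQ
  let Q' : H →L[ℝ] W := Q.codRestrict W (S.projToV_mem h)
  let L : W →L[ℝ] StrongDual ℝ V :=
    LinearMap.toContinuousLinearMap ((S.fracPowLinear hρ).comp W.subtype)
  let E : StrongDual ℝ V →ₗ[ℝ] H :=
    { toFun := S.projExt U W h
      map_add' := fun f g => ext_inner_right ℝ fun z => by simp [inner_projExt, inner_add_left]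
      map_smul' := fun r f => ext_inner_right ℝ fun z => by
        simp [inner_projExt, real_inner_smul_left] }
  have hE : Continuous E := (InnerProductSpace.toDual ℝ H).symm.continuous.comp
    ((ContinuousLinearMap.compL ℝ H V ℝ).flip Q).continuous
  let B : H →L[ℝ] H := ContinuousLinearMap.comp ⟨E, hE⟩ (L.comp Q')
  have hB : ∀ y, B y = S.projExt U W h (S.fracPow ρ (Q y)) := fun y => rfl
  refine ⟨B, hB, ?_⟩
  let b : W →L[ℝ] W →L[ℝ] ℝ := ((ContinuousLinearMap.compL ℝ W V ℝ).flip W.subtypeL).comp L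
  have hb : ∀ x : W, b x x = S.fracPow ρ x x := fun x => rfl
  obtain ⟨c, hc, hcb⟩ := exists_pos_mul_norm_sq_le b fun x hx => by
    rw [hb]
    exact S.fracPow_apply_self_pos hρ (by simpa using hx)
  refine ⟨c, hc, fun y => ?_⟩
  rw [hB, inner_projExt]
  exact hcb (Q' y)

/-- The quadratic form `‖v‖_V² + L ‖P_W^{U^⊥} v‖_V²` dominates `K ‖v‖_H²`. -/
theorem mul_norm_emb_sq_le {K L : ℝ} (hK : 0 ≤ K) (hL : 1 + 2 * K * ‖S.emb‖ ^ 2 ≤ L)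
    (hU : ENNReal.ofReal (4 * K) ≤ S.poincareConst U) (v : V) :
    K * ‖S.emb v‖ ^ 2 ≤ ‖v‖ ^ 2 + L * ‖S.projToV U W h (S.emb v)‖ ^ 2 := by
  set q := S.projToV U W h (S.emb v) with hq
  set θ := v - q with hθ
  -- Since θ ∈ U^⊥, the Poincaré constant applies. The 4 compensates two factors 2: from |v|_H² ≤
  -- 2|θ|_H² + 2|q|_H² and from ‖θ‖² ≤ 2‖v‖² + 2‖q‖².
  have h1 : 4 * K * ‖S.emb θ‖ ^ 2 ≤ ‖θ‖ ^ 2 := by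
    by_cases h0 : θ = 0
    · simp [h0]
    have hmem : S.emb θ ∈ Uᗮ := by
      rw [hθ, map_sub]; exact S.sub_emb_projToV_mem h _
    have h2 : ENNReal.ofReal (4 * K) ≤ ENNReal.ofReal (‖θ‖ ^ 2 / ‖S.emb θ‖ ^ 2) :=
      hU.trans (iInf_le_of_le θ (iInf_le_of_le h0 (iInf_le _ hmem)))
    rw [ENNReal.ofReal_le_ofReal_iff (by positivity)] at h2
    have h3 : 0 < ‖S.emb θ‖ := norm_pos_iff.2 fun h =>
      h0 (S.emb_injective (by rw [h, map_zero]))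
    rwa [le_div_iff₀ (by positivity)] at h2
  have h4 : ‖θ‖ ^ 2 ≤ 2 * ‖v‖ ^ 2 + 2 * ‖q‖ ^ 2 := by
    have := pow_le_pow_left₀ (norm_nonneg _) (norm_sub_le v q) 2
    nlinarith [sq_nonneg (‖v‖ - ‖q‖)]
  have h5 : ‖S.emb v‖ ^ 2 ≤ 2 * ‖S.emb θ‖ ^ 2 + 2 * ‖S.emb q‖ ^ 2 := by
    have e : S.emb v = S.emb θ + S.emb q := by rw [hθ, map_sub, sub_add_cancel]
    have := pow_le_pow_left₀ (norm_nonneg _) (norm_add_le (S.emb θ) (S.emb q)) 2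
    rw [← e] at this
    nlinarith [sq_nonneg (‖S.emb θ‖ - ‖S.emb q‖)]
  have h6 : ‖S.emb q‖ ^ 2 ≤ ‖S.emb‖ ^ 2 * ‖q‖ ^ 2 := by
    rw [← mul_pow]; exact pow_le_pow_left₀ (norm_nonneg _) (S.emb.le_opNorm _) 2
  have h7 := mul_le_mul_of_nonneg_left h5 hK
  have h8 := mul_le_mul_of_nonneg_left h6 hK
  have h9 := mul_le_mul_of_nonneg_right hL (sq_nonneg ‖q‖)
  nlinarith

end Feedback

/-! ### The perturbations -/

/-- The norm of the sum space is an infimum that need not be attained, so a decomposition optimal up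
to ε is used and ε is removed at the end. -/
theorem abs_apply_le_of_sumNorm_le {L : V →L[ℝ] StrongDual ℝ V} {C : ℝ≥0} (hL : S.sumNorm L ≤ C)
    (v w : V) : |L v w| ≤ C * (‖S.emb v‖ * ‖w‖ + ‖v‖ * ‖S.emb w‖) := by
  set X := ‖S.emb v‖ * ‖w‖ + ‖v‖ * ‖S.emb w‖ with hX
  have hX0 : 0 ≤ X := by positivity
  refine le_of_forall_pos_le_add fun δ hδ => ?_
  set ε := δ / (X + 1) with hε
  have hε0 : 0 < ε := by positivity
  have hlt : S.sumNorm L < ENNReal.ofReal (C + ε) := by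
    refine hL.trans_lt ?_
    rw [← ENNReal.ofReal_coe_nnreal]
    exact (ENNReal.ofReal_lt_ofReal_iff (by positivity)).2 (by linarith)
  simp only [sumNorm, iInf_lt_iff] at hlt
  obtain ⟨B, D, hBD, hlt⟩ := hlt
  have hlt' := (ENNReal.ofReal_lt_ofReal_iff (by positivity)).1 hlt
  have hB : ‖B‖ ≤ √(‖B‖ ^ 2 + ‖D‖ ^ 2) :=
    Real.le_sqrt_of_sq_le (by linarith [sq_nonneg ‖D‖])
  have hD : ‖D‖ ≤ √(‖B‖ ^ 2 + ‖D‖ ^ 2) :=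
    Real.le_sqrt_of_sq_le (by linarith [sq_nonneg ‖B‖])
  have h1 : |B (S.emb v) w| ≤ ‖B‖ * (‖S.emb v‖ * ‖w‖) := by
    rw [← mul_assoc]
    exact ((B (S.emb v)).le_opNorm w).trans (by gcongr; exact B.le_opNorm _)
  have h2 : |⟪D v, S.emb w⟫| ≤ ‖D‖ * (‖v‖ * ‖S.emb w‖) := by
    rw [← mul_assoc]
    exact (abs_real_inner_le_norm _ _).trans (by gcongr; exact D.le_opNorm _)
  have hεX : ε * X ≤ δ := by
    rw [hε, div_mul_eq_mul_div, div_le_iff₀ (by positivity)]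
    nlinarith
  calc |L v w| = |B (S.emb v) w + ⟪D v, S.emb w⟫| := by rw [hBD]; rfl
    _ ≤ ‖B‖ * (‖S.emb v‖ * ‖w‖) + ‖D‖ * (‖v‖ * ‖S.emb w‖) :=
      (abs_add_le _ _).trans (add_le_add h1 h2)
    _ ≤ (C + ε) * (‖S.emb v‖ * ‖w‖) + (C + ε) * (‖v‖ * ‖S.emb w‖) := by
      gcongr
      · exact hB.trans hlt'.le
      · exact hD.trans hlt'.le
    _ = C * X + ε * X := by rw [hX]; ring
    _ ≤ C * X + δ := by gcongr

section Pert

variable {S} {n : ℕ} {ζ₁ ζ₂ δ₁ δ₂ : Fin n → ℝ}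

theorem IsNonlinearity.ae_pertBound {Arc : ℝ → V →L[ℝ] StrongDual ℝ V} {Crc CN : ℝ≥0}
    {N : ℝ → V → StrongDual ℝ V} (hN : S.IsNonlinearity ζ₁ ζ₂ δ₁ δ₂ CN N)
    (hA : S.IsReactionConvection Arc Crc) :
    ∀ᵐ t ∂volume.restrict (Ioi (0 : ℝ)),
      S.PertBound ζ₁ ζ₂ δ₁ δ₂ Crc CN fun v => -(Arc t v) - N t v := by
  filter_upwards [hN.boundedContinuous, hA.bound, ae_restrict_mem measurableSet_Ioi] with t h1 h2 h3
  obtain ⟨-, i, -, -, hi0, hi⟩ := h1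
  refine ⟨?_, fun v₁ v₂ w => ?_⟩
  · have := hi 0
    rw [norm_zero, hi0] at this
    rw [map_zero, neg_zero, zero_sub, neg_eq_zero]
    exact norm_le_zero_iff.1 this
  · have k1 := S.abs_apply_le_of_sumNorm_le h2 (v₁ - v₂) w
    have k2 : |(N t v₁ - N t v₂) w| ≤ _ := ((N t v₁ - N t v₂).le_opNorm w).trans
      (mul_le_mul_of_nonneg_right (hN.bound t h3 v₁ v₂) (norm_nonneg w))
    have e : (-(Arc t v₁) - N t v₁ - (-(Arc t v₂) - N t v₂)) w =
        -(Arc t (v₁ - v₂) w + (N t v₁ - N t v₂) w) := by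
      simp only [map_sub, sub_apply, neg_apply]
      ring
    rw [e, abs_neg]
    exact (abs_add_le _ _).trans (add_le_add k1 k2)

/-- For well-posedness the feedback is just another bounded linear perturbation. The resulting
constant depends on λ, which is harmless since the decay rate does not use it. -/
theorem PertBound.add_feedback {C₀ C₁ : ℝ} {G : V → StrongDual ℝ V}
    (hG : S.PertBound ζ₁ ζ₂ δ₁ δ₂ C₀ C₁ G) (B : H →L[ℝ] H) :
    S.PertBound ζ₁ ζ₂ δ₁ δ₂ (C₀ + ‖B‖ * ‖S.emb‖) C₁ fun v => S.incl (B (S.emb v)) + G v := by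
  refine ⟨by simp [hG.zero, incl], fun v₁ v₂ w => ?_⟩
  have k1 : |⟪B (S.emb (v₁ - v₂)), S.emb w⟫| ≤ ‖B‖ * ‖S.emb‖ * (‖S.emb (v₁ - v₂)‖ * ‖w‖) := by
    calc |⟪B (S.emb (v₁ - v₂)), S.emb w⟫| ≤ ‖B (S.emb (v₁ - v₂))‖ * ‖S.emb w‖ :=
          abs_real_inner_le_norm _ _
      _ ≤ ‖B‖ * ‖S.emb (v₁ - v₂)‖ * (‖S.emb‖ * ‖w‖) := by
          gcongr
          · exact B.le_opNorm _
          · exact S.emb.le_opNorm _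
      _ = _ := by ring
  have k2 := hG.bound v₁ v₂ w
  have e : (S.incl (B (S.emb v₁)) + G v₁ - (S.incl (B (S.emb v₂)) + G v₂)) w =
      ⟪B (S.emb (v₁ - v₂)), S.emb w⟫ + (G v₁ - G v₂) w := by
    simp only [map_sub, sub_apply, add_apply, incl_apply, inner_sub_left]
    ring
  rw [e]
  have k3 : 0 ≤ ‖B‖ * ‖S.emb‖ * (‖v₁ - v₂‖ * ‖S.emb w‖) := by positivity
  refine (abs_add_le _ _).trans ((add_le_add k1 k2).trans ?_)
  linarith

variable (S) in
/-- The constant with which the perturbations are dominated in the energy estimate. -/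
theorem exists_monotone_energy_const (hE : AdmissibleExponents ζ₁ ζ₂ δ₁ δ₂) :
    ∃ k : ℝ≥0 × ℝ≥0 × ℝ≥0 → ℕ, Monotone k ∧ ∀ (R Crc CN : ℝ≥0) (G : V → StrongDual ℝ V),
      S.PertBound ζ₁ ζ₂ δ₁ δ₂ Crc CN G → ∀ v, ‖S.emb v‖ ≤ R →
        2 * |G v v| ≤ 3 / 2 * ‖v‖ ^ 2 + k (R, Crc, CN) * ‖S.emb v‖ ^ 2 := by
  classical
  let P : ℝ≥0 × ℝ≥0 × ℝ≥0 → ℕ → Prop := fun x k => ∀ G : V → StrongDual ℝ V,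
      S.PertBound ζ₁ ζ₂ δ₁ δ₂ x.2.1 x.2.2 G → ∀ v, ‖S.emb v‖ ≤ x.1 →
        2 * |G v v| ≤ 3 / 2 * ‖v‖ ^ 2 + k * ‖S.emb v‖ ^ 2
  have hP : ∀ x, ∃ k, P x k := by
    intro x
    set r : ℝ := x.1 + 1 with hr
    have hr0 : 0 < r := by positivity
    -- With v₂ = 0, w = v and D = |v|_H, the ε-terms add up to at most ε(r² + 1)‖v‖² = ‖v‖²/2,
    -- whence the 3/2.
    set ε : ℝ := 1 / (2 * (r ^ 2 + 1)) with hε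
    have hε0 : 0 < ε := by positivity
    obtain ⟨C, hC0, hC⟩ := PertBound.exists_energy_bound S hE x.2.1 x.2.2 hr0 hε0
    obtain ⟨k, hk⟩ := exists_nat_ge (2 * C)
    refine ⟨k, fun G hG v hv => ?_⟩
    rcases eq_or_ne v 0 with rfl | hne
    · simp
    have hD : 0 < ‖S.emb v‖ := norm_pos_iff.2 fun h =>
      hne (S.emb_injective (by rw [h, map_zero]))
    have hvr : ‖S.emb v‖ ≤ r := by rw [hr]; linarith
    have h1 := hC G hG v 0 v ‖S.emb v‖ hD (by linarith) hvr (by simpa using hr0.le)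
      (by rw [sub_zero])
    rw [hG.zero, sub_zero, sub_zero, norm_zero] at h1
    have h2 : ‖S.emb v‖ ^ 2 ≤ r ^ 2 := pow_le_pow_left₀ (norm_nonneg _) hvr 2
    have h3 : ε * (r ^ 2 + 1) = 1 / 2 := by rw [hε]; field_simp
    have h4 := mul_le_mul_of_nonneg_right h2 (mul_nonneg hε0.le (sq_nonneg ‖v‖))
    have h5 := mul_le_mul_of_nonneg_right hk (sq_nonneg ‖S.emb v‖)
    have h6 : ε * (r ^ 2 + 1) * ‖v‖ ^ 2 = 1 / 2 * ‖v‖ ^ 2 := by rw [h3]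
    nlinarith
  -- Taking the least admissible natural number gives monotonicity: enlarging the parameters
  -- enlarges the class of maps and vectors, so a number admissible for `y` is admissible for every
  -- x ≤ y.
  refine ⟨fun x => Nat.find (hP x), fun x y hxy => ?_, fun R Crc CN => Nat.find_spec (hP (R, Crc, CN))⟩
  refine Nat.find_min' _ fun G hG v hv => ?_
  exact Nat.find_spec (hP y) G (hG.mono hxy.2.1 hxy.2.2) v (hv.trans (by exact_mod_cast hxy.1))

/-- Twice the dissipation is at most -‖v‖²/2 + k|v|_H² - 2λc‖Qv‖². Half of `mul_norm_emb_sq_le` with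
K = 2k + 4μ and L = 4λc bounds this by -2μ|v|_H². -/
theorem isStabilized_of_coercive (hE : AdmissibleExponents ζ₁ ζ₂ δ₁ δ₂)
    {U : Submodule ℝ H} {W : Submodule ℝ V} [FiniteDimensional ℝ U] [FiniteDimensional ℝ W]
    (h : IsCompl U (W.map (S.emb : V →ₗ[ℝ] H))ᗮ)
    {Arc : ℝ → V →L[ℝ] StrongDual ℝ V} {Crc CN : ℝ≥0} {N : ℝ → V → StrongDual ℝ V}
    (hA : S.IsReactionConvection Arc Crc) (hN : S.IsNonlinearity ζ₁ ζ₂ δ₁ δ₂ CN N)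
    {R μ k c lam : ℝ} (hR : 0 < R) (hμ : 0 < μ) (hk0 : 0 ≤ k) (hlam : 0 < lam)
    (hk : ∀ G : V → StrongDual ℝ V, S.PertBound ζ₁ ζ₂ δ₁ δ₂ Crc CN G → ∀ v, ‖S.emb v‖ ≤ R →
        2 * |G v v| ≤ 3 / 2 * ‖v‖ ^ 2 + k * ‖S.emb v‖ ^ 2)
    (hU : ENNReal.ofReal (4 * (2 * k + 4 * μ)) ≤ S.poincareConst U)
    (hclam : 1 + 2 * (2 * k + 4 * μ) * ‖S.emb‖ ^ 2 ≤ 4 * (lam * c))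
    {B : H →L[ℝ] H} (hB : ∀ y : H, c * ‖S.projToV U W h y‖ ^ 2 ≤ ⟪B y, y⟫) {K : H → H}
    (hK : ∀ y, K y = -lam • B y) :
    S.IsStabilized Arc N K R μ := by
  have hae := hN.ae_pertBound hA
  have hKB : K = (-lam • B : H →L[ℝ] H) := funext hK
  have hform : ∀ t v, S.incl (K (S.emb v)) - Arc t v - N t v =
      S.incl ((-lam • B : H →L[ℝ] H) (S.emb v)) + (-(Arc t v) - N t v) := by
    intro t v
    rw [hKB]; abel
  have hF : S.IsPert ζ₁ ζ₂ δ₁ δ₂ (Crc + ‖(-lam • B : H →L[ℝ] H)‖ * ‖S.emb‖) CN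
      fun t v => S.incl (K (S.emb v)) - Arc t v - N t v := by
    constructor
    · filter_upwards [hae] with t ht
      simp only [hform]
      exact ht.add_feedback _
    · intro v
      exact (aestronglyMeasurable_const.sub (hA.aestronglyMeasurable v)).sub
        (hN.locallyIntegrable v).aestronglyMeasurable
  refine isStabilized_of_decay hE hF hR hμ ?_
  filter_upwards [hae] with t ht v hv
  have h1 := hk _ ht v hv
  have h2 := le_abs_self ((-(Arc t v) - N t v) v)
  have h3 := S.mul_norm_emb_sq_le h (by positivity) hclam hU v
  have h4 := mul_le_mul_of_nonneg_left (hB (S.emb v)) hlam.le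
  have h5 : S.incl ((-lam • B : H →L[ℝ] H) (S.emb v)) v = -(lam * ⟪B (S.emb v), S.emb v⟫) := by
    rw [incl_apply, smul_apply, real_inner_smul_left, neg_mul]
  rw [hform, add_apply, h5]
  nlinarith

end Pert

end DiffusionSetting

/-! ### The main theorem: choice of the thresholds for M and λ. -/

theorem corollary3p7 {V H : Type*}
    [NormedAddCommGroup V] [InnerProductSpace ℝ V] [CompleteSpace V]
    [NormedAddCommGroup H] [InnerProductSpace ℝ H] [CompleteSpace H]
    (S : DiffusionSetting V H)
    (σ : ℕ+ → ℕ+) (hσ : StrictMono σ)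
    (Φ : ∀ M : ℕ+, Fin (σ M) → H) (hΦ : ∀ M, LinearIndependent ℝ (Φ M))
    (hPoincare : Tendsto (fun M => S.poincareConst (Submodule.span ℝ (range (Φ M)))) atTop (𝓝 ⊤))
    (Ψ : ∀ M : ℕ+, Fin (σ M) → V) (hΨ : ∀ M, LinearIndependent ℝ (Ψ M))
    (hdir : ∀ M, IsCompl (Submodule.span ℝ (range (Φ M)))
      ((Submodule.span ℝ (range (Ψ M))).map (S.emb : V →ₗ[ℝ] H))ᗮ)
    (n : ℕ) (ζ₁ ζ₂ δ₁ δ₂ : Fin n → ℝ)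
    (hζ₁ : ∀ j, 0 ≤ ζ₁ j) (hζ₂ : ∀ j, 0 ≤ ζ₂ j) (hδ₁ : ∀ j, 0 ≤ δ₁ j) (hδ₂ : ∀ j, 0 ≤ δ₂ j)
    (hlt : ∀ j, ζ₂ j + δ₂ j < 1) (hge : ∀ j, 1 ≤ δ₁ j + δ₂ j)
    (ρ : ℝ) (hρ : ρ ≤ 1) :
    ∃ (Mbar : ℝ≥0 × ℝ≥0 × ℝ≥0 × ℝ≥0 → ℕ+) (lamBar : ℕ+ × ℝ≥0 × ℝ≥0 × ℝ≥0 × ℝ≥0 → ℝ≥0),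
      Monotone Mbar ∧ Monotone lamBar ∧
      ∀ (R μ Crc CN : ℝ≥0), 0 < R → 0 < μ →
      ∀ Arc : ℝ → V →L[ℝ] StrongDual ℝ V, S.IsReactionConvection Arc Crc →
      ∀ N : ℝ → V → StrongDual ℝ V, S.IsNonlinearity ζ₁ ζ₂ δ₁ δ₂ CN N →
      ∀ M : ℕ+, Mbar (R, μ, Crc, CN) ≤ M →
      ∀ lam : ℝ, 0 < lam → lamBar (M, R, μ, Crc, CN) ≤ lam →
        S.IsStabilized Arc N
          (DiffusionSetting.orthogonalFeedback (Submodule.span ℝ (range (Φ M))) lam) R μ ∧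
        S.IsStabilized Arc N
          (S.obliqueFeedback (Submodule.span ℝ (range (Φ M))) (Submodule.span ℝ (range (Ψ M)))
            (hdir M) ρ lam) R μ := by
  have hE : AdmissibleExponents ζ₁ ζ₂ δ₁ δ₂ := ⟨hζ₁, hζ₂, hδ₁, hδ₂, hlt, hge⟩
  obtain ⟨k, hkmono, hk⟩ := DiffusionSetting.exists_monotone_energy_const S hE
  set U : ℕ+ → Submodule ℝ H := fun M => Submodule.span ℝ (range (Φ M))
  set W : ℕ+ → Submodule ℝ V := fun M => Submodule.span ℝ (range (Ψ M))
  choose c₁ hc₁ hcb₁ using fun M => S.exists_orthogonal_coercive (hdir M)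
  choose B hB c₂ hc₂ hcb₂ using fun M => S.exists_oblique_coercive (hdir M) hρ
  set c : ℕ+ → ℝ := fun M => min (c₁ M) (c₂ M) with hc
  have hc0 : ∀ M, 0 < c M := fun M => lt_min (hc₁ M) (hc₂ M)
  set κ : ℝ≥0 × ℝ≥0 × ℝ≥0 × ℝ≥0 → ℝ := fun x =>
    2 * (k (x.1, x.2.2.1, x.2.2.2) : ℝ) + 4 * x.2.1 with hκ
  have hκ0 : ∀ x, 0 ≤ κ x := fun x => by positivity
  have hκmono : Monotone κ := fun x y hxy => by
    have h1 : k (x.1, x.2.2.1, x.2.2.2) ≤ k (y.1, y.2.2.1, y.2.2.2) :=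
      hkmono ⟨hxy.1, hxy.2.2.1, hxy.2.2.2⟩
    have h2 : (x.2.1 : ℝ) ≤ y.2.1 := by exact_mod_cast hxy.2.1
    simp only [hκ]
    gcongr
  have hM : ∀ x, ∃ M : ℕ+, ∀ M' ≥ M, ENNReal.ofReal (4 * κ x) ≤ S.poincareConst (U M') := fun x =>
    eventually_atTop.1 (hPoincare.eventually (eventually_ge_nhds ENNReal.ofReal_lt_top))
  classical
  -- The M-threshold is the least index beyond which the Poincaré constants stay above 4κ, hence
  -- monotone in κ. The coercivity constants `c i` need not be monotone in i; summing the required λ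
  -- over all i ≤ M gives a threshold nondecreasing in M.
  refine ⟨fun x => PNat.find (hM x), fun x => Real.toNNReal (∑ i ∈ Finset.Icc 1 x.1,
    (1 + 2 * κ x.2 * ‖S.emb‖ ^ 2) / (4 * c i)), ?_, ?_, ?_⟩
  · intro x y hxy
    refine PNat.find_min' _ fun M' hM' => le_trans ?_ (PNat.find_spec (hM y) M' hM')
    exact ENNReal.ofReal_le_ofReal (mul_le_mul_of_nonneg_left (hκmono hxy) (by norm_num))
  · intro x y hxy
    refine Real.toNNReal_le_toNNReal ?_
    have hpos : ∀ z i, 0 ≤ (1 + 2 * κ z * ‖S.emb‖ ^ 2) / (4 * c i) := fun z i => by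
      have := hc0 i
      have := hκ0 z
      positivity
    refine (Finset.sum_le_sum_of_subset_of_nonneg (Finset.Icc_subset_Icc le_rfl hxy.1)
      fun i _ _ => hpos _ i).trans (Finset.sum_le_sum fun i _ => ?_)
    have h1 := hκmono hxy.2
    have := hc0 i
    gcongr
  · intro R μ Crc CN hR hμ Arc hA N hN M hMle lam hlam0 hlam
    have hU := PNat.find_spec (hM (R, μ, Crc, CN)) M hMle
    have hle : (1 + 2 * κ (R, μ, Crc, CN) * ‖S.emb‖ ^ 2) / (4 * c M) ≤ lam := by
      refine le_trans ?_ ((Real.le_coe_toNNReal _).trans hlam)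
      refine Finset.single_le_sum (f := fun i => (1 + 2 * κ (R, μ, Crc, CN) * ‖S.emb‖ ^ 2) /
        (4 * c i)) (fun i _ => ?_) (Finset.mem_Icc.2 ⟨one_le, le_rfl⟩)
      have := hc0 i
      have := hκ0 (R, μ, Crc, CN)
      positivity
    rw [div_le_iff₀ (mul_pos (by norm_num) (hc0 M))] at hle
    have hle' : 1 + 2 * κ (R, μ, Crc, CN) * ‖S.emb‖ ^ 2 ≤ 4 * (lam * c M) := by linarith
    constructor
    · refine DiffusionSetting.isStabilized_of_coercive hE (hdir M) hA hN (by exact_mod_cast hR)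
        (by exact_mod_cast hμ) (Nat.cast_nonneg _) hlam0 (hk R Crc CN) hU hle'
        (B := (U M).starProjection) (fun y => le_trans ?_ (hcb₁ M y)) (fun y => rfl)
      exact mul_le_mul_of_nonneg_right (min_le_left _ _) (sq_nonneg _)
    · refine DiffusionSetting.isStabilized_of_coercive hE (hdir M) hA hN (by exact_mod_cast hR)
        (by exact_mod_cast hμ) (Nat.cast_nonneg _) hlam0 (hk R Crc CN) hU hle'
        (B := B M) (fun y => le_trans ?_ (hcb₂ M y))
        (fun y => by rw [hB]; rfl)
      exact mul_le_mul_of_nonneg_right (min_le_right _ _) (sq_nonneg _)
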